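/- Let $X=\Gamma_X\backslash\mathbb{H}$ be a non-compact hyperbolic Riemann orbisurface of finite volume, where $\Gamma_X\subset\mathrm{PSL}_2(\mathbb{R})$ is a Fuchsian group of the first kind. Let $g_X$ be its genus, $\mathrm{vol}(X)$ its hyperbolic volume, $\mathcal{P}_X$ and $\mathcal{E}_X$ the finite sets of its cusps and of its elliptic fixed points (with fixed representatives in $\mathbb{R}\cup\{\infty\}$ and in $\mathbb{H}$), $m_{\mathfrak e}$ the order of $\mathfrak e\in\mathcal{E}_X$, and $\Gamma_{X,p}$, $\Gamma_{X,\mathfrak e}$ the stabilizers. For $p\in\mathcal{P}_X$ let $\sigma_p$ be a scaling matrix, i.e. $\sigma_p\infty=p$ and $\sigma_p^{-1}\Gamma_{X,p}\sigma_p=\langle z\mapsto z+1\rangle$. Put $$\mathcal{E}_{X,\mathrm{par},p}(z,2)=\sum_{\eta\in\Gamma_{X,p}\backslash\Gamma_X}\mathrm{Im}(\sigma_p^{-1}\eta z)^2,\qquad \mathcal{E}_{X,\mathrm{ell},\mathfrak e}(z,2)=\sum_{\eta\in\Gamma_{X,\mathfrak e}\backslash\Gamma_X}\sinh^{-2}\big(d_{\mathbb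 H}(\eta z,\mathfrak e)\big),$$ $$P_X(z)=\sum_{\gamma\in\Gamma_X\text{ parabolic}}\log\Big|\frac{z-\overline{\gamma z}}{z-\gamma z}\Big|^2,\qquad \Delta_{\mathrm{hyp}}=-y^2\Big(\frac{\partial^2}{\partial x^2}+\frac{\partial^2}{\partial y^2}\Big),$$ and $$C_{X,\mathrm{par}}=\sup_{z\in X}\sum_{p\in\mathcal{P}_X}\big(\mathcal{E}_{X,\mathrm{par},p}(z,2)-\mathrm{Im}(\sigma_p^{-1}z)^2\big),\qquad C^{\mathrm{aux}}_{X,\mathrm{par}}=\sup_{z\in X}|\Delta_{\mathrm{hyp}}P_X(z)|,$$ $$c_{X,\mathrm{ell}}=\max\{1/\sin^2(n\pi/m_{\mathfrak e}) : \mathfrak e\in\mathcal{E}_X,\ 0<n<m_{\mathfrak e}\}\quad(=0\text{ if }\mathcal{E}_X=\emptyset),$$ $$C_{X,\mathrm{ell}}=\sup_{z\in X\setminus\mathcal{E}_X}c_{X,\mathrm{ell}}\sum_{\mathfrak e\in\mathcal{E}_X}(m_{\mathfrak e}-1)\big(\mathcal{E}_{X,\mathrm{ell},\mathfrak e}(z,2)-\sinh^{-2}(d_{\mathbb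 H}(z,\mathfrak e))\big).$$ In $C_{X,\mathrm{par}}$ and $C_{X,\mathrm{ell}}$, $X$ is identified with a fundamental domain $F\subset\mathbb{H}$ whose cusps and elliptic vertices are the chosen representatives, in the following sense. Call $0<\varepsilon<1$ admissible if it is smaller than the length of the shortest closed geodesic of $X$; if $\mathrm{Im}(\sigma_p^{-1}\gamma z)\le\mathrm{Im}(\sigma_p^{-1}z)$ for all $p\in\mathcal{P}_X$, $\gamma\in\Gamma_X$ and $z\in U_\varepsilon(p)=\{|e^{2\pi i\sigma_p^{-1}z}|<\varepsilon\}$; if $d_{\mathbb H}(z,\gamma\mathfrak e)\ge\varepsilon$ for all $\mathfrak e\in\mathcal{E}_X$, $\gamma\in\Gamma_X$ and $z$ with $d_{\mathbb H}(z,\mathfrak e)=\varepsilon$; and if the images in $X$ of the disks $U_\varepsilon(p)$ and $U_\varepsilon(\mathfrak e)=\{d_{\mathbb H}(z,\mathfrak e)<\varepsilon\}$ are pairwise disjoint. Then, for all admissible $\varepsilon$, a point of $F$ whose image in $X$ lies in the image of $U_\varepsilon(p)$ (of $U_\varepsilon(\mathfrak e)$) lies itself in $U_\varepsilon(p)$ (in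 $U_\varepsilon(\mathfrak e)$). A family $\{X_N\}_{N\in\mathcal{N}}$, $\mathcal{N}\subseteq\mathbb{N}$, of such orbisurfaces of genus $\ge1$ is admissible if either (1) $\mathcal{N}=\mathbb{N}$ and each $X_{N+1}$ is a finite degree cover of $X_N$ (up to conjugation, $\Gamma_{X_{N+1}}$ is a finite index subgroup of $\Gamma_{X_N}$), and then $q_{\mathcal N}=0$; or (2) $\mathcal{N}\subseteq\mathbb{N}_{>0}$ and $X_N=\Gamma_0(N)\backslash\mathbb{H}$ for all $N\in\mathcal N$, or $X_N=\Gamma_1(N)\backslash\mathbb{H}$ for all $N\in\mathcal N$, or $X_N=\Gamma(N)\backslash\mathbb{H}$ for all $N\in\mathcal N$, and then $q_{\mathcal N}$ is any element of $\mathcal N$ (for instance its smallest prime). Then there is a constant $C$ that depends only on $X_{q_{\mathcal N}}$ such that for every admissible family with this base surface and every $N\in\mathcal{N}$: (i) $C_{X_N,\mathrm{par}}\le C$; (ii) the series $P_{X_N}$ converges absolutely to a $C^2$ function, and $C^{\mathrm{aux}}_{X_N,\mathrm{par}}\le C$; (iii) $c_{X_N,\mathrm{ell}}\le C$ and $$\frac{5\,c_{X_N,\mathrm{ell}}}{g_{X_N}\mathrm{vol}(X_N)}\sum_{\mathfrak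 e\in\mathcal{E}_{X_N}}(m_{\mathfrak e}-1)\le C\,\frac{|\mathcal{E}_{X_N}|}{g_{X_N}};$$ (iv) $C_{X_N,\mathrm{ell}}\le C$. -/

import Mathlib

open UpperHalfPlane MeasureTheory
open scoped MatrixGroups ENNReal NNReal

noncomputable section

namespace Orbisurface

/-- A subgroup of `PSL₂(ℝ)`, represented by its full preimage in `SL₂(ℝ) ⊂ GL₂(ℝ)`,
i.e. by a group of matrices of determinant one that contains `-1`. -/
structure PSLSubgroup where
  /-- The preimage in `SL₂(ℝ)`. -/
  grp : Subgroup (GL (Fin 2) ℝ)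
  det_eq_one : ∀ γ ∈ grp, γ.det = 1
  neg_one_mem : -1 ∈ grp

instance (Γ : PSLSubgroup) : Γ.grp.HasDetOne := ⟨fun hg => Γ.det_eq_one _ hg⟩

/-- The image in `PSL₂(ℝ)` of a subgroup of `SL₂(ℤ)`. -/
def ofSL2Z (H : Subgroup SL(2, ℤ)) : PSLSubgroup where
  grp := (H.map (Matrix.SpecialLinearGroup.mapGL ℝ)).adjoinNegOne
  det_eq_one γ hγ := by
    rcases Subgroup.mem_adjoinNegOne_iff.mp hγ with h | h
    · exact Subgroup.HasDetOne.det_eq h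
    · have h2 : (-γ).det = 1 := Subgroup.HasDetOne.det_eq h
      rw [Units.ext_iff] at h2 ⊢
      simpa [Matrix.det_fin_two] using h2
  neg_one_mem := Subgroup.negOne_mem_adjoinNegOne _

variable (Γ : PSLSubgroup)

/-! ### The quotient `X = Γ \ ℍ` and its compactification -/

/-- `z` is a fixed point of an elliptic element of `Γ`. -/
def IsEllipticPoint (z : ℍ) : Prop := ∃ γ ∈ Γ.grp, γ.IsElliptic ∧ γ • z = z

/-- The order of `z`: the order of its stabilizer in `PSL₂(ℝ)`, half of the order of the
stabilizer in the preimage in `SL₂(ℝ)`. -/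
def order (z : ℍ) : ℕ := Nat.card (MulAction.stabilizer Γ.grp z) / 2

/-- The extended half-plane `ℍ* = ℍ ∪ {cusps of Γ}`. -/
inductive ExtHalfPlane : Type
  | point (z : ℍ) : ExtHalfPlane
  | cusp (c : OnePoint ℝ) (hc : IsCusp c Γ.grp) : ExtHalfPlane

/-- The usual topology of `ℍ*`: `U` is open if `U ∩ ℍ` is open and if `U` contains, with each
cusp `c = g ∞`, some horoball `{z | T < Im (g⁻¹ z)}` at `c`. -/
instance : TopologicalSpace (ExtHalfPlane Γ) where
  IsOpen U := IsOpen {z : ℍ | ExtHalfPlane.point z ∈ U} ∧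
    ∀ (c : OnePoint ℝ) (hc : IsCusp c Γ.grp), ExtHalfPlane.cusp c hc ∈ U →
      ∀ g : GL (Fin 2) ℝ, g.det = 1 → g • (OnePoint.infty : OnePoint ℝ) = c →
        ∃ T : ℝ, ∀ z : ℍ, T < (g⁻¹ • z).im → ExtHalfPlane.point z ∈ U
  isOpen_univ := ⟨by simp, fun _ _ _ _ _ _ => ⟨0, fun _ _ => Set.mem_univ _⟩⟩
  isOpen_inter U V hU hV := by
    refine ⟨hU.1.inter hV.1, fun c hc hcU g hg hgc => ?_⟩
    obtain ⟨T, hT⟩ := hU.2 c hc hcU.1 g hg hgc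
    obtain ⟨S, hS⟩ := hV.2 c hc hcU.2 g hg hgc
    exact ⟨max T S, fun z hz =>
      ⟨hT z ((le_max_left _ _).trans_lt hz), hS z ((le_max_right _ _).trans_lt hz)⟩⟩
  isOpen_sUnion S hS := by
    refine ⟨?_, fun c hc hcS g hg hgc => ?_⟩
    · have : {z : ℍ | ExtHalfPlane.point z ∈ ⋃₀ S} =
          ⋃ U ∈ S, {z : ℍ | (ExtHalfPlane.point z : ExtHalfPlane Γ) ∈ U} := by ext; simp
      rw [this]
      exact isOpen_biUnion fun U hU => (hS U hU).1
    · obtain ⟨U, hU, hcU⟩ := hcS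
      obtain ⟨T, hT⟩ := (hS U hU).2 c hc hcU g hg hgc
      exact ⟨T, fun z hz => ⟨U, hU, hT z hz⟩⟩

/-- Equivalence of points of `ℍ*` under `Γ`. -/
def extRel : ExtHalfPlane Γ → ExtHalfPlane Γ → Prop
  | .point z, .point w => ∃ γ ∈ Γ.grp, γ • z = w
  | .cusp c _, .cusp d _ => ∃ γ ∈ Γ.grp, γ • c = d
  | _, _ => False

/-- A Fuchsian group of the first kind: a discrete group `Γ` with `Γ \ ℍ*` compact. -/
structure IsFuchsianFirstKind : Prop where
  discrete : DiscreteTopology Γ.grp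
  compact : CompactSpace (Quot (extRel Γ))

/-- The hyperbolic area of `X = Γ \ ℍ`: the infimum, attained at the measurable fundamental
domains, of the areas `∫ dx dy / y²` of the measurable sets that meet all the orbits. -/
def hypVol : ℝ≥0∞ :=
  ⨅ (S : Set ℍ) (_ : MeasurableSet S ∧ ∀ z : ℍ, ∃ γ ∈ Γ.grp, γ • z ∈ S), volume S

/-- The genus of `X`: the dimension of the space `S₂(Γ)` of cusp forms of weight two, that is,
of the holomorphic differentials of the compact Riemann surface `Γ \ ℍ*`. -/
def genus : ℕ := Module.finrank ℂ (CuspForm Γ.grp 2)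

/-- `X = Γ \ ℍ` is a non-compact hyperbolic Riemann orbisurface of finite volume, of genus at
least one, with `Γ` a Fuchsian group of the first kind. -/
structure IsOrbisurface : Prop where
  firstKind : IsFuchsianFirstKind Γ
  noncompact : NoncompactSpace (Quotient (MulAction.orbitRel Γ.grp ℍ))
  finite_volume : hypVol Γ < ∞
  one_le_genus : 1 ≤ genus Γ

/-- The length `ℓ_X` of the shortest closed geodesic: the infimum of `d(z, γ z)` over the
hyperbolic elements `γ` of `Γ`. -/
def shortestGeodesic : ℝ≥0∞ :=
  ⨅ (γ : GL (Fin 2) ℝ) (_ : γ ∈ Γ.grp ∧ γ.IsHyperbolic) (z : ℍ), edist z (γ • z)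

/-! ### Cusps, elliptic fixed points, and fundamental domains -/

/-- Representatives in `ℝ ∪ {∞}` and in `ℍ` of the cusps and of the elliptic fixed points of
`X`, with scaling matrices for the cusps. -/
structure Marking where
  /-- The set `𝒫_X`. -/
  cusps : Set (OnePoint ℝ)
  isCusp : ∀ p ∈ cusps, IsCusp p Γ.grp
  cusps_repr : ∀ c, IsCusp c Γ.grp → ∃! p, p ∈ cusps ∧ ∃ γ ∈ Γ.grp, γ • c = p
  /-- The scaling matrices `σ_p`. -/
  scal : OnePoint ℝ → GL (Fin 2) ℝ
  scal_det : ∀ p ∈ cusps, (scal p).det = 1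
  scal_infty : ∀ p ∈ cusps, scal p • (OnePoint.infty : OnePoint ℝ) = p
  /-- `σ_p⁻¹ Γ_p σ_p` is generated, up to sign, by the translation `z ↦ z + 1`. -/
  scal_stabilizer : ∀ p ∈ cusps, ∀ γ : GL (Fin 2) ℝ, (γ ∈ Γ.grp ∧ γ • p = p) ↔
    ∃ n : ℤ, (scal p)⁻¹ * γ * scal p = Matrix.GeneralLinearGroup.upperRightHom (n : ℝ) ∨
      (scal p)⁻¹ * γ * scal p = -Matrix.GeneralLinearGroup.upperRightHom (n : ℝ)
  /-- The set `ℰ_X`. -/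
  ells : Set ℍ
  isElliptic : ∀ e ∈ ells, IsEllipticPoint Γ e
  ells_repr : ∀ w, IsEllipticPoint Γ w → ∃! e, e ∈ ells ∧ ∃ γ ∈ Γ.grp, γ • w = e

variable {Γ}

/-- The coordinate disk `|exp (2πi σ_p⁻¹ z)| < ε` around the cusp `p`. -/
def Marking.cuspDisk (M : Marking Γ) (ε : ℝ) (p : OnePoint ℝ) : Set ℍ :=
  {z | Real.exp (-(2 * Real.pi * ((M.scal p)⁻¹ • z).im)) < ε}

/-- The conditions on a radius `ε`: at each cusp the height `Im (σ_p⁻¹ z)` is maximal in the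
orbit of each point of the disk of radius `ε` around `p`, and the disks of radius `ε` around the
cusps and the elliptic fixed points are embedded in `X` (up to the stabilizers) and pairwise
disjoint there. -/
structure Marking.IsAdmissibleRadius (M : Marking Γ) (ε : ℝ) : Prop where
  pos : 0 < ε
  lt_one : ε < 1
  lt_geodesic : ENNReal.ofReal ε < shortestGeodesic Γ
  cusp_max : ∀ p ∈ M.cusps, ∀ z ∈ M.cuspDisk ε p, ∀ γ ∈ Γ.grp,
    ((M.scal p)⁻¹ • γ • z).im ≤ ((M.scal p)⁻¹ • z).im
  cusp_cusp : ∀ p ∈ M.cusps, ∀ q ∈ M.cusps, p ≠ q → ∀ z ∈ M.cuspDisk ε p, ∀ γ ∈ Γ.grp,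
    γ • z ∉ M.cuspDisk ε q
  ell_ell : ∀ e ∈ M.ells, ∀ f ∈ M.ells, e ≠ f → ∀ z ∈ Metric.ball e ε, ∀ γ ∈ Γ.grp,
    γ • z ∉ Metric.ball f ε
  ell_self : ∀ e ∈ M.ells, ∀ z : ℍ, dist z e = ε → ∀ γ ∈ Γ.grp, ε ≤ dist z (γ • e)
  cusp_ell : ∀ p ∈ M.cusps, ∀ e ∈ M.ells, ∀ z ∈ M.cuspDisk ε p, ∀ γ ∈ Γ.grp,
    γ • z ∉ Metric.ball e ε

/-- `F` is a fundamental domain of `Γ` whose cusps and elliptic vertices are the chosen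
representatives: the points of `F` over the disk of admissible radius around a cusp (an elliptic
fixed point) of `X` lie in the disk around its representative, not in a translate of that disk. -/
structure Marking.IsFundamentalDomain (M : Marking Γ) (F : Set ℍ) : Prop where
  covers : ∀ z : ℍ, ∃ γ ∈ Γ.grp, γ • z ∈ F
  disjoint : ∀ γ ∈ Γ.grp, γ ≠ 1 → γ ≠ -1 → ∀ z ∈ interior F, γ • z ∉ interior F
  cusp_mem : ∀ ε, M.IsAdmissibleRadius ε → ∀ p ∈ M.cusps, ∀ z ∈ F, ∀ γ ∈ Γ.grp,
    γ • z ∈ M.cuspDisk ε p → z ∈ M.cuspDisk ε p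
  ell_mem : ∀ ε, M.IsAdmissibleRadius ε → ∀ e ∈ M.ells, ∀ z ∈ F, ∀ γ ∈ Γ.grp,
    γ • z ∈ Metric.ball e ε → z ∈ Metric.ball e ε

/-! ### Eisenstein series and the constants -/

/-- The parabolic Eisenstein series `∑_{η ∈ Γ_p \ Γ} Im (σ_p⁻¹ η z) ^ s` for real `s`, with
values in `[0, ∞]`. The terms do not depend on the representatives of the cosets. -/
def Marking.eisPar (M : Marking Γ) (p : OnePoint ℝ) (z : ℍ) (s : ℝ) : ℝ≥0∞ :=
  ∑' η : Quotient (QuotientGroup.rightRel (MulAction.stabilizer Γ.grp p)),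
    ENNReal.ofReal (((M.scal p)⁻¹ • η.out • z).im) ^ s

/-- The elliptic Eisenstein series `∑_{η ∈ Γ_e \ Γ} sinh (ρ (σ_e⁻¹ η z)) ^ (-s)` for real `s`,
with values in `[0, ∞]`. As `σ_e` maps `i` to `e`, the distance `ρ (σ_e⁻¹ w)` from `σ_e⁻¹ w` to `i`
is `d(w, e)`. -/
def eisEll (Γ : PSLSubgroup) (e z : ℍ) (s : ℝ) : ℝ≥0∞ :=
  ∑' η : Quotient (QuotientGroup.rightRel (MulAction.stabilizer Γ.grp e)),
    ENNReal.ofReal (Real.sinh (dist (η.out • z) e)) ^ (-s)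

/-- `C_{X,par}`, the supremum being taken over a fundamental domain `F`. -/
def Marking.constPar (M : Marking Γ) (F : Set ℍ) : ℝ≥0∞ :=
  ⨆ z ∈ F, ∑' p : M.cusps,
    (M.eisPar p z 2 - ENNReal.ofReal (((M.scal p)⁻¹ • z).im) ^ (2 : ℝ))

/-- `c_{X,ell}`, the maximum of `1 / sin² (nπ / m_e)`; it is `0` if there are no elliptic fixed
points. -/
def Marking.smallConstEll (M : Marking Γ) : ℝ≥0∞ :=
  ⨆ e ∈ M.ells, ⨆ n ∈ Set.Ioo 0 (order Γ e),
    ENNReal.ofReal (1 / Real.sin (n * Real.pi / order Γ e) ^ 2)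

/-- `C_{X,ell}`, the supremum being taken over a fundamental domain `F` without the elliptic fixed
points, where the elliptic Eisenstein series have their poles. -/
def Marking.constEll (M : Marking Γ) (F : Set ℍ) : ℝ≥0∞ :=
  ⨆ z ∈ {z ∈ F | ¬ IsEllipticPoint Γ z}, M.smallConstEll * ∑' e : M.ells,
    ((order Γ e - 1 : ℕ) : ℝ≥0∞) *
      (eisEll Γ e z 2 - ENNReal.ofReal (Real.sinh (dist z e)) ^ (-2 : ℝ))

/-- The free-space Green's function `log |(z - w̄) / (z - w)|²`. -/
def greenH (z w : ℍ) : ℝ :=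
  Real.log (‖((z : ℂ) - (starRingEnd ℂ) (w : ℂ)) / ((z : ℂ) - (w : ℂ))‖ ^ 2)

/-- The parabolic elements of `Γ` as a subset of `PSL₂(ℝ)`: each of them has exactly one lift to
`SL₂(ℝ)` of trace `2`. -/
def parabolics (Γ : PSLSubgroup) : Set (GL (Fin 2) ℝ) :=
  {γ | γ ∈ Γ.grp ∧ γ.IsParabolic ∧ Matrix.trace γ.val = 2}

/-- The function `P_X(z) = ∑_γ g_ℍ(z, γ z)`, the sum being over the parabolic elements of `Γ`. -/
def parSum (Γ : PSLSubgroup) (z : ℍ) : ℝ := ∑' γ : parabolics Γ, greenH z (γ.1 • z)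

/-- The hyperbolic Laplacian `-y² (∂²/∂x² + ∂²/∂y²)`. -/
def hypLaplacian (f : ℍ → ℝ) (z : ℍ) : ℝ :=
  -z.im ^ 2 * Laplacian.laplacian (fun w : ℂ => f (ofComplex w)) (z : ℂ)

/-- `C_{X,par}^{aux}`, the supremum of `|Δ_hyp P_X|`. -/
def constParAux (Γ : PSLSubgroup) : ℝ≥0∞ := ⨆ z : ℍ, ENNReal.ofReal |hypLaplacian (parSum Γ) z|

/-! ### Admissible sequences -/

/-- `X' = Γ' \ ℍ` is a finite degree cover of `X = Γ \ ℍ`: up to conjugation in `PSL₂(ℝ)`, `Γ'` is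
a subgroup of finite index of `Γ`. -/
def IsFiniteCover (Γ' Γ : PSLSubgroup) : Prop :=
  ∃ g : GL (Fin 2) ℝ, g.det = 1 ∧
    Γ'.grp.map (MulAut.conj g).toMonoidHom ≤ Γ.grp ∧
    (Γ'.grp.map (MulAut.conj g).toMonoidHom).relIndex Γ.grp ≠ 0

/-- `(X_N)_{N ∈ 𝒩}` is an admissible sequence with base index `q`. For the modular curves, `q` may
be any element of `𝒩`, for instance the smallest prime in `𝒩`. -/
inductive IsAdmissible : Set ℕ → (ℕ → PSLSubgroup) → ℕ → Prop
  | tower (Γ : ℕ → PSLSubgroup) (surface : ∀ N, IsOrbisurface (Γ N))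
      (cover : ∀ N, IsFiniteCover (Γ (N + 1)) (Γ N)) : IsAdmissible Set.univ Γ 0
  | modular (𝒩 : Set ℕ) (Γ : ℕ → PSLSubgroup) (q : ℕ) (level : ℕ → Subgroup SL(2, ℤ))
      (family : level = CongruenceSubgroup.Gamma0 ∨ level = CongruenceSubgroup.Gamma1 ∨
        level = CongruenceSubgroup.Gamma)
      (pos : ∀ N ∈ 𝒩, 0 < N) (curve : ∀ N ∈ 𝒩, Γ N = ofSL2Z (level N))
      (one_le_genus : ∀ N ∈ 𝒩, 1 ≤ genus (Γ N)) (base : q ∈ 𝒩) : IsAdmissible 𝒩 Γ q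

end Orbisurface

end

noncomputable section

namespace Orbisurface

open Matrix Matrix.GeneralLinearGroup

/-! ### Matrices of determinant one -/

/-! Every group of an admissible family is conjugate into one fixed discrete group: the base group
`Γq` for a tower, the modular group for `Γ₀(N)`, `Γ₁(N)`, `Γ(N)`. So it suffices to bound all the
constants by data that pass to subgroups of conjugates. These data are collected in `GeomBound`, and
inheritance is `GeomBound.of_conj`. They exist for a locally finite group that is compact modulo the
group outside horoballs (`HasCore.exists_geomBound`). The core comes from compactness of `Γ \ ℍ*` in
the first-kind case, and from the standard fundamental domain for the modular group.

The sums are bounded by packing. By Shimizu's lemma the horoballs of height one at distinct cusps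
are disjoint, whatever the group (`IsScaling.eq_of_one_lt_im`). Each term of a parabolic Eisenstein
series is at most a constant times `cosh⁻² d(z, w)` on a box in its own horoball. The sum is
therefore at most a multiple of the integral of this kernel over `ℍ`, which is finite and
independent of `z` (`tsum_height_sq_le`). This requires bounded heights, which is why the identity
coset is subtracted and `z` is kept in a fundamental domain adapted to the cusps. The elliptic
series are treated in the same way with disjoint balls around the elliptic points
(`tsum_inv_sinh_sq_le`).

For `P_X`, the parabolic elements are the pairs of a cusp `c` and an integer `n ≠ 0`, with term `log
(1 + 4 t² / n²)`, where `t` is the height of `z` at `c` (`parabolicEquiv`, `greenH_conj`). The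
height is the imaginary part of a Möbius map, so the Laplacian of a term is `-t² ψₙ''(t)`
(`hypLaplacian_parSum`). The sum over `n` at one cusp is `O(t²)`, and it is also at most `2` for
every `t` by an explicit evaluation (`tsum_psi₂_bound`). At most one cusp has `t > 1`, and the
packing estimate controls the others. Hence the bound for `Δ P_X` is the same for all groups. -/

lemma exists_toGL_eq {g : GL (Fin 2) ℝ} (hg : g.det = 1) :
    ∃ s : SL(2, ℝ), SpecialLinearGroup.toGL s = g := by
  have : g ∈ Set.range (SpecialLinearGroup.toGL : SL(2, ℝ) → GL (Fin 2) ℝ) := by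
    rw [SpecialLinearGroup.range_toGL]; exact hg
  exact this

lemma toGL_smul (s : SL(2, ℝ)) (z : ℍ) : SpecialLinearGroup.toGL s • z = s • z := by
  rw [MulAction.compHom_smul_def]
  congr 1

lemma dist_smul_smul {g : GL (Fin 2) ℝ} (hg : g.det = 1) (z w : ℍ) :
    dist (g • z) (g • w) = dist z w := by
  obtain ⟨s, rfl⟩ := exists_toGL_eq hg
  rw [toGL_smul, toGL_smul, dist_smul]

lemma det_inv_eq_one {g : GL (Fin 2) ℝ} (hg : g.det = 1) : g⁻¹.det = 1 := by
  rw [map_inv, hg, inv_one]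

lemma det_mul_eq_one {g h : GL (Fin 2) ℝ} (hg : g.det = 1) (hh : h.det = 1) :
    (g * h).det = 1 := by
  rw [map_mul, hg, hh, one_mul]

lemma dist_smul_left {g : GL (Fin 2) ℝ} (hg : g.det = 1) (z w : ℍ) :
    dist (g • z) w = dist z (g⁻¹ • w) := by
  rw [← dist_smul_smul hg z, smul_inv_smul]

lemma det_val_eq_one {g : GL (Fin 2) ℝ} (hg : g.det = 1) : g.val.det = 1 := by
  have := congrArg Units.val hg
  simpa using this

lemma entries_det {g : GL (Fin 2) ℝ} (hg : g.det = 1) :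
    g 0 0 * g 1 1 - g 0 1 * g 1 0 = 1 := by
  rw [← det_val_eq_one hg, Matrix.det_fin_two]

lemma im_smul_eq {g : GL (Fin 2) ℝ} (hg : g.det = 1) (z : ℍ) :
    (g • z).im = z.im / ((g 1 0 * z.re + g 1 1) ^ 2 + (g 1 0 * z.im) ^ 2) := by
  rw [im_smul_eq_div_normSq, hg]
  simp [denom, Complex.normSq_apply]
  ring

lemma inv_entries {g : GL (Fin 2) ℝ} (hg : g.det = 1) :
    g⁻¹ 0 0 = g 1 1 ∧ g⁻¹ 0 1 = -g 0 1 ∧ g⁻¹ 1 0 = -g 1 0 ∧ g⁻¹ 1 1 = g 0 0 := by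
  have h : (g⁻¹ : GL (Fin 2) ℝ).val = !![g 1 1, -g 0 1; -g 1 0, g 0 0] := by
    rw [Matrix.coe_units_inv, Matrix.inv_def, Matrix.adjugate_fin_two, det_val_eq_one hg]
    simp
  simp [h]

/-- This is the dictionary between displacement of `i` and size of the matrix entries, used in both
directions. -/
lemma two_mul_cosh_dist_smul_I {g : GL (Fin 2) ℝ} (hg : g.det = 1) :
    2 * Real.cosh (dist (g • I) I) = g 0 0 ^ 2 + g 0 1 ^ 2 + g 1 0 ^ 2 + g 1 1 ^ 2 := by
  have hd := entries_det hg
  have hq : 0 < g 1 1 ^ 2 + g 1 0 ^ 2 := by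
    rcases eq_or_ne (g 1 0) 0 with h | h
    · have : g 1 1 ≠ 0 := by rintro h'; rw [h, h'] at hd; simp at hd
      positivity
    · positivity
  have him : (g • I).im = 1 / (g 1 1 ^ 2 + g 1 0 ^ 2) := by
    rw [im_smul_eq hg]; simp
  have hre : (g • I).re = (g 0 0 * g 1 0 + g 0 1 * g 1 1) / (g 1 1 ^ 2 + g 1 0 ^ 2) := by
    rw [re_smul]
    simp [num, denom, Complex.div_re, Complex.normSq_apply]
    field_simp
    ring
  rw [cosh_dist', him, hre]
  simp only [I_re, I_im, sub_zero, one_pow, mul_one]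
  field_simp
  -- Lagrange's identity, the `1` being the square of the determinant.
  have h2 : (g 0 0 * g 1 0 + g 0 1 * g 1 1) ^ 2 + 1 =
      (g 0 0 ^ 2 + g 0 1 ^ 2) * (g 1 1 ^ 2 + g 1 0 ^ 2) := by
    linear_combination (-(g 0 0 * g 1 1 - g 0 1 * g 1 0) - 1) * hd
  linear_combination h2

/-! ### Locally finite groups -/

/-- Only finitely many elements of `Γ` move the point `i` by at most a given distance. -/
def IsLocFinite (Γ : PSLSubgroup) : Prop :=
  ∀ R : ℝ, {γ : GL (Fin 2) ℝ | γ ∈ Γ.grp ∧ dist (γ • I) I ≤ R}.Finite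

/-- The orbit map `g ↦ g • i` on `SL₂(ℝ)` is proper and a discrete subgroup is closed, so the group
meets the preimage of a closed ball in a compact discrete set. -/
lemma isLocFinite_of_discrete {Γ : PSLSubgroup} (h : DiscreteTopology Γ.grp) :
    IsLocFinite Γ := by
  intro R
  let G : Subgroup SL(2, ℝ) := Γ.grp.comap SpecialLinearGroup.toGL
  have hG : DiscreteTopology G := by
    have hm : Set.MapsTo (SpecialLinearGroup.toGL : SL(2, ℝ) → GL (Fin 2) ℝ) G Γ.grp :=
      fun x hx => hx
    exact .of_continuous_injective (SpecialLinearGroup.continuous_toGL.restrict hm)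
      (hm.restrict_inj.mpr SpecialLinearGroup.toGL_injective.injOn)
  have hc : IsClosed (G : Set SL(2, ℝ)) := Subgroup.isClosed_of_discrete
  have hK : IsCompact ((fun g : SL(2, ℝ) => g • I) ⁻¹' Metric.closedBall I R) :=
    isProperMap_smul_I.isCompact_preimage (isCompact_closedBall _ _)
  have hfin : ((fun g : SL(2, ℝ) => g • I) ⁻¹' Metric.closedBall I R ∩ G).Finite := by
    refine (hK.inter_right hc).finite ?_
    have : IsDiscrete (G : Set SL(2, ℝ)) := ⟨hG⟩
    exact this.mono Set.inter_subset_right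
  refine (hfin.image SpecialLinearGroup.toGL).subset ?_
  rintro γ ⟨hγ, hd⟩
  obtain ⟨s, rfl⟩ := exists_toGL_eq (Γ.det_eq_one γ hγ)
  refine ⟨s, ⟨?_, hγ⟩, rfl⟩
  rw [toGL_smul] at hd
  exact hd

lemma IsLocFinite.finite_dist {Γ : PSLSubgroup} (h : IsLocFinite Γ) (R : ℝ) :
    {γ : GL (Fin 2) ℝ | γ ∈ Γ.grp ∧ ∃ z : ℍ, dist z I ≤ R ∧ dist (γ • z) I ≤ R}.Finite := by
  refine (h (R + R)).subset ?_
  rintro γ ⟨hγ, z, hz, hz'⟩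
  refine ⟨hγ, (dist_triangle _ (γ • z) _).trans ?_⟩
  rw [dist_smul_smul (Γ.det_eq_one γ hγ), dist_comm I z]
  exact add_le_add hz hz'

/-- Finiteness in coordinates in which a given cusp sits at `∞`, the form needed for Shimizu's lemma
and for scaling matrices. -/
lemma IsLocFinite.finite_entries {Γ : PSLSubgroup} (h : IsLocFinite Γ) (g : GL (Fin 2) ℝ)
    (hg : g.det = 1) (B : ℝ) :
    {γ : GL (Fin 2) ℝ | g * γ * g⁻¹ ∈ Γ.grp ∧ γ.det = 1 ∧ ∀ i j, |γ i j| ≤ B}.Finite := by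
  have hinj : Function.Injective fun γ : GL (Fin 2) ℝ => g * γ * g⁻¹ := by
    intro a b hab; simpa using hab
  refine Set.Finite.of_finite_image ((h (4 * B ^ 2 + 2 * dist (g⁻¹ • I) I)).subset ?_)
    hinj.injOn
  rintro _ ⟨γ, ⟨hγ, hγd, hγB⟩, rfl⟩
  refine ⟨hγ, ?_⟩
  have h1 : dist (γ • I) I ≤ 4 * B ^ 2 := by
    have hs : ∀ i j, γ i j ^ 2 ≤ B ^ 2 := fun i j =>
      sq_le_sq' (abs_le.mp (hγB i j)).1 (abs_le.mp (hγB i j)).2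
    have h2 := two_mul_cosh_dist_smul_I hγd
    have h3 : dist (γ • I) I ≤ Real.sinh (dist (γ • I) I) :=
      Real.self_le_sinh_iff.mpr dist_nonneg
    have h4 := Real.sinh_lt_cosh (dist (γ • I) I)
    have h5 : 0 ≤ Real.cosh (dist (γ • I) I) := (Real.cosh_pos _).le
    nlinarith [hs 0 0, hs 0 1, hs 1 0, hs 1 1]
  change dist ((g * γ * g⁻¹) • I) I ≤ _
  rw [mul_smul, mul_smul, dist_smul_left hg]
  calc dist (γ • g⁻¹ • I) (g⁻¹ • I) ≤ dist (γ • g⁻¹ • I) (γ • I) + dist (γ • I) I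
        + dist I (g⁻¹ • I) := dist_triangle4 _ _ _ _
    _ ≤ _ := by rw [dist_smul_smul hγd, dist_comm I]; linarith

/-! ### Scaling matrices -/

/-- `s` is a scaling matrix of `Γ` at the cusp `c`. -/
structure IsScaling (Γ : PSLSubgroup) (c : OnePoint ℝ) (s : GL (Fin 2) ℝ) : Prop where
  det : s.det = 1
  smul_infty : s • (OnePoint.infty : OnePoint ℝ) = c
  stabilizer : ∀ γ : GL (Fin 2) ℝ, (γ ∈ Γ.grp ∧ γ • c = c) ↔
    ∃ n : ℤ, s⁻¹ * γ * s = upperRightHom (n : ℝ) ∨ s⁻¹ * γ * s = -upperRightHom (n : ℝ)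

lemma Marking.isScaling {Γ : PSLSubgroup} (M : Marking Γ) {p : OnePoint ℝ} (hp : p ∈ M.cusps) :
    IsScaling Γ p (M.scal p) :=
  ⟨M.scal_det p hp, M.scal_infty p hp, M.scal_stabilizer p hp⟩

lemma IsScaling.smul {Γ : PSLSubgroup} {c : OnePoint ℝ} {s γ : GL (Fin 2) ℝ}
    (h : IsScaling Γ c s) (hγ : γ ∈ Γ.grp) : IsScaling Γ (γ • c) (γ * s) where
  det := det_mul_eq_one (Γ.det_eq_one γ hγ) h.det
  smul_infty := by rw [mul_smul, h.smul_infty]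
  stabilizer δ := by
    have h1 : (γ * s)⁻¹ * δ * (γ * s) = s⁻¹ * (γ⁻¹ * δ * γ) * s := by group
    rw [h1, ← h.stabilizer, Subgroup.mul_mem_cancel_right _ hγ,
      Subgroup.mul_mem_cancel_left _ (inv_mem hγ), mul_smul, mul_smul, inv_smul_eq_iff]

lemma upperRightHom_smul_coe (t : ℝ) (z : ℍ) :
    ((upperRightHom t • z : ℍ) : ℂ) = (z : ℂ) + t := by
  rw [coe_smul_of_det_pos (by simp [Matrix.det_fin_two])]
  simp [num, denom]

lemma upperRightHom_smul_im (t : ℝ) (z : ℍ) : (upperRightHom t • z).im = z.im := by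
  rw [← coe_im, upperRightHom_smul_coe]; simp

lemma IsScaling.im_smul_of_fixes {Γ : PSLSubgroup} {c : OnePoint ℝ} {s γ : GL (Fin 2) ℝ}
    (h : IsScaling Γ c s) (hγ : γ ∈ Γ.grp) (hc : γ • c = c) (z : ℍ) :
    (s⁻¹ • γ • z).im = (s⁻¹ • z).im := by
  obtain ⟨n, hn⟩ := (h.stabilizer γ).mp ⟨hγ, hc⟩
  have : s⁻¹ • γ • z = (s⁻¹ * γ * s) • s⁻¹ • z := by
    simp [mul_smul]
  rw [this]
  rcases hn with hn | hn <;> rw [hn]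
  · exact upperRightHom_smul_im _ _
  · rw [UpperHalfPlane.neg_smul]; exact upperRightHom_smul_im _ _

lemma IsScaling.conj_mem {Γ : PSLSubgroup} {c : OnePoint ℝ} {s : GL (Fin 2) ℝ}
    (h : IsScaling Γ c s) (n : ℤ) : s * upperRightHom (n : ℝ) * s⁻¹ ∈ Γ.grp :=
  ((h.stabilizer _).mpr ⟨n, Or.inl (by group)⟩).1

/-! ### Shimizu's lemma and disjointness of horoballs -/

/-- The sequence `A, A T A⁻¹, …` of Shimizu's lemma, where `T` is the translation by `1`. -/
def shimizuSeq (A : GL (Fin 2) ℝ) : ℕ → GL (Fin 2) ℝ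
  | 0 => A
  | n + 1 => shimizuSeq A n * upperRightHom 1 * (shimizuSeq A n)⁻¹

lemma det_upperRightHom (t : ℝ) : (upperRightHom t : GL (Fin 2) ℝ).det = 1 := by
  ext; simp [Matrix.det_fin_two]

lemma det_conj_upperRightHom {A : GL (Fin 2) ℝ} (t : ℝ) :
    (A * upperRightHom t * A⁻¹).det = 1 := by
  rw [map_mul, map_mul, det_upperRightHom, mul_one, ← map_mul, mul_inv_cancel, map_one]

/-- The lower left entry `-t c²` is the decisive one: it drives the iteration in Shimizu's lemma and
measures how far apart two cusps are. -/
lemma conj_upperRightHom_entries {A : GL (Fin 2) ℝ} (hA : A.det = 1) (t : ℝ) :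
    (A * upperRightHom t * A⁻¹) 0 0 = 1 - t * (A 0 0 * A 1 0) ∧
    (A * upperRightHom t * A⁻¹) 0 1 = t * A 0 0 ^ 2 ∧
    (A * upperRightHom t * A⁻¹) 1 0 = -(t * A 1 0 ^ 2) ∧
    (A * upperRightHom t * A⁻¹) 1 1 = 1 + t * (A 0 0 * A 1 0) := by
  obtain ⟨h1, h2, h3, h4⟩ := inv_entries hA
  have hd := entries_det hA
  have e : ∀ i j, (A * upperRightHom t * A⁻¹) i j =
      A i 0 * A⁻¹ 0 j + (t * A i 0 + A i 1) * A⁻¹ 1 j := by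
    intro i j
    simp only [Units.val_mul, Matrix.mul_apply, Fin.sum_univ_two, upperRightHom_apply]
    simp [mul_comm]
  refine ⟨?_, ?_, ?_, ?_⟩ <;> rw [e] <;> simp only [h1, h2, h3, h4]
  · linear_combination hd
  · ring
  · ring
  · linear_combination hd

/-- **Shimizu's lemma.** -/
lemma shimizu {Γ : PSLSubgroup} (h : IsLocFinite Γ) {g A : GL (Fin 2) ℝ} (hg : g.det = 1)
    (hT : g * upperRightHom 1 * g⁻¹ ∈ Γ.grp) (hA : A.det = 1) (hAΓ : g * A * g⁻¹ ∈ Γ.grp)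
    (h0 : A 1 0 ≠ 0) : 1 ≤ |A 1 0| := by
  by_contra! hlt
  set c := |A 1 0| with hc
  have hcpos : 0 < c := abs_pos.mpr h0
  have hdet : ∀ n, (shimizuSeq A n).det = 1 := by
    rintro (_ | n)
    · exact hA
    · exact det_conj_upperRightHom 1
  have hmem : ∀ n, g * shimizuSeq A n * g⁻¹ ∈ Γ.grp := by
    intro n
    induction n with
    | zero => exact hAΓ
    | succ n ih =>
      have : g * shimizuSeq A (n + 1) * g⁻¹ = (g * shimizuSeq A n * g⁻¹) *
          (g * upperRightHom 1 * g⁻¹) * (g * shimizuSeq A n * g⁻¹)⁻¹ := by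
        rw [shimizuSeq]; group
      rw [this]
      exact mul_mem (mul_mem ih hT) (inv_mem ih)
  have hent := fun n => conj_upperRightHom_entries (hdet n) 1
  -- The lower left entry is squared at each step; starting in `(0, 1)`, it decreases strictly and
  -- never vanishes.
  have h10 : ∀ n, |shimizuSeq A (n + 1) 1 0| = |shimizuSeq A n 1 0| ^ 2 := by
    intro n
    rw [shimizuSeq, (hent n).2.2.1, one_mul, abs_neg, abs_pow]
  have hcn : ∀ n, 0 < |shimizuSeq A n 1 0| ∧ |shimizuSeq A n 1 0| ≤ c := by
    intro n
    induction n with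
    | zero => exact ⟨hcpos, le_rfl⟩
    | succ n ih =>
      rw [h10]
      exact ⟨pow_pos ih.1 2, by nlinarith⟩
  -- The value `1 / (1 - c)` is the fixed point of `x ↦ 1 + c x`, so the bound `B` on the upper left
  -- entries reproduces itself.
  set B := max |A 0 0| (1 / (1 - c)) with hB
  have hB1 : 1 ≤ B * (1 - c) := by
    rw [← div_le_iff₀ (by linarith)]; exact le_max_right _ _
  have hB0 : 1 ≤ B := by nlinarith [le_max_left |A 0 0| (1 / (1 - c)), abs_nonneg (A 0 0)]
  have han : ∀ n, |shimizuSeq A n 0 0| ≤ B := by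
    intro n
    induction n with
    | zero => exact le_max_left _ _
    | succ n ih =>
      rw [shimizuSeq, (hent n).1]
      calc |1 - 1 * (shimizuSeq A n 0 0 * shimizuSeq A n 1 0)|
          ≤ |1| + |1 * (shimizuSeq A n 0 0 * shimizuSeq A n 1 0)| := abs_sub _ _
        _ = 1 + |shimizuSeq A n 0 0| * |shimizuSeq A n 1 0| := by rw [one_mul, abs_one, abs_mul]
        _ ≤ 1 + B * c := by
          gcongr
          exact (hcn n).2
        _ ≤ B := by linarith
  have hanti : StrictAnti fun n => |shimizuSeq A n 1 0| := by
    refine strictAnti_nat_of_succ_lt fun n => ?_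
    rw [h10]
    nlinarith [(hcn n).1, (hcn n).2]
  have hinj : Function.Injective fun n => shimizuSeq A (n + 1) := by
    intro m n hmn
    have h1 := congrArg (fun x : GL (Fin 2) ℝ => |x 1 0|) hmn
    have := hanti.injective h1
    omega
  -- Infinitely many distinct elements of a conjugate of `Γ` with bounded entries: a contradiction.
  refine Set.infinite_range_of_injective hinj ((h.finite_entries g hg (1 + B ^ 2)).subset ?_)
  rintro _ ⟨n, rfl⟩
  refine ⟨hmem _, hdet _, ?_⟩
  have hp : |shimizuSeq A n 0 0 * shimizuSeq A n 1 0| ≤ B ^ 2 := by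
    rw [abs_mul, sq]
    exact mul_le_mul (han n) (by linarith [(hcn n).2]) (abs_nonneg _) (by linarith)
  have hp' := abs_le.mp hp
  obtain ⟨e1, e2, e3, e4⟩ := hent n
  intro i j
  fin_cases i <;> fin_cases j
  · simp only [Fin.zero_eta, shimizuSeq, e1]
    rw [abs_le]; constructor <;> linarith
  · simp only [Fin.zero_eta, Fin.mk_one, shimizuSeq, e2, one_mul, abs_pow]
    have := pow_le_pow_left₀ (abs_nonneg _) (han n) 2
    linarith
  · simp only [Fin.zero_eta, Fin.mk_one]
    nlinarith [(hcn (n + 1)).2]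
  · simp only [Fin.mk_one, shimizuSeq, e4]
    rw [abs_le]; constructor <;> linarith

/-- The horoballs of height one at distinct cusps are disjoint. -/
lemma IsScaling.eq_of_one_lt_im {Γ : PSLSubgroup} (h : IsLocFinite Γ) {c c' : OnePoint ℝ}
    {s s' : GL (Fin 2) ℝ} (hs : IsScaling Γ c s) (hs' : IsScaling Γ c' s') {z : ℍ}
    (hz : 1 < (s⁻¹ • z).im) (hz' : 1 < (s'⁻¹ • z).im) : c = c' := by
  set τ := s⁻¹ * s' with hτ
  have hτd : τ.det = 1 := det_mul_eq_one (det_inv_eq_one hs.det) hs'.det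
  -- If `τ` fixes `∞`, the two cusps agree. Otherwise Shimizu's lemma for `τ T τ⁻¹`, whose lower
  -- left entry is `-c²` with `c = τ 1 0`, gives `c² ≥ 1`. Then `Im (τ⁻¹ w) ≤ 1 / (c² Im w) < 1`.
  by_cases h0 : τ 1 0 = 0
  · have := OnePoint.smul_infty_eq_self_iff.mpr h0
    rw [hτ, mul_smul, inv_smul_eq_iff, hs.smul_infty, hs'.smul_infty] at this
    exact this.symm
  exfalso
  have hT : s * upperRightHom 1 * s⁻¹ ∈ Γ.grp := by simpa using hs.conj_mem 1
  have hT' : s * (τ * upperRightHom 1 * τ⁻¹) * s⁻¹ ∈ Γ.grp := by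
    have : s * (τ * upperRightHom 1 * τ⁻¹) * s⁻¹ = s' * upperRightHom 1 * s'⁻¹ := by
      rw [hτ]; group
    rw [this]; simpa using hs'.conj_mem 1
  have e := (conj_upperRightHom_entries hτd 1).2.2.1
  have h1 := shimizu h hs.det hT (det_conj_upperRightHom 1) hT' (by
    rw [e, one_mul]; exact neg_ne_zero.mpr (pow_ne_zero 2 h0))
  rw [e, one_mul, abs_neg, abs_of_nonneg (sq_nonneg _)] at h1
  have hw : s'⁻¹ • z = τ⁻¹ • s⁻¹ • z := by rw [← mul_smul, hτ]; congr 1; group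
  set w := s⁻¹ • z
  obtain ⟨-, -, i3, i4⟩ := inv_entries hτd
  rw [hw, im_smul_eq (det_inv_eq_one hτd), i3, i4] at hz'
  have hq : w.im ^ 2 ≤ (-τ 1 0 * w.re + τ 0 0) ^ 2 + (-τ 1 0 * w.im) ^ 2 := by
    nlinarith [sq_nonneg (-τ 1 0 * w.re + τ 0 0), sq_nonneg w.im]
  rw [one_lt_div (by nlinarith)] at hz'
  nlinarith

/-! ### Existence of scaling matrices -/

lemma exists_det_one_smul_infty (c : OnePoint ℝ) :
    ∃ s : GL (Fin 2) ℝ, s.det = 1 ∧ s • (OnePoint.infty : OnePoint ℝ) = c := by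
  obtain ⟨g, hg⟩ := OnePoint.exists_mem_SL2 (K := ℝ) ℝ c
  exact ⟨_, SpecialLinearGroup.det_mapGL g, hg⟩

lemma PSLSubgroup.neg_mem {Γ : PSLSubgroup} {γ : GL (Fin 2) ℝ} (h : γ ∈ Γ.grp) :
    -γ ∈ Γ.grp := by
  rw [← neg_one_mul]; exact mul_mem Γ.neg_one_mem h

lemma eq_pm_upperRightHom {B : GL (Fin 2) ℝ} (hB : B.det = 1) (h10 : B 1 0 = 0)
    (ha : B 0 0 ^ 2 = 1) : B = upperRightHom (B 0 0 * B 0 1) ∨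
      B = -upperRightHom (B 0 0 * B 0 1) := by
  have hd := entries_det hB
  rw [h10, mul_zero, sub_zero] at hd
  have h11 : B 1 1 = B 0 0 := by linear_combination B 0 0 * hd - B 1 1 * ha
  rcases sq_eq_one_iff.mp ha with h | h
  · left
    ext i j
    fin_cases i <;> fin_cases j <;> simp [h, h10, h11]
  · right
    ext i j
    fin_cases i <;> fin_cases j <;> simp [h, h10, h11]

/-- Every cusp of a discrete group has a scaling matrix. -/
lemma exists_isScaling {Γ : PSLSubgroup} (h : IsLocFinite Γ) {c : OnePoint ℝ}
    (hc : IsCusp c Γ.grp) : ∃ s, IsScaling Γ c s := by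
  obtain ⟨s₀, hs₀, hs₀c⟩ := exists_det_one_smul_infty c
  have hfix : ∀ γ : GL (Fin 2) ℝ, γ • c = c ↔ (s₀⁻¹ * γ * s₀) 1 0 = 0 := by
    intro γ
    rw [← OnePoint.smul_infty_eq_self_iff, mul_smul, mul_smul, hs₀c, inv_smul_eq_iff, hs₀c]
  -- The translation lengths of `Γ` at the cusp. The subgroup is nonzero because a cusp is fixed by
  -- a parabolic element, and discrete by local finiteness, hence generated by its least positive
  -- element `l`.
  let H : AddSubgroup ℝ :=
    { carrier := {t | s₀ * upperRightHom t * s₀⁻¹ ∈ Γ.grp}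
      zero_mem' := by
        have : s₀ * upperRightHom (0 : ℝ) * s₀⁻¹ = 1 := by
          rw [AddChar.map_zero_eq_one]; group
        rw [Set.mem_ofPred_eq, this]
        exact one_mem _
      add_mem' := by
        intro a b ha hb
        have : s₀ * upperRightHom (a + b) * s₀⁻¹ =
            (s₀ * upperRightHom a * s₀⁻¹) * (s₀ * upperRightHom b * s₀⁻¹) := by
          rw [AddChar.map_add_eq_mul]; group
        rw [Set.mem_ofPred_eq, this]
        exact mul_mem ha hb
      neg_mem' := by
        intro a ha
        have : s₀ * upperRightHom (-a) * s₀⁻¹ = (s₀ * upperRightHom a * s₀⁻¹)⁻¹ := by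
          rw [AddChar.map_neg_eq_inv]; group
        rw [Set.mem_ofPred_eq, this]
        exact inv_mem ha }
  have hH : ∀ t, t ∈ H ↔ s₀ * upperRightHom t * s₀⁻¹ ∈ Γ.grp := fun t => Iff.rfl
  have hpm : ∀ γ ∈ Γ.grp, ∀ t : ℝ, (s₀⁻¹ * γ * s₀ = upperRightHom t ∨
      s₀⁻¹ * γ * s₀ = -upperRightHom t) → t ∈ H := by
    rintro γ hγ t (ht | ht)
    · rw [hH, ← ht]; convert hγ using 1; group
    · rw [hH, ← neg_neg (upperRightHom t), ← ht]
      convert PSLSubgroup.neg_mem hγ using 1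
      rw [mul_neg, neg_mul]; congr 1; group
  obtain ⟨x₀, hx₀H, hx₀⟩ : ∃ x ∈ H, 0 < x := by
    obtain ⟨γ, hγ, hγp, hγc⟩ := hc
    have hp : (s₀⁻¹ * γ * s₀).IsParabolic := by simpa using hγp
    rw [isParabolic_iff_of_upperTriangular_of_det (Or.inl (by simp [hs₀, Γ.det_eq_one γ hγ]))
      ((hfix γ).mp hγc)] at hp
    obtain ⟨x, hx, hx'⟩ : ∃ x ≠ 0, (s₀⁻¹ * γ * s₀ = upperRightHom x ∨
        s₀⁻¹ * γ * s₀ = -upperRightHom x) := by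
      rcases hp with ⟨x, hx, hx'⟩ | ⟨x, hx, hx'⟩
      exacts [⟨x, hx, Or.inl hx'⟩, ⟨x, hx, Or.inr hx'⟩]
    have hxH := hpm γ hγ x hx'
    rcases lt_or_gt_of_ne hx with h | h
    · exact ⟨-x, H.neg_mem hxH, by linarith⟩
    · exact ⟨x, hxH, h⟩
  have hfin : {t : ℝ | t ∈ H ∧ 0 < t ∧ t ≤ x₀}.Finite := by
    refine Set.Finite.of_finite_image ((h.finite_entries s₀ hs₀ (1 + x₀)).subset ?_)
      (injective_upperRightHom (R := ℝ)).injOn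
    rintro _ ⟨t, ⟨ht, ht0, htx⟩, rfl⟩
    refine ⟨ht, det_upperRightHom t, fun i j => ?_⟩
    fin_cases i <;> fin_cases j <;> simp [abs_of_pos ht0] <;> linarith
  obtain ⟨l, ⟨hlH, hl0, hlx⟩, hlmin⟩ :=
    hfin.exists_minimal ⟨x₀, hx₀H, hx₀, le_rfl⟩
  have hleast : IsLeast {g | g ∈ H ∧ 0 < g} l := by
    refine ⟨⟨hlH, hl0⟩, fun t ht => ?_⟩
    rcases le_total t l with h' | h'
    · exact hlmin ⟨ht.1, ht.2, h'.trans hlx⟩ h'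
    · exact h'
  have hcyc : ∀ t, t ∈ H ↔ ∃ n : ℤ, n * l = t := by
    intro t
    rw [AddSubgroup.cyclic_of_min hleast, AddSubgroup.mem_closure_singleton]
    simp
  -- Conjugation by `d` normalises the generating translation from `l` to `1`.
  set d : GL (Fin 2) ℝ := GeneralLinearGroup.mkOfDetNeZero !![√l, 0; 0, 1 / √l] (by
    have : √l ≠ 0 := (Real.sqrt_pos.mpr hl0).ne'
    simp [Matrix.det_fin_two, this]) with hd_def
  have hsl : √l ≠ 0 := (Real.sqrt_pos.mpr hl0).ne'
  have hdv : d.val = !![√l, 0; 0, 1 / √l] := rfl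
  have hdd : d.det = 1 := by ext; simp [hdv, Matrix.det_fin_two, hsl]
  have hdT : ∀ t : ℝ, d * upperRightHom t * d⁻¹ = upperRightHom (t * l) := by
    intro t
    obtain ⟨e1, e2, e3, e4⟩ := conj_upperRightHom_entries hdd t
    ext i j
    fin_cases i <;> fin_cases j
    · simpa [hdv] using e1
    · simpa [hdv, Real.sq_sqrt hl0.le] using e2
    · simpa [hdv] using e3
    · simpa [hdv] using e4
  have hdT' : ∀ t : ℝ, d⁻¹ * upperRightHom (t * l) * d = upperRightHom t := by
    intro t; rw [← hdT]; group
  refine ⟨s₀ * d, det_mul_eq_one hs₀ hdd, ?_, fun γ => ⟨?_, ?_⟩⟩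
  · rw [mul_smul, OnePoint.smul_infty_eq_self_iff.mpr (by simp [hdv]), hs₀c]
  · rintro ⟨hγ, hγc⟩
    set B := s₀⁻¹ * γ * s₀ with hB
    have hBd : B.det = 1 := by simp [hB, hs₀, Γ.det_eq_one γ hγ]
    have hB10 : B 1 0 = 0 := (hfix γ).mp hγc
    have hBi := inv_entries hBd
    have hdet := entries_det hBd
    rw [hB10, mul_zero, sub_zero] at hdet
    -- Conjugation by `B` multiplies translation lengths by `a²`, where `a = B 0 0`, and preserves
    -- `H`; so `a²` is an integer. The same for `B⁻¹` makes `a²` a unit, so the stabilizer of a cusp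
    -- contains no hyperbolic element.
    have key : ∀ γ ∈ Γ.grp, ∀ B, B = s₀⁻¹ * γ * s₀ → B.det = 1 → B 1 0 = 0 →
        ∃ n : ℤ, (n : ℝ) = B 0 0 ^ 2 := by
      intro γ hγ B hB hBd hB10
      have hmem : B 0 0 ^ 2 * l ∈ H := by
        have e : B * upperRightHom l * B⁻¹ = upperRightHom (B 0 0 ^ 2 * l) := by
          obtain ⟨e1, e2, e3, e4⟩ := conj_upperRightHom_entries hBd l
          ext i j
          fin_cases i <;> fin_cases j
          · simpa [hB10] using e1
          · simpa [mul_comm] using e2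
          · simpa [hB10] using e3
          · simpa [hB10] using e4
        rw [hH, ← e, hB]
        have : s₀ * (s₀⁻¹ * γ * s₀ * upperRightHom l * (s₀⁻¹ * γ * s₀)⁻¹) * s₀⁻¹ =
          γ * (s₀ * upperRightHom l * s₀⁻¹) * γ⁻¹ := by group
        rw [this]
        exact mul_mem (mul_mem hγ hlH) (inv_mem hγ)
      obtain ⟨n, hn⟩ := (hcyc _).mp hmem
      exact ⟨n, mul_right_cancel₀ hl0.ne' hn⟩
    obtain ⟨n, hn⟩ := key γ hγ B hB hBd hB10
    obtain ⟨m, hm⟩ := key γ⁻¹ (inv_mem hγ) B⁻¹ (by rw [hB]; group) (det_inv_eq_one hBd)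
      (by rw [hBi.2.2.1, hB10, neg_zero])
    have hnm : n * m = 1 := by
      have : (n : ℝ) * m = 1 := by
        rw [hn, hm, hBi.1, ← mul_pow, hdet, one_pow]
      exact_mod_cast this
    have hn1 : n = 1 := by
      have h0 : (0 : ℝ) ≤ n := by rw [hn]; positivity
      have h0' : 0 ≤ n := by exact_mod_cast h0
      rcases Int.eq_one_or_neg_one_of_mul_eq_one hnm with h | h <;> omega
    have ha : B 0 0 ^ 2 = 1 := by rw [← hn, hn1]; simp
    have hBT := eq_pm_upperRightHom hBd hB10 ha
    obtain ⟨k, hk⟩ := (hcyc _).mp (hpm γ hγ _ hBT)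
    refine ⟨k, ?_⟩
    have e : (s₀ * d)⁻¹ * γ * (s₀ * d) = d⁻¹ * B * d := by rw [hB]; group
    rw [← hk] at hBT
    rw [e]
    rcases hBT with hBT | hBT <;> rw [hBT]
    · left; exact hdT' _
    · right; rw [mul_neg, neg_mul, hdT']
  · rintro ⟨n, hn⟩
    have hnl : s₀ * upperRightHom (n * l) * s₀⁻¹ ∈ Γ.grp := (hcyc _).mpr ⟨n, rfl⟩
    have hγ : γ = s₀ * upperRightHom (n * l) * s₀⁻¹ ∨ γ = -(s₀ * upperRightHom (n * l) * s₀⁻¹) := by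
      have e : γ = (s₀ * d) * ((s₀ * d)⁻¹ * γ * (s₀ * d)) * (s₀ * d)⁻¹ := by group
      rw [e]
      rcases hn with hn | hn <;> rw [hn, ← hdT]
      · left; group
      · right; rw [mul_neg, neg_mul]; congr 1; group
    rw [hfix]
    rcases hγ with hγ | hγ
    · refine ⟨hγ ▸ hnl, ?_⟩
      have : s₀⁻¹ * γ * s₀ = upperRightHom (n * l) := by rw [hγ]; group
      rw [this]; simp
    · refine ⟨hγ ▸ PSLSubgroup.neg_mem hnl, ?_⟩
      have : s₀⁻¹ * γ * s₀ = -upperRightHom (n * l) := by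
        rw [hγ, mul_neg, neg_mul]; congr 1; group
      rw [this]; simp

/-! ### Packing estimates -/

/-- The kernel `cosh (d(z, w)) ^ (-2)`. -/
def coshKernel (z w : ℍ) : ℝ≥0∞ := ENNReal.ofReal ((Real.cosh (dist z w) ^ 2)⁻¹)

lemma measurable_coshKernel (z : ℍ) : Measurable (coshKernel z) := by
  refine Measurable.ennreal_ofReal (Continuous.measurable ?_)
  refine Continuous.inv₀ (by fun_prop) fun w => ?_
  exact pow_ne_zero 2 (ne_of_gt (Real.cosh_pos _))

/-- The mass of the kernel `coshKernel`. -/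
def kernelMass : ℝ≥0∞ := ∫⁻ w, coshKernel I w

/-- The kernel and the area are invariant under `SL₂(ℝ)`, which acts transitively. This is what
makes the packing estimates independent of `z`. -/
lemma lintegral_coshKernel (z : ℍ) : ∫⁻ w, coshKernel z w = kernelMass := by
  have hz : SpecialLinearGroup.toGL z.toSL2R • I = z := by rw [toGL_smul, toSL2R_smul_I]
  have hd : (SpecialLinearGroup.toGL z.toSL2R).det = 1 := SpecialLinearGroup.coeToGL_det _
  rw [kernelMass, ← (measurePreserving_smul (SpecialLinearGroup.toGL z.toSL2R)
    (volume : Measure ℍ)).lintegral_comp (measurable_coshKernel z)]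
  congr 1
  ext w
  nth_rewrite 1 [← hz]
  rw [coshKernel, dist_smul_smul hd, coshKernel]

/-- Since `cosh d(z, i) = (|z|² + 1) / (2y)`, the factors `y` cancel against the density `y⁻²` and
leave `4 / (1 + |z|²)²`, which is integrable over all of `ℂ`. -/
lemma kernelMass_lt_top : kernelMass < ∞ := by
  have hint : Integrable (fun z : ℂ => (1 + ‖z‖ ^ 2) ^ (-(4 : ℝ) / 2)) :=
    integrable_rpow_neg_one_add_norm_sq (by simp [Complex.finrank_real_complex]; norm_num)
  have hfin := (hint.const_mul 4).lintegral_lt_top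
  refine lt_of_le_of_lt ?_ hfin
  have hm : Measurable fun z : ℍ =>
      (((1 / NNReal.mk z.im z.im_pos.le : ℝ≥0) ^ 2 : ℝ≥0) : ℝ≥0∞) := by
    refine Measurable.coe_nnreal_ennreal (Measurable.pow_const (Measurable.const_div ?_ _) _)
    exact (continuous_im.subtype_mk _).measurable
  rw [kernelMass, volume_def, lintegral_withDensity_eq_lintegral_mul _ hm (measurable_coshKernel I)]
  have hle : ∀ z : ℍ, ((fun z : ℍ => (((1 / NNReal.mk z.im z.im_pos.le : ℝ≥0) ^ 2 : ℝ≥0) : ℝ≥0∞)) *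
      coshKernel I) z ≤ ENNReal.ofReal (4 * (1 + ‖(z : ℂ)‖ ^ 2) ^ (-(4 : ℝ) / 2)) := by
    intro z
    have h1 : (((1 / NNReal.mk z.im z.im_pos.le : ℝ≥0) ^ 2 : ℝ≥0) : ℝ≥0∞) =
        ENNReal.ofReal ((1 / z.im) ^ 2) := by
      rw [ENNReal.ofReal, Real.toNNReal_of_nonneg (by positivity)]
      congr 1
    rw [Pi.mul_apply, h1, coshKernel, ← ENNReal.ofReal_mul (by positivity)]
    refine ENNReal.ofReal_le_ofReal (le_of_eq ?_)
    have hpos := z.im_pos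
    have hn : ‖(z : ℂ)‖ ^ 2 = z.re ^ 2 + z.im ^ 2 := by
      rw [← Complex.normSq_eq_norm_sq, Complex.normSq_apply]; simp [sq]
    rw [cosh_dist', hn, show (-(4 : ℝ) / 2) = -(2 : ℕ) by norm_num, Real.rpow_neg (by positivity),
      Real.rpow_natCast]
    simp only [I_re, I_im]
    have : 0 < z.re ^ 2 + z.im ^ 2 := by positivity
    field_simp
    ring
  refine (lintegral_mono hle).trans ?_
  have : MeasurePreserving UpperHalfPlane.coe (volume.comap UpperHalfPlane.coe)
      (volume.restrict (.range UpperHalfPlane.coe)) :=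
    ⟨measurable_coe, by rw [measurableEmbedding_coe.map_comap]⟩
  rw [this.lintegral_comp_emb measurableEmbedding_coe
    (fun z : ℂ => ENNReal.ofReal (4 * (1 + ‖z‖ ^ 2) ^ (-(4 : ℝ) / 2)))]
  exact setLIntegral_le_lintegral _ _

instance : (volume : Measure ℍ).IsOpenPosMeasure := by
  refine ⟨fun U hU hne h0 => ?_⟩
  rw [volume_eq_lintegral, lintegral_eq_zero_iff (by fun_prop)] at h0
  have hUo : IsOpen (UpperHalfPlane.coe '' U) := isOpenEmbedding_coe.isOpenMap U hU
  have hf : ∀ᵐ z : ℂ ∂(volume.restrict (UpperHalfPlane.coe '' U)), False := by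
    filter_upwards [h0, ae_restrict_mem hUo.measurableSet] with z hz hzU
    obtain ⟨w, -, rfl⟩ := hzU
    simp [w.im_ne_zero] at hz
  rw [Filter.eventually_false_iff_eq_bot, ae_eq_bot, Measure.restrict_eq_zero] at hf
  exact absurd hf (ne_of_gt (hUo.measure_pos volume (hne.image _)))

/-- If `f i ≤ A cosh (d(z, w)) ^ (-2)` for the points `w` of disjoint sets `B i` of measure at
least `v`, then `∑ f i` is bounded independently of `z`. -/
lemma tsum_mul_le_kernelMass {ι : Type*} (z : ℍ) (B : ι → Set ℍ) (hB : ∀ i, MeasurableSet (B i))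
    (hd : Pairwise fun i j => Disjoint (B i) (B j)) (f : ι → ℝ≥0∞) (v A : ℝ≥0∞)
    (hv : ∀ i, v ≤ volume (B i)) (hf : ∀ i, ∀ w ∈ B i, f i ≤ A * coshKernel z w) :
    (∑' i, f i) * v ≤ A * kernelMass := by
  rw [← ENNReal.tsum_mul_right]
  rw [ENNReal.tsum_eq_iSup_sum]
  refine iSup_le fun s => ?_
  calc ∑ i ∈ s, f i * v ≤ ∑ i ∈ s, ∫⁻ w in B i, A * coshKernel z w := by
        refine Finset.sum_le_sum fun i _ => ?_
        calc f i * v ≤ f i * volume (B i) := by gcongr; exact hv i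
          _ = ∫⁻ _ in B i, f i := by rw [setLIntegral_const]
          _ ≤ _ := setLIntegral_mono' (hB i) (hf i)
    _ = ∫⁻ w in ⋃ i ∈ s, B i, A * coshKernel z w := by
        rw [lintegral_biUnion_finset (fun i _ j _ hij => hd hij) (fun i _ => hB i)]
    _ ≤ ∫⁻ w, A * coshKernel z w := setLIntegral_le_lintegral _ _
    _ = A * kernelMass := by
        rw [lintegral_const_mul _ (measurable_coshKernel z), lintegral_coshKernel]

/-- A box in the horoball of height one. -/
def horoBox (x : ℝ) : Set ℍ := {u | |u.re - x| < 1 ∧ 1 < u.im ∧ u.im < 2}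

lemma isOpen_horoBox (x : ℝ) : IsOpen (horoBox x) := by
  refine IsOpen.and ?_ (IsOpen.and ?_ ?_)
  · exact isOpen_lt (by fun_prop) continuous_const
  · exact isOpen_lt continuous_const continuous_im
  · exact isOpen_lt continuous_im continuous_const

lemma volume_horoBox (x : ℝ) : volume (horoBox x) = volume (horoBox 0) := by
  rw [← measure_preimage_smul (volume : Measure ℍ) (upperRightHom x : GL (Fin 2) ℝ) (horoBox x)]
  congr 1
  ext u
  have hre : (upperRightHom x • u).re = u.re + x := by
    rw [← coe_re, upperRightHom_smul_coe]; simp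
  simp only [horoBox, Set.mem_preimage, Set.mem_ofPred_eq, hre, upperRightHom_smul_im]
  simp

lemma volume_horoBox_ne_zero : volume (horoBox 0) ≠ 0 := by
  refine ((isOpen_horoBox 0).measure_pos volume ⟨⟨⟨0, 3 / 2⟩, by norm_num⟩, ?_⟩).ne'
  refine ⟨?_, ?_, ?_⟩ <;> simp [UpperHalfPlane.re, UpperHalfPlane.im] <;> norm_num

/-- The constant of the packing estimate for horoballs. -/
def horoConst (H : ℝ) : ℝ≥0∞ :=
  ENNReal.ofReal (((5 + H ^ 2) / 2) ^ 2) * kernelMass / volume (horoBox 0)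

lemma horoConst_ne_top (H : ℝ) : horoConst H ≠ ∞ :=
  ENNReal.div_ne_top (ENNReal.mul_ne_top ENNReal.ofReal_ne_top kernelMass_lt_top.ne)
    volume_horoBox_ne_zero

/-- The box for the index `i` lies in the `i`-th horoball, directly above or below `z` as seen from
that cusp. The height bound `H` is needed because `cosh d(z, w)` grows with the height of `z` once
`z` is above the box. -/
lemma tsum_height_sq_le {ι : Type*} (s : ι → GL (Fin 2) ℝ) (hs : ∀ i, (s i).det = 1)
    (hd : ∀ i j, ∀ w : ℍ, 1 < ((s i)⁻¹ • w).im → 1 < ((s j)⁻¹ • w).im → i = j)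
    (z : ℍ) {H : ℝ} (hH : ∀ i, ((s i)⁻¹ • z).im ≤ H) :
    ∑' i, ENNReal.ofReal (((s i)⁻¹ • z).im ^ 2) ≤ horoConst H := by
  have h := tsum_mul_le_kernelMass z
    (fun i => (fun w => (s i)⁻¹ • w) ⁻¹' horoBox ((s i)⁻¹ • z).re)
    (fun i => ((isOpen_horoBox _).preimage (continuous_const_smul _)).measurableSet)
    (fun i j hij => Set.disjoint_left.mpr fun w hw hw' => hij (hd i j w hw.2.1 hw'.2.1))
    (fun i => ENNReal.ofReal (((s i)⁻¹ • z).im ^ 2)) (volume (horoBox 0))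
    (ENNReal.ofReal (((5 + H ^ 2) / 2) ^ 2))
    (fun i => by rw [measure_preimage_smul, volume_horoBox ((s i)⁻¹ • z).re]) ?_
  · rw [horoConst, ENNReal.le_div_iff_mul_le (Or.inl volume_horoBox_ne_zero)
      (Or.inr (ENNReal.mul_ne_top ENNReal.ofReal_ne_top kernelMass_lt_top.ne))]
    exact h
  · rintro i w ⟨h1, h2, h3⟩
    rw [coshKernel, ← dist_smul_smul (det_inv_eq_one (hs i)), cosh_dist',
      ← ENNReal.ofReal_mul (by positivity)]
    refine ENNReal.ofReal_le_ofReal ?_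
    set y := (s i)⁻¹ • z
    set u := (s i)⁻¹ • w
    have hy := y.im_pos
    have hyH : y.im ≤ H := hH i
    have hre : (y.re - u.re) ^ 2 ≤ 1 := by
      rw [sq_le_one_iff_abs_le_one, abs_sub_comm]; exact h1.le
    rw [← inv_pow, ← mul_pow, inv_div]
    refine pow_le_pow_left₀ hy.le ?_ 2
    rw [mul_div_assoc', le_div_iff₀ (by positivity)]
    -- This is the numerator of `cosh d(y, u)`: at most `1` horizontally, `H²` from `z` and `2²`
    -- from the box.
    have : (y.re - u.re) ^ 2 + y.im ^ 2 + u.im ^ 2 ≤ 5 + H ^ 2 := by nlinarith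
    have hu : (5 + H ^ 2) ≤ (5 + H ^ 2) * u.im := by nlinarith [sq_nonneg H]
    nlinarith

lemma volume_ball (w : ℍ) (r : ℝ) : volume (Metric.ball w r) = volume (Metric.ball I r) := by
  have hz : SpecialLinearGroup.toGL w.toSL2R • I = w := by rw [toGL_smul, toSL2R_smul_I]
  have hd : (SpecialLinearGroup.toGL w.toSL2R).det = 1 := SpecialLinearGroup.coeToGL_det _
  rw [← measure_preimage_smul (volume : Measure ℍ) (SpecialLinearGroup.toGL w.toSL2R)
    (Metric.ball w r)]
  congr 1
  ext u
  rw [Set.mem_preimage, Metric.mem_ball, Metric.mem_ball]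
  nth_rewrite 2 [← hz]
  rw [dist_smul_smul hd]

/-- The constant of the packing estimate for balls. -/
def ballConst (ε : ℝ) : ℝ≥0∞ :=
  ENNReal.ofReal ((Real.cosh ε / Real.sinh ε * Real.exp 1) ^ 2) * kernelMass /
    volume (Metric.ball I ε)

lemma ballConst_ne_top {ε : ℝ} (hε : 0 < ε) : ballConst ε ≠ ∞ :=
  ENNReal.div_ne_top (ENNReal.mul_ne_top ENNReal.ofReal_ne_top kernelMass_lt_top.ne)
    (Metric.measure_ball_pos volume I hε).ne'

/-- The balls of radius `ε` around the points are disjoint. Passing from `sinh` to `cosh` costs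
`coth ε`, as `z` stays at distance `ε` from the points; moving from a centre to another point of its
ball costs `e`, as `ε ≤ 1`. -/
lemma tsum_inv_sinh_sq_le {ι : Type*} (p : ι → ℍ) (z : ℍ) {ε : ℝ} (hε : 0 < ε) (hε1 : ε ≤ 1)
    (hp : ∀ i j, dist (p i) (p j) < 2 * ε → i = j) (hz : ∀ i, ε ≤ dist z (p i)) :
    ∑' i, ENNReal.ofReal ((Real.sinh (dist z (p i)) ^ 2)⁻¹) ≤ ballConst ε := by
  have h := tsum_mul_le_kernelMass z (fun i => Metric.ball (p i) ε)
    (fun i => measurableSet_ball)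
    (fun i j hij => Set.disjoint_left.mpr fun w hw hw' => hij (hp i j ?_))
    (fun i => ENNReal.ofReal ((Real.sinh (dist z (p i)) ^ 2)⁻¹)) (volume (Metric.ball I ε))
    (ENNReal.ofReal ((Real.cosh ε / Real.sinh ε * Real.exp 1) ^ 2))
    (fun i => (volume_ball (p i) ε).ge) ?_
  · rw [ballConst, ENNReal.le_div_iff_mul_le
      (Or.inl (Metric.measure_ball_pos volume I hε).ne')
      (Or.inr (ENNReal.mul_ne_top ENNReal.ofReal_ne_top kernelMass_lt_top.ne))]
    exact h
  · have h1 := Metric.mem_ball'.mp hw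
    have h2 := Metric.mem_ball.mp hw'
    linarith [dist_triangle (p i) w (p j)]
  · intro i w hw
    rw [coshKernel, ← ENNReal.ofReal_mul (by positivity)]
    refine ENNReal.ofReal_le_ofReal ?_
    have hdw : dist z w ≤ dist z (p i) + 1 := by
      have := Metric.mem_ball'.mp hw
      linarith [dist_triangle z (p i) w]
    set d := dist z (p i)
    have hd : ε ≤ d := hz i
    have hsε : 0 < Real.sinh ε := Real.sinh_pos_iff.mpr hε
    have hsd : 0 < Real.sinh d := Real.sinh_pos_iff.mpr (by linarith)
    have hc1 : Real.cosh (dist z w) ≤ Real.exp 1 * Real.cosh d := by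
      have : Real.cosh (dist z w) ≤ Real.cosh (d + 1) := by
        rw [Real.cosh_le_cosh, abs_of_nonneg dist_nonneg, abs_of_nonneg (by linarith)]
        exact hdw
      refine this.trans ?_
      rw [Real.cosh_eq, Real.cosh_eq, Real.exp_add]
      have h1 : Real.exp (-(d + 1)) ≤ Real.exp 1 * Real.exp (-d) := by
        rw [← Real.exp_add]; exact Real.exp_le_exp.mpr (by linarith)
      nlinarith
    -- Monotonicity of `coth`, read off from `sinh (d - ε) ≥ 0`.
    have hc2 : Real.cosh d * Real.sinh ε ≤ Real.sinh d * Real.cosh ε := by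
      have : 0 ≤ Real.sinh (d - ε) := Real.sinh_nonneg_iff.mpr (by linarith)
      rw [Real.sinh_sub] at this
      linarith
    have hcw := Real.cosh_pos (dist z w)
    rw [← inv_pow, ← inv_pow, ← mul_pow]
    refine pow_le_pow_left₀ (by positivity) ?_ 2
    rw [inv_le_comm₀ hsd (by positivity), mul_inv, inv_inv, mul_inv, inv_div]
    calc Real.sinh ε / Real.cosh ε * (Real.exp 1)⁻¹ * Real.cosh (dist z w)
        ≤ Real.sinh ε / Real.cosh ε * (Real.exp 1)⁻¹ * (Real.exp 1 * Real.cosh d) := by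
          have := Real.cosh_pos ε
          gcongr
      _ = (Real.cosh d * Real.sinh ε) / Real.cosh ε := by
          field_simp
      _ ≤ Real.sinh d := by
          rw [div_le_iff₀ (Real.cosh_pos ε)]; exact hc2

/-! ### Uniform geometric bounds -/

/-- The geometric data of `Γ` that bound the constants of `X` and of all of its covers: `ε` bounds
from below the displacement of the hyperbolic elements and the distances between the elliptic
points, `m` bounds the orders of their stabilizers, and `v` bounds the area from below. -/
structure GeomBound (Γ : PSLSubgroup) (ε : ℝ) (m : ℕ) (v : ℝ≥0∞) : Prop where
  locFinite : IsLocFinite Γ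
  le_dist_smul : ∀ γ ∈ Γ.grp, γ.IsHyperbolic → ∀ z : ℍ, ε ≤ dist z (γ • z)
  eq_of_dist_lt : ∀ w w', IsEllipticPoint Γ w → IsEllipticPoint Γ w' → dist w w' < ε → w = w'
  encard_le : ∀ w, IsEllipticPoint Γ w → {γ : GL (Fin 2) ℝ | γ ∈ Γ.grp ∧ γ • w = w}.encard ≤ m
  le_hypVol : v ≤ hypVol Γ

lemma conj_smul_smul (g γ : GL (Fin 2) ℝ) (z : ℍ) : (g * γ * g⁻¹) • g • z = g • γ • z := by
  rw [mul_smul, mul_smul, inv_smul_smul]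

lemma isHyperbolic_conj (g γ : GL (Fin 2) ℝ) :
    (g * γ * g⁻¹).IsHyperbolic ↔ γ.IsHyperbolic := by
  have := Matrix.isHyperbolic_conj_iff (m := γ.val) g
  simpa [Matrix.GeneralLinearGroup.IsHyperbolic] using this

lemma isElliptic_conj (g γ : GL (Fin 2) ℝ) :
    (g * γ * g⁻¹).IsElliptic ↔ γ.IsElliptic := by
  have := Matrix.isElliptic_conj_iff (m := γ.val) g
  simpa [Matrix.GeneralLinearGroup.IsElliptic] using this

lemma IsEllipticPoint.conj {Γ Γ₀ : PSLSubgroup} {g : GL (Fin 2) ℝ}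
    (hg : ∀ γ ∈ Γ.grp, g * γ * g⁻¹ ∈ Γ₀.grp) {w : ℍ} (hw : IsEllipticPoint Γ w) :
    IsEllipticPoint Γ₀ (g • w) := by
  obtain ⟨γ, hγ, he, hf⟩ := hw
  exact ⟨g * γ * g⁻¹, hg γ hγ, (isElliptic_conj g γ).mpr he, by rw [conj_smul_smul, hf]⟩

lemma IsEllipticPoint.smul {Γ : PSLSubgroup} {γ : GL (Fin 2) ℝ} (hγ : γ ∈ Γ.grp) {w : ℍ}
    (hw : IsEllipticPoint Γ w) : IsEllipticPoint Γ (γ • w) :=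
  hw.conj fun _ h => mul_mem (mul_mem hγ h) (inv_mem hγ)

lemma conj_injective (g : GL (Fin 2) ℝ) :
    Function.Injective fun γ : GL (Fin 2) ℝ => g * γ * g⁻¹ := by
  intro a b hab; simpa using hab

lemma IsLocFinite.of_conj {Γ Γ₀ : PSLSubgroup} {g : GL (Fin 2) ℝ} (hgd : g.det = 1)
    (hg : ∀ γ ∈ Γ.grp, g * γ * g⁻¹ ∈ Γ₀.grp) (h : IsLocFinite Γ₀) : IsLocFinite Γ := by
  intro R
  refine (h.finite_entries g hgd (1 + 2 * Real.cosh R)).subset ?_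
  rintro γ ⟨hγ, hR⟩
  refine ⟨hg γ hγ, Γ.det_eq_one γ hγ, ?_⟩
  have h1 := two_mul_cosh_dist_smul_I (Γ.det_eq_one γ hγ)
  have h2 : Real.cosh (dist (γ • I) I) ≤ Real.cosh R := by
    rw [Real.cosh_le_cosh, abs_of_nonneg dist_nonneg]
    exact hR.trans (le_abs_self R)
  have h3 : ∀ i j, γ i j ^ 2 ≤ 2 * Real.cosh R := by
    intro i j
    have := sq_nonneg (γ 0 0)
    have := sq_nonneg (γ 0 1)
    have := sq_nonneg (γ 1 0)
    have := sq_nonneg (γ 1 1)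
    fin_cases i <;> fin_cases j <;> simp only [Fin.zero_eta, Fin.mk_one] <;> linarith
  intro i j
  have := h3 i j
  nlinarith [sq_abs (γ i j), sq_nonneg (|γ i j| - 1)]

/-- The geometric bounds of a group are inherited by the subgroups of its conjugates. -/
lemma GeomBound.of_conj {Γ Γ₀ : PSLSubgroup} {ε : ℝ} {m : ℕ} {v : ℝ≥0∞} (h : GeomBound Γ₀ ε m v)
    {g : GL (Fin 2) ℝ} (hgd : g.det = 1) (hg : ∀ γ ∈ Γ.grp, g * γ * g⁻¹ ∈ Γ₀.grp) :
    GeomBound Γ ε m v where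
  locFinite := h.locFinite.of_conj hgd hg
  le_dist_smul γ hγ hh z := by
    have := h.le_dist_smul _ (hg γ hγ) ((isHyperbolic_conj g γ).mpr hh) (g • z)
    rwa [conj_smul_smul, dist_smul_smul hgd] at this
  eq_of_dist_lt w w' hw hw' hd := by
    have := h.eq_of_dist_lt _ _ (hw.conj hg) (hw'.conj hg) (by rwa [dist_smul_smul hgd])
    exact MulAction.injective g this
  encard_le w hw := by
    refine le_trans ?_ (h.encard_le _ (hw.conj hg))
    rw [← (conj_injective g).encard_image]
    refine Set.encard_le_encard ?_
    rintro _ ⟨γ, ⟨hγ, hf⟩, rfl⟩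
    exact ⟨hg γ hγ, by rw [conj_smul_smul, hf]⟩
  -- If `S` meets all orbits of `Γ`, then its translate by `g` has the same area and meets all
  -- orbits of `Γ₀`.
  le_hypVol := by
    refine h.le_hypVol.trans (le_iInf₂ fun S hS => ?_)
    rw [← measure_preimage_smul (volume : Measure ℍ) g⁻¹ S]
    refine iInf₂_le _ ⟨hS.1.preimage (measurable_const_smul _), fun z => ?_⟩
    obtain ⟨γ, hγ, hγS⟩ := hS.2 (g⁻¹ • z)
    refine ⟨_, hg γ hγ, ?_⟩
    rw [Set.mem_preimage, ← mul_smul]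
    rw [← mul_smul] at hγS
    convert hγS using 2
    group

/-! ### Horoballs -/

lemma IsScaling.discr_eq_zero {Γ : PSLSubgroup} {c : OnePoint ℝ} {s γ : GL (Fin 2) ℝ}
    (hs : IsScaling Γ c s) (hγ : γ ∈ Γ.grp) (hc : γ • c = c) : γ.val.discr = 0 := by
  obtain ⟨n, hn⟩ := (hs.stabilizer γ).mp ⟨hγ, hc⟩
  have h1 : γ.val.discr = (s⁻¹ * γ * s).val.discr := by
    simp
  rw [h1]
  rcases hn with hn | hn <;> rw [hn] <;>
    simp [Matrix.discr_fin_two, Matrix.trace_fin_two, Matrix.det_fin_two] <;> norm_num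

lemma IsScaling.smul_eq_self {Γ : PSLSubgroup} (h : IsLocFinite Γ) {c : OnePoint ℝ}
    {s γ : GL (Fin 2) ℝ} (hs : IsScaling Γ c s) (hγ : γ ∈ Γ.grp) {z : ℍ}
    (hz : 1 < (s⁻¹ • z).im) (hγz : 1 < (s⁻¹ • γ • z).im) : γ • c = c := by
  have := hs.eq_of_one_lt_im h (hs.smul (inv_mem hγ)) hz (by
    rwa [_root_.mul_inv_rev, inv_inv, mul_smul])
  rw [eq_inv_smul_iff] at this
  exact this

/-- Heights change by a factor of at most `e` over distance one, and `3 > e`. This is the reason for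
removing horoballs of height `3`: unit neighbourhoods of their points stay in the disjoint horoballs
of height `1`. -/
lemma one_lt_im_of_dist_lt {g : GL (Fin 2) ℝ} (hg : g.det = 1) {z w : ℍ} (hz : 3 < (g • z).im)
    (hd : dist z w < 1) : 1 < (g • w).im := by
  have h1 := im_div_exp_dist_le (g • z) (g • w)
  rw [dist_smul_smul hg] at h1
  refine lt_of_lt_of_le ?_ h1
  rw [one_lt_div (Real.exp_pos _)]
  have := Real.exp_lt_exp.mpr hd
  linarith [Real.exp_one_lt_d9]

/-- An element fixing a point of the horoball must fix the cusp, so up to sign it is conjugate to a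
translation and has discriminant zero. -/
lemma IsScaling.not_isEllipticPoint {Γ : PSLSubgroup} (h : IsLocFinite Γ) {c : OnePoint ℝ}
    {s : GL (Fin 2) ℝ} (hs : IsScaling Γ c s) {w : ℍ} (hw : 1 < (s⁻¹ • w).im) :
    ¬ IsEllipticPoint Γ w := by
  rintro ⟨γ, hγ, he, hf⟩
  have := hs.discr_eq_zero hγ (hs.smul_eq_self h hγ hw (by rwa [hf]))
  exact he.ne this

/-! ### Groups with a compact core -/

/-- The complement of the horoballs of height `3` is compact modulo `Γ`. -/
def HasCore (Γ : PSLSubgroup) : Prop :=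
  ∃ R : ℝ, ∀ z : ℍ, (∃ γ ∈ Γ.grp, dist (γ • z) I ≤ R) ∨
    ∃ c s, IsScaling Γ c s ∧ 3 < (s⁻¹ • z).im

lemma smul_ne_of_isHyperbolic {γ : GL (Fin 2) ℝ} (hd : γ.det = 1) (hh : γ.IsHyperbolic) (z : ℍ) :
    γ • z ≠ z := by
  intro hz
  have hpos : 0 < γ.val.det := by rw [det_val_eq_one hd]; exact one_pos
  have hh' : 0 < γ.val.discr := hh
  by_cases hc : γ ∈ Subgroup.center (GL (Fin 2) ℝ)
  · rw [GeneralLinearGroup.mem_center_iff_val_mem_range_scalar] at hc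
    obtain ⟨a, ha⟩ := hc
    rw [← ha] at hh'
    simp [Matrix.discr_fin_two] at hh'
    nlinarith
  · have he : γ.val.discr < 0 := isElliptic_of_exists_smul_eq_self hpos hc ⟨z, hz⟩
    linarith

/-- An element moving a point of the ball by less than `1` belongs to a finite set, and each
hyperbolic element of that set has a positive minimal displacement on the compact ball. Stating the
bound for all small `ε` lets several such conditions be combined. -/
lemma exists_le_dist_smul {Γ : PSLSubgroup} (h : IsLocFinite Γ) (R : ℝ) :
    ∀ᶠ ε in nhdsWithin (0 : ℝ) (Set.Ioi 0), ∀ γ ∈ Γ.grp, γ.IsHyperbolic →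
      ∀ z : ℍ, dist z I ≤ R → ε ≤ dist z (γ • z) := by
  have hfin := h.finite_dist (R + 1)
  have key : ∀ γ ∈ {γ : GL (Fin 2) ℝ | γ ∈ Γ.grp ∧ ∃ z : ℍ, dist z I ≤ R + 1 ∧
      dist (γ • z) I ≤ R + 1}, ∀ᶠ ε in nhdsWithin (0 : ℝ) (Set.Ioi 0), γ.IsHyperbolic →
      ∀ z : ℍ, dist z I ≤ R → ε ≤ dist z (γ • z) := by
    rintro γ ⟨hγ, -⟩
    by_cases hh : γ.IsHyperbolic
    swap; · exact Filter.Eventually.of_forall fun _ h => absurd h hh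
    rcases (Metric.closedBall I R).eq_empty_or_nonempty with he | hne
    · refine Filter.Eventually.of_forall fun _ _ z hz => ?_
      exact absurd (show z ∈ Metric.closedBall I R from hz) (by rw [he]; simp)
    obtain ⟨z₀, hz₀, hmin⟩ := (isCompact_closedBall I R).exists_isMinOn hne
      (f := fun z => dist z (γ • z))
      (Continuous.continuousOn (continuous_id.dist (continuous_const_smul γ)))
    have hpos : 0 < dist z₀ (γ • z₀) :=
      dist_pos.mpr (smul_ne_of_isHyperbolic (Γ.det_eq_one γ hγ) hh z₀).symm
    have : ∀ᶠ ε in nhdsWithin (0 : ℝ) (Set.Ioi 0), ε < dist z₀ (γ • z₀) :=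
      nhdsWithin_le_nhds (eventually_lt_nhds hpos)
    filter_upwards [this] with ε hε _ z hz
    exact hε.le.trans (hmin hz)
  have h1 : ∀ᶠ ε in nhdsWithin (0 : ℝ) (Set.Ioi 0), ε < 1 :=
    nhdsWithin_le_nhds (eventually_lt_nhds one_pos)
  filter_upwards [(Filter.eventually_all_finite hfin).mpr key, h1] with ε hε hε1 γ hγ hh z hz
  by_cases hd : dist z (γ • z) < 1
  · refine hε γ ⟨hγ, z, by linarith, ?_⟩ hh z hz
    rw [dist_comm] at hd
    linarith [dist_triangle (γ • z) z I]
  · linarith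

/-- Each such point is the unique fixed point in `ℍ` of an elliptic element from a finite set. -/
lemma finite_ellipticPoints {Γ : PSLSubgroup} (h : IsLocFinite Γ) (R : ℝ) :
    {w : ℍ | IsEllipticPoint Γ w ∧ dist w I ≤ R}.Finite := by
  have hfin : (⋃ γ ∈ {γ : GL (Fin 2) ℝ | γ ∈ Γ.grp ∧ ∃ z : ℍ, dist z I ≤ R ∧ dist (γ • z) I ≤ R},
      {w : ℍ | γ.IsElliptic ∧ γ • w = w}).Finite := by
    refine (h.finite_dist R).biUnion fun γ hγ => Set.Subsingleton.finite ?_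
    rintro w ⟨he, hw⟩ w' ⟨-, hw'⟩
    have hpos : 0 < γ.val.det := by
      rw [det_val_eq_one (Γ.det_eq_one γ hγ.1)]; exact one_pos
    rw [gl_smul_eq_self_iff_eq_fixedPt hpos he] at hw hw'
    rw [hw, hw']
  refine hfin.subset ?_
  rintro w ⟨⟨γ, hγ, he, hw⟩, hR⟩
  exact Set.mem_biUnion (x := γ) ⟨hγ, w, hR, by rwa [hw]⟩ ⟨he, hw⟩

lemma exists_ellipticPoints_separated {Γ : PSLSubgroup} (h : IsLocFinite Γ) (R : ℝ) :
    ∀ᶠ ε in nhdsWithin (0 : ℝ) (Set.Ioi 0), ∀ w w', IsEllipticPoint Γ w → IsEllipticPoint Γ w' →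
      dist w I ≤ R → dist w w' < ε → w = w' := by
  have hfin := finite_ellipticPoints h (R + 1)
  have key : ∀ p ∈ {w : ℍ | IsEllipticPoint Γ w ∧ dist w I ≤ R + 1} ×ˢ
      {w : ℍ | IsEllipticPoint Γ w ∧ dist w I ≤ R + 1},
      ∀ᶠ ε in nhdsWithin (0 : ℝ) (Set.Ioi 0), dist p.1 p.2 < ε → p.1 = p.2 := by
    rintro ⟨w, w'⟩ -
    by_cases hww : w = w'
    · exact Filter.Eventually.of_forall fun _ _ => hww
    have : ∀ᶠ ε in nhdsWithin (0 : ℝ) (Set.Ioi 0), ε < dist w w' :=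
      nhdsWithin_le_nhds (eventually_lt_nhds (dist_pos.mpr hww))
    filter_upwards [this] with ε hε hlt
    exact absurd hlt (not_lt.mpr hε.le)
  have h1 : ∀ᶠ ε in nhdsWithin (0 : ℝ) (Set.Ioi 0), ε < 1 :=
    nhdsWithin_le_nhds (eventually_lt_nhds one_pos)
  filter_upwards [(Filter.eventually_all_finite (hfin.prod hfin)).mpr key, h1]
    with ε hε hε1 w w' hw hw' hR hd
  refine hε (w, w') ⟨⟨hw, by linarith⟩, ⟨hw', ?_⟩⟩ hd
  have := dist_triangle w' w I
  rw [dist_comm w' w] at this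
  linarith

lemma IsLocFinite.countable {Γ : PSLSubgroup} (h : IsLocFinite Γ) : Countable Γ.grp := by
  have : (Γ.grp : Set (GL (Fin 2) ℝ)) ⊆
      ⋃ n : ℕ, {γ : GL (Fin 2) ℝ | γ ∈ Γ.grp ∧ dist (γ • I) I ≤ n} := by
    intro γ hγ
    obtain ⟨n, hn⟩ := exists_nat_ge (dist (γ • I) I)
    exact Set.mem_iUnion.mpr ⟨n, hγ, hn⟩
  exact ((Set.countable_iUnion fun n : ℕ => (h n).countable).mono this).to_subtype

/-- The unit ball around `i` is covered by translates of pieces of `S`, and a point of `S` is used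
at most as often as there are elements mapping some point of the closed ball into it. Hence the area
of `S` is at least that of the ball divided by this number. -/
lemma exists_le_hypVol {Γ : PSLSubgroup} (h : IsLocFinite Γ) : ∃ v ≠ 0, v ≤ hypVol Γ := by
  have hfin := h.finite_dist 1
  set Φ := {γ : GL (Fin 2) ℝ | γ ∈ Γ.grp ∧ ∃ z : ℍ, dist z I ≤ 1 ∧ dist (γ • z) I ≤ 1} with hΦ
  have hcount := h.countable
  have hΦtop : ((Φ.encard : ℕ∞) : ℝ≥0∞) ≠ ∞ := by
    rw [hfin.encard_eq_coe_toFinset_card]; simp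
  refine ⟨volume (Metric.ball I 1) / Φ.encard,
    ENNReal.div_ne_zero.mpr ⟨(Metric.measure_ball_pos volume I one_pos).ne', hΦtop⟩,
    le_iInf₂ fun S hS => ENNReal.div_le_of_le_mul' ?_⟩
  have hsub : Metric.ball I 1 ⊆ ⋃ γ : Γ.grp, (Metric.ball I 1 ∩ (fun z => γ.1 • z) ⁻¹' S) := by
    intro z hz
    obtain ⟨γ, hγ, hγS⟩ := hS.2 z
    exact Set.mem_iUnion.mpr ⟨⟨γ, hγ⟩, hz, hγS⟩
  have hmeas : ∀ γ : GL (Fin 2) ℝ, MeasurableSet ((fun z : ℍ => γ • z) ⁻¹' Metric.ball I 1) :=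
    fun γ => measurableSet_ball.preimage (measurable_const_smul _)
  calc volume (Metric.ball I 1)
      ≤ ∑' γ : Γ.grp, volume (Metric.ball I 1 ∩ (fun z => γ.1 • z) ⁻¹' S) :=
        (measure_mono hsub).trans (measure_iUnion_le _)
    _ = ∑' γ : Γ.grp, ∫⁻ w in S, ((fun z => γ.1⁻¹ • z) ⁻¹' Metric.ball I 1).indicator 1 w := by
        congr 1
        ext γ
        rw [lintegral_indicator_one (hmeas _), Measure.restrict_apply (hmeas _),
          ← measure_preimage_smul (volume : Measure ℍ) γ.1
            ((fun z => γ.1⁻¹ • z) ⁻¹' Metric.ball I 1 ∩ S)]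
        congr 1
        ext z
        simp
    _ = ∫⁻ w in S, ∑' γ : Γ.grp, ((fun z => γ.1⁻¹ • z) ⁻¹' Metric.ball I 1).indicator 1 w :=
        (lintegral_tsum fun γ => (measurable_one.indicator (hmeas _)).aemeasurable).symm
    _ ≤ ∫⁻ w in S, (Φ.encard : ℝ≥0∞) := by
        refine lintegral_mono fun w => ?_
        have e : ∀ γ : Γ.grp, ((fun z => γ.1⁻¹ • z) ⁻¹' Metric.ball I 1).indicator
            (1 : ℍ → ℝ≥0∞) w = {γ : Γ.grp | γ.1⁻¹ • w ∈ Metric.ball I 1}.indicator 1 γ :=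
          fun γ => by simp only [Set.indicator, Set.mem_preimage, Set.mem_ofPred_eq]; rfl
        simp_rw [e]
        rw [← tsum_subtype]
        simp only [Pi.one_apply]
        rw [ENNReal.tsum_set_one]
        refine ENat.toENNReal_le.mpr ?_
        rcases Set.eq_empty_or_nonempty {γ : Γ.grp | γ.1⁻¹ • w ∈ Metric.ball I 1} with he | ⟨γ₀, h₀⟩
        · rw [he]; simp
        have hinj : Function.Injective fun γ : Γ.grp => γ.1⁻¹ * γ₀.1 := by
          intro a b hab; simpa using hab
        rw [← hinj.encard_image]
        refine Set.encard_le_encard ?_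
        rintro _ ⟨γ, hγ, rfl⟩
        refine ⟨mul_mem (inv_mem γ.2) γ₀.2, γ₀.1⁻¹ • w, (Metric.mem_ball.mp h₀).le, ?_⟩
        rw [mul_smul, smul_inv_smul]
        exact (Metric.mem_ball.mp hγ).le
    _ = Φ.encard * volume S := by rw [setLIntegral_const]

/-- A discrete group with a compact core has uniform geometric bounds. -/
lemma HasCore.exists_geomBound {Γ : PSLSubgroup} (h : IsLocFinite Γ) (hc : HasCore Γ) :
    ∃ ε > 0, ∃ m, ∃ v ≠ 0, GeomBound Γ ε m v := by
  obtain ⟨R, hR⟩ := hc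
  obtain ⟨v, hv0, hv⟩ := exists_le_hypVol h
  have h1 : ∀ᶠ ε in nhdsWithin (0 : ℝ) (Set.Ioi 0), ε < 1 :=
    nhdsWithin_le_nhds (eventually_lt_nhds one_pos)
  obtain ⟨ε, ⟨⟨hhyp, hell⟩, hε1⟩, hε0⟩ := ((((exists_le_dist_smul h R).and
    (exists_ellipticPoints_separated h R)).and h1).and self_mem_nhdsWithin).exists
  have hfin := h.finite_dist R
  refine ⟨ε, hε0, hfin.toFinset.card, v, hv0, h, ?_, ?_, ?_, hv⟩
  · intro γ hγ hh z
    rcases hR z with ⟨g, hg, hgz⟩ | ⟨c, s, hs, hz⟩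
    · have := hhyp (g * γ * g⁻¹) (mul_mem (mul_mem hg hγ) (inv_mem hg))
        ((isHyperbolic_conj g γ).mpr hh) (g • z) hgz
      rwa [conj_smul_smul, dist_smul_smul (Γ.det_eq_one g hg)] at this
    -- High in a horoball, a short displacement keeps the point in the horoball of height one, so
    -- `γ` fixes the cusp and cannot be hyperbolic.
    · by_contra! hlt
      have h2 := one_lt_im_of_dist_lt (det_inv_eq_one hs.det) hz (hlt.trans hε1)
      have h3 := hs.discr_eq_zero hγ (hs.smul_eq_self h hγ (by linarith) h2)
      have h4 : 0 < γ.val.discr := hh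
      linarith
  · intro w w' hw hw' hd
    rcases hR w with ⟨g, hg, hgz⟩ | ⟨c, s, hs, hz⟩
    · refine MulAction.injective g (hell _ _ (hw.smul hg) (hw'.smul hg) hgz ?_)
      rwa [dist_smul_smul (Γ.det_eq_one g hg)]
    · exact absurd hw (hs.not_isEllipticPoint h (by linarith))
  · intro w hw
    rcases hR w with ⟨g, hg, hgz⟩ | ⟨c, s, hs, hz⟩
    · rw [← hfin.encard_eq_coe_toFinset_card, ← (conj_injective g).encard_image]
      refine Set.encard_le_encard ?_
      rintro _ ⟨γ, ⟨hγ, hf⟩, rfl⟩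
      refine ⟨mul_mem (mul_mem hg hγ) (inv_mem hg), g • w, hgz, ?_⟩
      rw [conj_smul_smul, hf]
      exact hgz
    · exact absurd hw (hs.not_isEllipticPoint h (by linarith))

/-! ### The core of a Fuchsian group of the first kind -/

/-- The open subset of `ℍ*` of the points that can be moved to a distance less than `R` from `i`, or
lie in a horoball of height `3`. -/
def corePred (Γ : PSLSubgroup) (R : ℝ) : ExtHalfPlane Γ → Prop
  | .point z => (∃ γ ∈ Γ.grp, dist (γ • z) I < R) ∨ ∃ c s, IsScaling Γ c s ∧ 3 < (s⁻¹ • z).im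
  | .cusp _ _ => True

lemma corePred_smul {Γ : PSLSubgroup} {R : ℝ} {z : ℍ} {γ : GL (Fin 2) ℝ} (hγ : γ ∈ Γ.grp)
    (h : corePred Γ R (.point z)) : corePred Γ R (.point (γ • z)) := by
  rcases h with ⟨δ, hδ, h⟩ | ⟨c, s, hs, h⟩
  · refine Or.inl ⟨δ * γ⁻¹, mul_mem hδ (inv_mem hγ), ?_⟩
    rwa [mul_smul, inv_smul_smul]
  · refine Or.inr ⟨_, _, hs.smul hγ, ?_⟩
    rwa [_root_.mul_inv_rev, mul_smul, inv_smul_smul]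

lemma corePred_rel {Γ : PSLSubgroup} {R : ℝ} (x y : ExtHalfPlane Γ) (h : extRel Γ x y) :
    corePred Γ R x = corePred Γ R y := by
  match x, y with
  | .point z, .point w =>
    obtain ⟨γ, hγ, rfl⟩ := h
    refine propext ⟨corePred_smul hγ, fun h => ?_⟩
    simpa using corePred_smul (inv_mem hγ) h
  | .cusp _ _, .cusp _ _ => rfl
  | .point _, .cusp _ _ => exact absurd h id
  | .cusp _ _, .point _ => exact absurd h id

lemma isOpen_corePred {Γ : PSLSubgroup} (h : IsLocFinite Γ) (R : ℝ) :
    IsOpen {x : ExtHalfPlane Γ | corePred Γ R x} := by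
  refine ⟨?_, fun c hc _ g hg hgc => ?_⟩
  · have : {z : ℍ | ExtHalfPlane.point z ∈ {x : ExtHalfPlane Γ | corePred Γ R x}} =
        (⋃ γ ∈ Γ.grp, {z : ℍ | dist (γ • z) I < R}) ∪
        ⋃ (c : OnePoint ℝ) (s : GL (Fin 2) ℝ) (_ : IsScaling Γ c s),
          {z : ℍ | 3 < (s⁻¹ • z).im} := by
      ext z
      simp [corePred]
    rw [this]
    refine IsOpen.union (isOpen_biUnion fun γ _ => ?_)
      (isOpen_iUnion fun c => isOpen_iUnion fun s => isOpen_iUnion fun _ => ?_)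
    · exact isOpen_lt ((continuous_const_smul γ).dist continuous_const) continuous_const
    · exact isOpen_lt continuous_const (continuous_im.comp (continuous_const_smul _))
  · obtain ⟨s, hs⟩ := exists_isScaling h hc
    set B := s⁻¹ * g with hB
    have hBd : B.det = 1 := det_mul_eq_one (det_inv_eq_one hs.det) hg
    have hB10 : B 1 0 = 0 := by
      rw [← OnePoint.smul_infty_eq_self_iff, mul_smul, hgc, inv_smul_eq_iff, hs.smul_infty]
    have hB11 : B 1 1 ≠ 0 := by
      intro h0
      have := entries_det hBd
      rw [hB10, h0] at this
      simp at this
    -- The topology allows any `g` with `g ∞ = c`; it differs from the scaling matrix by an upper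
    -- triangular matrix, which divides heights by `B 1 1 ^ 2`.
    refine ⟨3 * B 1 1 ^ 2, fun z hz => Or.inr ⟨c, s, hs, ?_⟩⟩
    have : s⁻¹ • z = B • g⁻¹ • z := by rw [hB, mul_smul, smul_inv_smul]
    rw [this, im_smul_eq hBd, hB10]
    simp only [zero_mul, zero_add, ne_eq, OfNat.ofNat_ne_zero, not_false_eq_true, zero_pow,
      add_zero]
    rwa [lt_div_iff₀ (by positivity)]

/-- The sets given by `corePred` are open, invariant and increasing in the radius, and they exhaust
`ℍ*`; compactness of the quotient selects one radius. -/
lemma IsFuchsianFirstKind.hasCore {Γ : PSLSubgroup} (h : IsFuchsianFirstKind Γ) : HasCore Γ := by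
  have hl := isLocFinite_of_discrete h.discrete
  have := h.compact
  let V : ℕ → Set (Quot (extRel Γ)) := fun n => {q | Quot.lift (corePred Γ n) corePred_rel q}
  have hV : ∀ n, IsOpen (V n) := fun n =>
    isQuotientMap_quot_mk.isOpen_preimage.mp (isOpen_corePred hl n)
  have hmono : ∀ m n : ℕ, m ≤ n → V m ⊆ V n := by
    intro m n hmn q
    induction q using Quot.ind with
    | mk x =>
      match x with
      | .cusp _ _ => exact id
      | .point z =>
        rintro (⟨γ, hγ, hz⟩ | hz)
        · exact Or.inl ⟨γ, hγ, hz.trans_le (by exact_mod_cast hmn)⟩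
        · exact Or.inr hz
  obtain ⟨n, hn⟩ := isCompact_univ.elim_directed_cover V hV (by
    intro q _
    induction q using Quot.ind with
    | mk x =>
      match x with
      | .cusp _ _ => exact Set.mem_iUnion.mpr ⟨0, trivial⟩
      | .point z =>
        obtain ⟨n, hn⟩ := exists_nat_gt (dist z I)
        exact Set.mem_iUnion.mpr ⟨n, Or.inl ⟨1, one_mem _, by rwa [one_smul]⟩⟩)
    (fun a b => ⟨max a b, hmono _ _ (le_max_left _ _), hmono _ _ (le_max_right _ _)⟩)
  refine ⟨n, fun z => ?_⟩
  have hz : corePred Γ n (.point z) := hn (Set.mem_univ (Quot.mk _ (ExtHalfPlane.point z)))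
  rcases hz with ⟨γ, hγ, hz⟩ | hz
  · exact Or.inl ⟨γ, hγ, hz.le⟩
  · exact Or.inr hz

/-! ### The modular group -/

lemma isLocFinite_SL2Z : IsLocFinite (ofSL2Z ⊤) := by
  refine isLocFinite_of_discrete ?_
  change DiscreteTopology (Subgroup.adjoinNegOne (Subgroup.map (SpecialLinearGroup.mapGL ℝ)
    (⊤ : Subgroup SL(2, ℤ))))
  infer_instance

lemma mem_ofSL2Z_iff {H : Subgroup SL(2, ℤ)} {γ : GL (Fin 2) ℝ} : γ ∈ (ofSL2Z H).grp ↔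
    ∃ g ∈ H, γ = SpecialLinearGroup.mapGL ℝ g ∨ γ = -SpecialLinearGroup.mapGL ℝ g := by
  change γ ∈ Subgroup.adjoinNegOne _ ↔ _
  rw [Subgroup.mem_adjoinNegOne_iff]
  constructor
  · rintro (⟨g, hg, rfl⟩ | ⟨g, hg, h⟩)
    · exact ⟨g, hg, Or.inl rfl⟩
    · exact ⟨g, hg, Or.inr (by rw [h, neg_neg])⟩
  · rintro ⟨g, hg, rfl | rfl⟩
    · exact Or.inl ⟨g, hg, rfl⟩
    · exact Or.inr ⟨g, hg, by rw [neg_neg]⟩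

lemma isScaling_SL2Z : IsScaling (ofSL2Z ⊤) OnePoint.infty 1 where
  det := map_one _
  smul_infty := one_smul _ _
  stabilizer γ := by
    have e : (1 : GL (Fin 2) ℝ)⁻¹ * γ * 1 = γ := by group
    rw [e, OnePoint.smul_infty_eq_self_iff]
    constructor
    · rintro ⟨hγ, h10⟩
      have hd := (ofSL2Z ⊤).det_eq_one γ hγ
      have hint : ∀ i j, ∃ n : ℤ, γ i j = n := by
        obtain ⟨g, -, rfl | rfl⟩ := mem_ofSL2Z_iff.mp hγ <;> intro i j
        · exact ⟨g i j, by simp⟩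
        · exact ⟨-g i j, by simp⟩
      obtain ⟨a, ha⟩ := hint 0 0
      obtain ⟨b, hb⟩ := hint 0 1
      obtain ⟨d, hd'⟩ := hint 1 1
      have had : a * d = 1 := by
        have := entries_det hd
        rw [h10, ha, hd', mul_zero, sub_zero] at this
        exact_mod_cast this
      have ha2 : γ 0 0 ^ 2 = 1 := by
        rcases Int.eq_one_or_neg_one_of_mul_eq_one had with h | h <;> rw [ha, h] <;> simp
      refine ⟨a * b, ?_⟩
      have := eq_pm_upperRightHom hd h10 ha2
      rw [ha, hb] at this
      push_cast
      exact this
    · rintro ⟨n, hn⟩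
      have hT : SpecialLinearGroup.mapGL ℝ (ModularGroup.T ^ n) = upperRightHom (n : ℝ) := by
        simp only [Units.ext_iff, SpecialLinearGroup.mapGL_coe_matrix,
          SpecialLinearGroup.map_apply_coe]
        ext i j
        fin_cases i <;> fin_cases j <;> simp [ModularGroup.coe_T_zpow]
      rcases hn with rfl | rfl
      · exact ⟨mem_ofSL2Z_iff.mpr ⟨_, trivial, Or.inl hT.symm⟩, by simp⟩
      · exact ⟨mem_ofSL2Z_iff.mpr ⟨_, trivial, Or.inr (by rw [hT])⟩, by simp⟩

lemma hasCore_SL2Z : HasCore (ofSL2Z ⊤) := by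
  -- For `|Re w| ≤ 1/2` and `1/2 ≤ Im w ≤ 3` one has `cosh d(w, i) ≤ 1/4 + 9 + 1 < 11`, and `d ≤
  -- sinh d < cosh d`.
  refine ⟨11, fun z => ?_⟩
  obtain ⟨g, hg1, hg2⟩ := ModularGroup.exists_smul_mem_fd z
  have hγ : SpecialLinearGroup.mapGL ℝ g ∈ (ofSL2Z ⊤).grp :=
    mem_ofSL2Z_iff.mpr ⟨g, trivial, Or.inl rfl⟩
  set w := g • z with hw
  have hw' : SpecialLinearGroup.mapGL ℝ g • z = w := rfl
  rcases le_or_gt w.im 3 with h | h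
  · left
    refine ⟨_, hγ, ?_⟩
    rw [hw']
    have hre : w.re ^ 2 ≤ 1 / 4 := by
      have := abs_le.mp hg2
      nlinarith
    rw [Complex.normSq_apply, coe_re, coe_im] at hg1
    have him : 1 / 2 ≤ w.im := by nlinarith [w.im_pos]
    have hc : Real.cosh (dist w I) ≤ 11 := by
      rw [cosh_dist', I_re, I_im, div_le_iff₀ (by linarith)]
      nlinarith
    have h3 : dist w I ≤ Real.sinh (dist w I) := Real.self_le_sinh_iff.mpr dist_nonneg
    linarith [Real.sinh_lt_cosh (dist w I)]
  · right
    refine ⟨_, _, isScaling_SL2Z.smul (inv_mem hγ), ?_⟩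
    rw [mul_one, inv_inv, hw']
    exact h

/-! ### Towers -/

lemma exists_conj_mem_base {Γ : ℕ → PSLSubgroup} (h : ∀ N, IsFiniteCover (Γ (N + 1)) (Γ N))
    (N : ℕ) : ∃ g : GL (Fin 2) ℝ, g.det = 1 ∧ ∀ γ ∈ (Γ N).grp, g * γ * g⁻¹ ∈ (Γ 0).grp := by
  induction N with
  | zero => exact ⟨1, map_one _, fun γ hγ => by simpa using hγ⟩
  | succ N ih =>
    obtain ⟨g, hg, hgm⟩ := ih
    obtain ⟨k, hk, hkm, -⟩ := h N
    refine ⟨g * k, det_mul_eq_one hg hk, fun γ hγ => ?_⟩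
    have := hgm _ (hkm ⟨γ, hγ, rfl⟩)
    convert this using 1
    simp [mul_assoc]

/-- The groups of all admissible families with a given base have common geometric bounds. -/
lemma exists_geomBound_of_isAdmissible (Γq : PSLSubgroup) :
    ∃ ε > 0, ∃ m, ∃ v ≠ 0, ∃ ε' > 0, ∃ m', ∃ v' ≠ 0,
      ∀ (𝒩 : Set ℕ) (Γ : ℕ → PSLSubgroup) (q : ℕ), IsAdmissible 𝒩 Γ q → Γ q = Γq → ∀ N ∈ 𝒩,
        GeomBound (Γ N) ε m v ∨ GeomBound (Γ N) ε' m' v' := by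
  obtain ⟨ε', hε', m', v', hv', hG'⟩ := hasCore_SL2Z.exists_geomBound isLocFinite_SL2Z
  have hmod : ∀ H : Subgroup SL(2, ℤ), GeomBound (ofSL2Z H) ε' m' v' := by
    refine fun H => hG'.of_conj (g := 1) (map_one _) fun γ hγ => ?_
    obtain ⟨g, -, hg⟩ := mem_ofSL2Z_iff.mp hγ
    rw [one_mul, inv_one, mul_one]
    exact mem_ofSL2Z_iff.mpr ⟨g, trivial, hg⟩
  by_cases hq : IsFuchsianFirstKind Γq
  · obtain ⟨ε, hε, m, v, hv, hG⟩ :=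
      hq.hasCore.exists_geomBound (isLocFinite_of_discrete hq.discrete)
    refine ⟨ε, hε, m, v, hv, ε', hε', m', v', hv', fun 𝒩 Γ q had hΓ N hN => ?_⟩
    cases had with
    | tower Γ surface cover =>
      obtain ⟨g, hg, hgm⟩ := exists_conj_mem_base cover N
      rw [hΓ] at hgm
      exact Or.inl (hG.of_conj hg hgm)
    | modular 𝒩 Γ q level family pos curve one_le_genus base =>
      exact Or.inr (curve N hN ▸ hmod (level N))
  -- No tower has this base, so the data of the modular group serve in both places.
  · refine ⟨ε', hε', m', v', hv', ε', hε', m', v', hv', fun 𝒩 Γ q had hΓ N hN => ?_⟩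
    cases had with
    | tower Γ surface cover => exact absurd (hΓ ▸ (surface 0).firstKind) hq
    | modular 𝒩 Γ q level family pos curve one_le_genus base =>
      exact Or.inr (curve N hN ▸ hmod (level N))

/-! ### A uniform admissible radius -/

lemma Marking.eq_of_smul_cusp {Γ : PSLSubgroup} (M : Marking Γ) {p q : OnePoint ℝ}
    (hp : p ∈ M.cusps) (hq : q ∈ M.cusps) {γ : GL (Fin 2) ℝ} (hγ : γ ∈ Γ.grp) (h : γ • p = q) :
    p = q :=
  (M.cusps_repr p (M.isCusp p hp)).unique ⟨hp, 1, one_mem _, one_smul _ _⟩ ⟨hq, γ, hγ, h⟩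

lemma Marking.eq_of_smul_ell {Γ : PSLSubgroup} (M : Marking Γ) {e f : ℍ}
    (he : e ∈ M.ells) (hf : f ∈ M.ells) {γ : GL (Fin 2) ℝ} (hγ : γ ∈ Γ.grp) (h : γ • e = f) :
    e = f :=
  (M.ells_repr e (M.isElliptic e he)).unique ⟨he, 1, one_mem _, one_smul _ _⟩ ⟨hf, γ, hγ, h⟩

/-- A radius that is admissible for all groups with the geometric bound `ε`. -/
def commonRadius (ε : ℝ) : ℝ := min (ε / 2) (Real.exp (-(2 * Real.pi * 3)))

lemma commonRadius_pos {ε : ℝ} (hε : 0 < ε) : 0 < commonRadius ε :=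
  lt_min (by positivity) (Real.exp_pos _)

lemma two_mul_commonRadius_le (ε : ℝ) : 2 * commonRadius ε ≤ ε := by
  have := min_le_left (ε / 2) (Real.exp (-(2 * Real.pi * 3)))
  rw [commonRadius]; linarith

lemma commonRadius_lt_one (ε : ℝ) : commonRadius ε < 1 := by
  refine (min_le_right _ _).trans_lt ?_
  rw [Real.exp_lt_one_iff]
  linarith [Real.pi_pos]

lemma Marking.three_lt_im {Γ : PSLSubgroup} (M : Marking Γ) {ε : ℝ} {p : OnePoint ℝ} {z : ℍ}
    (hz : z ∈ M.cuspDisk (commonRadius ε) p) : 3 < ((M.scal p)⁻¹ • z).im := by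
  have h1 : Real.exp (-(2 * Real.pi * ((M.scal p)⁻¹ • z).im)) < _ :=
    lt_of_lt_of_le hz (min_le_right _ _)
  rw [Real.exp_lt_exp, neg_lt_neg_iff] at h1
  exact lt_of_mul_lt_mul_left h1 (by positivity)

/-- A bound for the height of the points outside the cusp disks of radius `commonRadius ε`. -/
def commonHeight (ε : ℝ) : ℝ := -Real.log (commonRadius ε) / (2 * Real.pi)

lemma Marking.im_le_commonHeight {Γ : PSLSubgroup} (M : Marking Γ) {ε : ℝ} (hε : 0 < ε)
    {p : OnePoint ℝ} {z : ℍ} (hz : z ∉ M.cuspDisk (commonRadius ε) p) :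
    ((M.scal p)⁻¹ • z).im ≤ commonHeight ε := by
  have h1 : commonRadius ε ≤ Real.exp (-(2 * Real.pi * ((M.scal p)⁻¹ • z).im)) := not_lt.mp hz
  have h2 := Real.log_le_log (commonRadius_pos hε) h1
  rw [Real.log_exp] at h2
  rw [commonHeight, le_div_iff₀ (by positivity)]
  linarith

/-- The half in `commonRadius` makes the centres of two overlapping elliptic disks closer than `ε`,
hence equal. The exponential puts the cusp disks inside horoballs of height `3`, where the
disjointness of horoballs and the absence of nearby elliptic points apply. -/
lemma GeomBound.isAdmissibleRadius {Γ : PSLSubgroup} {ε : ℝ} {m : ℕ} {v : ℝ≥0∞}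
    (h : GeomBound Γ ε m v) (hε : 0 < ε) (M : Marking Γ) :
    M.IsAdmissibleRadius (commonRadius ε) where
  pos := commonRadius_pos hε
  lt_one := commonRadius_lt_one ε
  lt_geodesic := by
    have h1 : ENNReal.ofReal ε ≤ shortestGeodesic Γ := by
      refine le_iInf₂ fun γ hγ => le_iInf fun z => ?_
      rw [edist_dist]
      exact ENNReal.ofReal_le_ofReal (h.le_dist_smul γ hγ.1 hγ.2 z)
    refine lt_of_lt_of_le ?_ h1
    rw [ENNReal.ofReal_lt_ofReal_iff hε]
    linarith [two_mul_commonRadius_le ε, commonRadius_pos hε]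
  cusp_max p hp z hz γ hγ := by
    by_contra! hlt
    have h3 := M.three_lt_im hz
    have hs := M.isScaling hp
    have hc := hs.smul_eq_self h.locFinite hγ (by linarith) (lt_trans (by linarith) hlt)
    exact hlt.ne (hs.im_smul_of_fixes hγ hc z).symm
  cusp_cusp p hp q hq hpq z hz γ hγ hγz := by
    have h3 := M.three_lt_im hz
    have h3' := M.three_lt_im hγz
    have := (M.isScaling hp).eq_of_one_lt_im h.locFinite ((M.isScaling hq).smul (inv_mem hγ))
      (z := z) (by linarith) (by rw [_root_.mul_inv_rev, inv_inv, mul_smul]; linarith)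
    rw [eq_inv_smul_iff] at this
    exact hpq (M.eq_of_smul_cusp hp hq hγ this)
  ell_ell e he f hf hef z hz γ hγ hγz := by
    have hd : dist (γ • e) f < ε := by
      have h1 := Metric.mem_ball'.mp hz
      have h2 := Metric.mem_ball.mp hγz
      rw [← dist_smul_smul (Γ.det_eq_one γ hγ)] at h1
      linarith [dist_triangle (γ • e) (γ • z) f, two_mul_commonRadius_le ε]
    exact hef (M.eq_of_smul_ell he hf hγ (h.eq_of_dist_lt _ _
      ((M.isElliptic e he).smul hγ) (M.isElliptic f hf) hd))
  ell_self e he z hz γ hγ := by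
    by_contra! hlt
    have hd : dist e (γ • e) < ε := by
      have := dist_triangle e z (γ • e)
      rw [dist_comm e z, hz] at this
      linarith [two_mul_commonRadius_le ε]
    rw [← h.eq_of_dist_lt _ _ (M.isElliptic e he) ((M.isElliptic e he).smul hγ) hd] at hlt
    exact hlt.ne hz
  cusp_ell p hp e he z hz γ hγ hγz := by
    have h3 := M.three_lt_im hz
    have hd : dist z (γ⁻¹ • e) < 1 := by
      rw [← dist_smul_left (Γ.det_eq_one γ hγ)]
      exact (Metric.mem_ball.mp hγz).trans (commonRadius_lt_one ε)
    have hs := M.isScaling hp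
    exact hs.not_isEllipticPoint h.locFinite
      (one_lt_im_of_dist_lt (det_inv_eq_one hs.det) h3 hd) ((M.isElliptic e he).smul (inv_mem hγ))

/-! ### Sums over cosets -/

/-- The identity coset contributes exactly `t`, and a representative lying in `H` forces the
identity coset. An inequality is enough, and with truncated subtraction it holds even if `t` is
infinite. -/
lemma tsum_coset_sub_le {G : Type*} [Group G] (H : Subgroup G)
    (f : Quotient (QuotientGroup.rightRel H) → ℝ≥0∞) {t : ℝ≥0∞}
    (ht : f (Quotient.mk _ 1) = t) :
    ∑' η, f η - t ≤ ∑' η, {η | η.out ∉ H}.indicator f η := by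
  classical
  rw [ENNReal.tsum_eq_add_tsum_ite (Quotient.mk _ 1), ht, tsub_le_iff_left]
  refine add_le_add le_rfl (ENNReal.tsum_le_tsum fun η => ?_)
  split_ifs with h
  · exact zero_le
  · rw [Set.indicator_of_mem]
    intro hη
    refine h ?_
    rw [← Quotient.out_eq η]
    refine Quotient.sound ?_
    rw [← Quotient.eq_iff_equiv, Quotient.eq, QuotientGroup.rightRel_apply]
    simpa using hη

lemma out_mk_one_mem {G : Type*} [Group G] (H : Subgroup G) :
    (Quotient.mk (QuotientGroup.rightRel H) 1).out ∈ H := by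
  have h := Quotient.mk_out (s := QuotientGroup.rightRel H) 1
  rw [QuotientGroup.rightRel_apply, one_mul] at h
  exact inv_mem_iff.mp h

lemma eq_of_out_mul_inv_mem {G : Type*} [Group G] (H : Subgroup G)
    {η η' : Quotient (QuotientGroup.rightRel H)} (h : η'.out * η.out⁻¹ ∈ H) : η = η' := by
  rw [← Quotient.out_eq η, ← Quotient.out_eq η']
  refine Quotient.sound ?_
  rw [← Quotient.eq_iff_equiv, Quotient.eq, QuotientGroup.rightRel_apply]
  exact h

lemma tsum_tsum_indicator {ι : Type*} {α : ι → Type*} (A : ∀ i, Set (α i))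
    (f : ∀ i, α i → ℝ≥0∞) :
    ∑' i, ∑' a, (A i).indicator (f i) a =
      ∑' x : {x : Σ i, α i // x.2 ∈ A x.1}, f x.1.1 x.1.2 := by
  rw [← ENNReal.tsum_sigma]
  exact (tsum_subtype {x : Σ i, α i | x.2 ∈ A x.1} fun x : Σ i, α i => f x.1 x.2).symm

/-! ### The parabolic constant -/

/-- The pairs of `p` and a nontrivial coset `η` correspond to distinct cusps `η⁻¹ p`, with scaling
matrices `η⁻¹ σ_p`. The packing estimate then treats the sum over all cusps of `X` at once. -/
lemma GeomBound.constPar_le {Γ : PSLSubgroup} {ε : ℝ} {m : ℕ} {v : ℝ≥0∞}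
    (h : GeomBound Γ ε m v) (hε : 0 < ε) (M : Marking Γ) (F : Set ℍ)
    (hF : M.IsFundamentalDomain F) : M.constPar F ≤ horoConst (commonHeight ε) := by
  refine iSup₂_le fun z hz => ?_
  have hrad := h.isAdmissibleRadius hε M
  have h1 : ∀ p : M.cusps, M.eisPar p z 2 - ENNReal.ofReal (((M.scal p)⁻¹ • z).im) ^ (2 : ℝ) ≤
      ∑' η, {η : Quotient (QuotientGroup.rightRel (MulAction.stabilizer Γ.grp p.1)) |
        η.out ∉ MulAction.stabilizer Γ.grp p.1}.indicator
        (fun η => ENNReal.ofReal (((M.scal p)⁻¹ • η.out • z).im) ^ (2 : ℝ)) η := by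
    intro p
    refine tsum_coset_sub_le _ _ ?_
    have hm := out_mk_one_mem (MulAction.stabilizer Γ.grp p.1)
    set g := (Quotient.mk (QuotientGroup.rightRel (MulAction.stabilizer Γ.grp p.1)) 1).out
    have := (M.isScaling p.2).im_smul_of_fixes g.2 hm z
    rw [← this]
    rfl
  refine (ENNReal.tsum_le_tsum h1).trans ?_
  rw [tsum_tsum_indicator]
  let s : {x : Σ p : M.cusps, Quotient (QuotientGroup.rightRel (MulAction.stabilizer Γ.grp p.1)) //
      x.2 ∈ {η : Quotient (QuotientGroup.rightRel (MulAction.stabilizer Γ.grp x.1.1)) |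
        η.out ∉ MulAction.stabilizer Γ.grp x.1.1}} → GL (Fin 2) ℝ :=
    fun x => (x.1.2.out : GL (Fin 2) ℝ)⁻¹ * M.scal x.1.1
  have hs : ∀ x (w : ℍ), (s x)⁻¹ • w = (M.scal x.1.1)⁻¹ • x.1.2.out • w := by
    intro x w
    simp only [s, _root_.mul_inv_rev, inv_inv, mul_smul]
    rfl
  have hsc : ∀ x, IsScaling Γ ((x.1.2.out : GL (Fin 2) ℝ)⁻¹ • x.1.1.1) (s x) :=
    fun x => (M.isScaling x.1.1.2).smul (inv_mem x.1.2.out.2)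
  have key := tsum_height_sq_le s (fun x => (hsc x).det) ?_ z (H := commonHeight ε) ?_
  · refine le_trans (le_of_eq ?_) key
    congr 1
    ext x
    rw [hs, ENNReal.rpow_two, ENNReal.ofReal_pow (im_pos _).le]
  · rintro ⟨⟨p, η⟩, hη⟩ ⟨⟨q, η'⟩, hη'⟩ w hw hw'
    have hc := (hsc _).eq_of_one_lt_im h.locFinite (hsc _) hw hw'
    simp only at hc
    have hpq : p.1 = q.1 := by
      refine M.eq_of_smul_cusp p.2 q.2 (mul_mem η'.out.2 (inv_mem η.out.2)) ?_
      rw [mul_smul, hc, smul_inv_smul]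
    obtain rfl : p = q := Subtype.ext hpq
    have : η = η' := by
      refine eq_of_out_mul_inv_mem _ ?_
      rw [MulAction.mem_stabilizer_iff, mul_smul]
      change (η'.out : GL (Fin 2) ℝ) • (η.out : GL (Fin 2) ℝ)⁻¹ • p.1 = p.1
      rw [hc, smul_inv_smul]
    subst this
    rfl
  -- Were `z` in the disk at `η⁻¹ p`, then as a point of `F` it would also lie in the disk at `p`.
  -- Then `η` would fix `p`, contrary to the coset being nontrivial.
  · rintro ⟨⟨p, η⟩, hη⟩
    rw [hs]
    refine M.im_le_commonHeight hε fun hmem => hη ?_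
    have hz' := hF.cusp_mem _ hrad p.1 p.2 z hz η.out.1 η.out.2 hmem
    have h3 := M.three_lt_im hmem
    have h3' := M.three_lt_im hz'
    exact (M.isScaling p.2).smul_eq_self h.locFinite η.out.2 (z := z) (by linarith)
      (lt_trans (by norm_num) h3)

/-! ### The elliptic constants -/

lemma GeomBound.order_le {Γ : PSLSubgroup} {ε : ℝ} {m : ℕ} {v : ℝ≥0∞}
    (h : GeomBound Γ ε m v) {e : ℍ} (he : IsEllipticPoint Γ e) : order Γ e ≤ m := by
  have h1 := h.encard_le e he
  set S := {γ : GL (Fin 2) ℝ | γ ∈ Γ.grp ∧ γ • e = e}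
  have hfin : S.Finite := Set.finite_of_encard_le_coe h1
  have h2 : S.ncard ≤ m := by
    rw [← hfin.cast_ncard_eq] at h1
    exact_mod_cast h1
  have := hfin.to_subtype
  have h3 : Nat.card (MulAction.stabilizer Γ.grp e) ≤ Nat.card S := by
    refine Nat.card_le_card_of_injective
      (fun γ => (⟨γ.1.1, γ.1.2, γ.2⟩ : S)) fun a b hab => ?_
    exact Subtype.ext (Subtype.ext (congrArg (fun x : S => x.1) hab))
  rw [Nat.card_coe_set_eq] at h3
  exact (Nat.div_le_self _ _).trans (h3.trans h2)

/-- Jordan's inequality `sin x ≥ 2x/π` on `[0, π/2]`, after reflection at `π/2` if necessary, gives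
`sin (nπ/k) ≥ 1/k`. -/
lemma inv_sin_sq_le {n k : ℕ} (hn : 0 < n) (hnk : n < k) :
    1 / Real.sin (n * Real.pi / k) ^ 2 ≤ (k : ℝ) ^ 2 := by
  have hk : (0 : ℝ) < k := by exact_mod_cast hn.trans hnk
  have hn' : (1 : ℝ) ≤ n := by exact_mod_cast hn
  have hnk' : (n : ℝ) + 1 ≤ k := by exact_mod_cast hnk
  have hpi := Real.pi_pos
  have hsin : 1 / (k : ℝ) ≤ Real.sin (n * Real.pi / k) := by
    rcases le_total (n * Real.pi / k) (Real.pi / 2) with h | h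
    · refine le_trans ?_ (Real.mul_le_sin (by positivity) h)
      rw [div_mul_div_comm, div_le_div_iff₀ hk (by positivity)]
      nlinarith [mul_pos hpi hk]
    · rw [← Real.sin_pi_sub]
      have e : Real.pi - n * Real.pi / k = (k - n) * Real.pi / k := by field_simp
      have h0 : 0 ≤ Real.pi - n * Real.pi / k := by
        rw [e]; exact div_nonneg (mul_nonneg (by linarith) hpi.le) hk.le
      refine le_trans ?_ (Real.mul_le_sin h0 (by linarith))
      rw [e, div_mul_div_comm, div_le_div_iff₀ hk (by positivity)]
      nlinarith [mul_pos hpi hk]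
  have hpos : 0 < Real.sin (n * Real.pi / k) := lt_of_lt_of_le (by positivity) hsin
  rw [div_le_iff₀ (by positivity), ← mul_pow]
  rw [div_le_iff₀ hk, mul_comm] at hsin
  exact one_le_pow₀ hsin

lemma GeomBound.smallConstEll_le {Γ : PSLSubgroup} {ε : ℝ} {m : ℕ} {v : ℝ≥0∞}
    (h : GeomBound Γ ε m v) (M : Marking Γ) : M.smallConstEll ≤ (m : ℝ≥0∞) ^ 2 := by
  refine iSup₂_le fun e he => iSup₂_le fun n hn => ?_
  have ho := h.order_le (M.isElliptic e he)
  have h1 : ENNReal.ofReal ((m : ℝ) ^ 2) = (m : ℝ≥0∞) ^ 2 := by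
    rw [ENNReal.ofReal_pow (by positivity), ENNReal.ofReal_natCast]
  rw [← h1]
  refine ENNReal.ofReal_le_ofReal ((inv_sin_sq_le hn.1 hn.2).trans ?_)
  gcongr

lemma GeomBound.coe_order_sub_one_le {Γ : PSLSubgroup} {ε : ℝ} {m : ℕ} {v : ℝ≥0∞}
    (h : GeomBound Γ ε m v) (M : Marking Γ) (e : M.ells) :
    ((order Γ e - 1 : ℕ) : ℝ≥0∞) ≤ m := by
  have := h.order_le (M.isElliptic e e.2)
  exact_mod_cast (Nat.sub_le _ _).trans this

lemma GeomBound.sum_order_le {Γ : PSLSubgroup} {ε : ℝ} {m : ℕ} {v : ℝ≥0∞}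
    (h : GeomBound Γ ε m v) (M : Marking Γ) {g : ℕ} (hg : 1 ≤ g) :
    5 * M.smallConstEll / (g * hypVol Γ) * ∑' e : M.ells, ((order Γ e - 1 : ℕ) : ℝ≥0∞) ≤
      (5 * (m : ℝ≥0∞) ^ 2 * m * v⁻¹) * ((M.ells.encard : ℝ≥0∞) / g) := by
  have h1 : ∑' e : M.ells, ((order Γ e - 1 : ℕ) : ℝ≥0∞) ≤ M.ells.encard * m := by
    refine (ENNReal.tsum_le_tsum fun e => h.coe_order_sub_one_le M e).trans ?_
    rw [ENNReal.tsum_const, Set.encard]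
  have hg0 : (g : ℝ≥0∞) ≠ 0 := by
    have : g ≠ 0 := by omega
    exact_mod_cast this
  rw [ENNReal.div_eq_inv_mul, ENNReal.mul_inv (Or.inl hg0) (Or.inl (ENNReal.natCast_ne_top g))]
  calc (g : ℝ≥0∞)⁻¹ * (hypVol Γ)⁻¹ * (5 * M.smallConstEll) *
        ∑' e : M.ells, ((order Γ e - 1 : ℕ) : ℝ≥0∞)
      ≤ (g : ℝ≥0∞)⁻¹ * v⁻¹ * (5 * (m : ℝ≥0∞) ^ 2) * (M.ells.encard * m) := by
        gcongr
        · exact h.le_hypVol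
        · exact h.smallConstEll_le M
    _ = _ := by rw [div_eq_mul_inv]; ring

lemma GeomBound.constEll_le {Γ : PSLSubgroup} {ε : ℝ} {m : ℕ} {v : ℝ≥0∞}
    (h : GeomBound Γ ε m v) (hε : 0 < ε) (M : Marking Γ) (F : Set ℍ)
    (hF : M.IsFundamentalDomain F) :
    M.constEll F ≤ (m : ℝ≥0∞) ^ 2 * (m * ballConst (commonRadius ε)) := by
  refine iSup₂_le fun z hz => mul_le_mul' (h.smallConstEll_le M) ?_
  have hzF : z ∈ F := hz.1
  have hrad := h.isAdmissibleRadius hε M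
  have hpos := commonRadius_pos hε
  have h1 : ∀ e : M.ells, eisEll Γ e z 2 - ENNReal.ofReal (Real.sinh (dist z e)) ^ (-2 : ℝ) ≤
      ∑' η, {η : Quotient (QuotientGroup.rightRel (MulAction.stabilizer Γ.grp e.1)) |
        η.out ∉ MulAction.stabilizer Γ.grp e.1}.indicator
        (fun η => ENNReal.ofReal (Real.sinh (dist (η.out • z) e)) ^ (-2 : ℝ)) η := by
    intro e
    refine tsum_coset_sub_le _ _ ?_
    have hm := out_mk_one_mem (MulAction.stabilizer Γ.grp e.1)
    set g := (Quotient.mk (QuotientGroup.rightRel (MulAction.stabilizer Γ.grp e.1)) 1).out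
    have hm' : (g : GL (Fin 2) ℝ) • e.1 = e.1 := hm
    have : dist (g • z) e.1 = dist z e := by
      change dist ((g : GL (Fin 2) ℝ) • z) e.1 = _
      nth_rewrite 1 [← hm']
      rw [dist_smul_smul (Γ.det_eq_one _ g.2)]
    rw [this]
  refine (ENNReal.tsum_le_tsum fun e => mul_le_mul' (h.coe_order_sub_one_le M e) (h1 e)).trans ?_
  rw [ENNReal.tsum_mul_left]
  refine mul_le_mul' le_rfl ?_
  rw [tsum_tsum_indicator]
  let p : {x : Σ e : M.ells, Quotient (QuotientGroup.rightRel (MulAction.stabilizer Γ.grp e.1)) //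
      x.2 ∈ {η : Quotient (QuotientGroup.rightRel (MulAction.stabilizer Γ.grp x.1.1)) |
        η.out ∉ MulAction.stabilizer Γ.grp x.1.1}} → ℍ :=
    fun x => (x.1.2.out : GL (Fin 2) ℝ)⁻¹ • x.1.1.1
  have hp : ∀ x, dist (x.1.2.out • z) x.1.1.1 = dist z (p x) :=
    fun x => dist_smul_left (Γ.det_eq_one _ x.1.2.out.2) z x.1.1.1
  have hpe : ∀ x, IsEllipticPoint Γ (p x) :=
    fun x => (M.isElliptic _ x.1.1.2).smul (inv_mem x.1.2.out.2)
  -- A point of `F` close to `η⁻¹ e` is also close to `e`; these two elliptic points are then closer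
  -- than `ε`, hence equal, and `η` would stabilize `e`.
  have hfar : ∀ x, commonRadius ε ≤ dist z (p x) := by
    rintro ⟨⟨e, η⟩, hη⟩
    by_contra! hlt
    rw [← hp] at hlt
    have hz' := hF.ell_mem _ hrad e.1 e.2 z hzF η.out.1 η.out.2 hlt
    refine hη ?_
    rw [hp] at hlt
    have hd : dist e.1 (p ⟨⟨e, η⟩, hη⟩) < ε := by
      have := Metric.mem_ball'.mp hz'
      linarith [dist_triangle e.1 z (p ⟨⟨e, η⟩, hη⟩), two_mul_commonRadius_le ε]
    have := h.eq_of_dist_lt _ _ (M.isElliptic _ e.2) (hpe _) hd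
    simp only [p] at this
    rw [eq_inv_smul_iff] at this
    exact this
  have key := tsum_inv_sinh_sq_le p z hpos (commonRadius_lt_one ε).le ?_ hfar
  · refine le_trans (le_of_eq ?_) key
    congr 1
    ext x
    have hs : 0 < Real.sinh (dist z (p x)) := Real.sinh_pos_iff.mpr (hpos.trans_le (hfar x))
    rw [hp, ENNReal.ofReal_rpow_of_pos hs, Real.rpow_neg hs.le]
    norm_cast
  · rintro ⟨⟨e, η⟩, hη⟩ ⟨⟨f, η'⟩, hη'⟩ hd
    have hc := h.eq_of_dist_lt _ _ (hpe _) (hpe _) (hd.trans_le (two_mul_commonRadius_le ε))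
    simp only [p] at hc
    have hef : e.1 = f.1 := by
      refine M.eq_of_smul_ell e.2 f.2 (mul_mem η'.out.2 (inv_mem η.out.2)) ?_
      rw [mul_smul, hc, smul_inv_smul]
    obtain rfl : e = f := Subtype.ext hef
    have : η = η' := by
      refine eq_of_out_mul_inv_mem _ ?_
      rw [MulAction.mem_stabilizer_iff, mul_smul]
      change (η'.out : GL (Fin 2) ℝ) • (η.out : GL (Fin 2) ℝ)⁻¹ • e.1 = e.1
      rw [hc, smul_inv_smul]
    subst this
    rfl

/-! ### Twice differentiable series -/

section Series

variable {ι E : Type*} [NormedAddCommGroup E] [NormedSpace ℝ E] {U : Set E}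
  {f : ι → E → ℝ} {f' : ι → E → E →L[ℝ] ℝ} {f'' : ι → E → E →L[ℝ] E →L[ℝ] ℝ} {b b' : ι → ℝ}

lemma fderiv_tsum_eqOn (hU : IsOpen U) (hUc : IsPreconnected U)
    (hf : ∀ i, ∀ x ∈ U, HasFDerivAt (f i) (f' i x) x) (hb : Summable b)
    (hfb : ∀ i, ∀ x ∈ U, ‖f' i x‖ ≤ b i) {x₀ : E} (hx₀ : x₀ ∈ U)
    (hs : Summable fun i => f i x₀) :
    ∀ x ∈ U, HasFDerivAt (fun y => ∑' i, f i y) (∑' i, f' i x) x := fun _ hx =>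
  hasFDerivAt_tsum_of_isPreconnected hb hU hUc hf hfb hx₀ hs hx

lemma hasFDerivAt_fderiv_tsum (hU : IsOpen U) (hUc : IsPreconnected U)
    (hf : ∀ i, ∀ x ∈ U, HasFDerivAt (f i) (f' i x) x) (hb : Summable b)
    (hfb : ∀ i, ∀ x ∈ U, ‖f' i x‖ ≤ b i)
    (hf' : ∀ i, ∀ x ∈ U, HasFDerivAt (f' i) (f'' i x) x) (hb' : Summable b')
    (hfb' : ∀ i, ∀ x ∈ U, ‖f'' i x‖ ≤ b' i) {x₀ : E} (hx₀ : x₀ ∈ U)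
    (hs : Summable fun i => f i x₀) :
    ∀ x ∈ U, HasFDerivAt (fderiv ℝ fun y => ∑' i, f i y) (∑' i, f'' i x) x := by
  intro x hx
  have h1 := fderiv_tsum_eqOn hU hUc hf hb hfb hx₀ hs
  have hs' : Summable fun i => f' i x₀ :=
    Summable.of_norm_bounded hb fun i => hfb i x₀ hx₀
  have h2 := hasFDerivAt_tsum_of_isPreconnected hb' hU hUc hf' hfb' hx₀ hs' hx
  refine h2.congr_of_eventuallyEq ?_
  filter_upwards [hU.mem_nhds hx] with y hy using (h1 y hy).fderiv

lemma contDiffOn_two_tsum (hU : IsOpen U) (hUc : IsPreconnected U)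
    (hf : ∀ i, ∀ x ∈ U, HasFDerivAt (f i) (f' i x) x) (hb : Summable b)
    (hfb : ∀ i, ∀ x ∈ U, ‖f' i x‖ ≤ b i)
    (hf' : ∀ i, ∀ x ∈ U, HasFDerivAt (f' i) (f'' i x) x) (hb' : Summable b')
    (hfb' : ∀ i, ∀ x ∈ U, ‖f'' i x‖ ≤ b' i) (hc : ∀ i, ContinuousOn (f'' i) U) {x₀ : E}
    (hx₀ : x₀ ∈ U) (hs : Summable fun i => f i x₀) :
    ContDiffOn ℝ 2 (fun y => ∑' i, f i y) U := by
  have h1 := fderiv_tsum_eqOn hU hUc hf hb hfb hx₀ hs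
  have h2 := hasFDerivAt_fderiv_tsum hU hUc hf hb hfb hf' hb' hfb' hx₀ hs
  rw [show (2 : WithTop ℕ∞) = 1 + 1 by norm_num, contDiffOn_succ_iff_fderiv_of_isOpen hU]
  refine ⟨fun x hx => (h1 x hx).differentiableAt.differentiableWithinAt, by simp, ?_⟩
  rw [show (1 : WithTop ℕ∞) = 0 + 1 by norm_num, contDiffOn_succ_iff_fderiv_of_isOpen hU]
  refine ⟨fun x hx => (h2 x hx).differentiableAt.differentiableWithinAt, by simp, ?_⟩
  rw [contDiffOn_zero]
  exact (continuousOn_tsum hc hb' hfb').congr fun x hx => (h2 x hx).fderiv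

end Series

lemma laplacian_of_hasFDerivAt {F : ℂ → ℝ} {x : ℂ} {D : ℂ →L[ℝ] ℂ →L[ℝ] ℝ}
    (h : HasFDerivAt (fderiv ℝ F) D x) :
    Laplacian.laplacian F x = D 1 1 + D Complex.I Complex.I := by
  rw [InnerProductSpace.laplacian_eq_iteratedFDeriv_complexPlane]
  simp [iteratedFDeriv_two_apply, h.fderiv]

/-! ### Functions of the imaginary part of a holomorphic function -/

/-- The real bilinear form `Im (ζ v)`. -/
def imMul : ℂ →L[ℝ] ℂ →L[ℝ] ℝ :=
  (ContinuousLinearMap.compL ℝ ℂ ℂ ℝ Complex.imCLM).comp (ContinuousLinearMap.mul ℝ ℂ)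

@[simp] lemma imMul_apply (ζ v : ℂ) : imMul ζ v = (ζ * v).im := rfl

lemma norm_imMul_le (ζ : ℂ) : ‖imMul ζ‖ ≤ ‖ζ‖ := by
  refine ContinuousLinearMap.opNorm_le_bound _ (norm_nonneg _) fun v => ?_
  rw [imMul_apply, ← norm_mul]
  exact Complex.abs_im_le_norm _

/-- The second derivative of `ψ (Im G)`, in terms of the derivatives of `ψ` and `G`. -/
def hessianIm (p₁ p₂ : ℝ) (G₁ G₂ : ℂ) : ℂ →L[ℝ] ℂ →L[ℝ] ℝ :=
  p₁ • imMul.comp (ContinuousLinearMap.mul ℝ ℂ G₂) + (p₂ • imMul G₁).smulRight (imMul G₁)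

lemma hessianIm_apply (p₁ p₂ : ℝ) (G₁ G₂ v w : ℂ) : hessianIm p₁ p₂ G₁ G₂ v w =
    p₁ * (G₂ * v * w).im + p₂ * (G₁ * v).im * (G₁ * w).im := by
  simp [hessianIm]

/-- The terms with `G₂` cancel because `1² + i² = 0`, that is, because `Im G` is harmonic. -/
lemma hessianIm_trace (p₁ p₂ : ℝ) (G₁ G₂ : ℂ) :
    hessianIm p₁ p₂ G₁ G₂ 1 1 + hessianIm p₁ p₂ G₁ G₂ Complex.I Complex.I = p₂ * ‖G₁‖ ^ 2 := by
  rw [hessianIm_apply, hessianIm_apply, ← Complex.normSq_eq_norm_sq, Complex.normSq_apply]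
  simp
  ring

lemma norm_hessianIm_le (p₁ p₂ : ℝ) (G₁ G₂ : ℂ) :
    ‖hessianIm p₁ p₂ G₁ G₂‖ ≤ |p₁| * ‖G₂‖ + |p₂| * ‖G₁‖ ^ 2 := by
  refine ContinuousLinearMap.opNorm_le_bound₂ _ (by positivity) fun v w => ?_
  rw [hessianIm_apply, Real.norm_eq_abs]
  have h1 : |(G₂ * v * w).im| ≤ ‖G₂‖ * ‖v‖ * ‖w‖ := by
    rw [← norm_mul, ← norm_mul]; exact Complex.abs_im_le_norm _
  have h2 : |(G₁ * v).im| ≤ ‖G₁‖ * ‖v‖ := by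
    rw [← norm_mul]; exact Complex.abs_im_le_norm _
  have h3 : |(G₁ * w).im| ≤ ‖G₁‖ * ‖w‖ := by
    rw [← norm_mul]; exact Complex.abs_im_le_norm _
  calc |p₁ * (G₂ * v * w).im + p₂ * (G₁ * v).im * (G₁ * w).im|
      ≤ |p₁ * (G₂ * v * w).im| + |p₂ * (G₁ * v).im * (G₁ * w).im| := abs_add_le _ _
    _ = |p₁| * |(G₂ * v * w).im| + |p₂| * |(G₁ * v).im| * |(G₁ * w).im| := by
        simp only [abs_mul]
    _ ≤ |p₁| * (‖G₂‖ * ‖v‖ * ‖w‖) + |p₂| * (‖G₁‖ * ‖v‖) * (‖G₁‖ * ‖w‖) := by gcongr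
    _ = _ := by ring

lemma continuous_hessianIm : Continuous fun x : ℝ × ℝ × ℂ × ℂ =>
    hessianIm x.1 x.2.1 x.2.2.1 x.2.2.2 := by
  have h1 : Continuous fun x : ℝ × ℝ × ℂ × ℂ => imMul.comp (ContinuousLinearMap.mul ℝ ℂ x.2.2.2) :=
    ((ContinuousLinearMap.compL ℝ ℂ ℂ (ℂ →L[ℝ] ℝ) imMul).comp
      (ContinuousLinearMap.mul ℝ ℂ)).continuous.comp (by fun_prop)
  have h2 : Continuous fun x : ℝ × ℝ × ℂ × ℂ => imMul x.2.2.1 :=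
    imMul.continuous.comp (by fun_prop)
  have h3 : Continuous fun x : ℝ × ℝ × ℂ × ℂ =>
      ContinuousLinearMap.smulRightL ℝ ℂ (ℂ →L[ℝ] ℝ) (x.2.1 • imMul x.2.2.1) (imMul x.2.2.1) :=
    (ContinuousLinearMap.smulRightL ℝ ℂ (ℂ →L[ℝ] ℝ)).continuous₂.comp
      (((continuous_fst.comp continuous_snd).smul h2).prodMk h2)
  have h4 : IsTopologicalAddGroup (ℂ →L[ℝ] ℂ →L[ℝ] ℝ) := inferInstance
  have : ContinuousAdd (ℂ →L[ℝ] ℂ →L[ℝ] ℝ) := h4.toContinuousAdd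
  exact (continuous_fst.smul h1).add h3

lemma hasFDerivAt_comp_im {ψ : ℝ → ℝ} {p₁ : ℝ} {G : ℂ → ℂ} {G₁ w : ℂ} (hG : HasDerivAt G G₁ w)
    (hψ : HasDerivAt ψ p₁ (G w).im) :
    HasFDerivAt (fun w => ψ (G w).im) (p₁ • imMul G₁) w := by
  have h1 : HasFDerivAt (fun w => (G w).im) (imMul G₁) w := by
    have := Complex.imCLM.hasFDerivAt.comp w (hG.hasFDerivAt.restrictScalars ℝ)
    refine this.congr_fderiv ?_
    ext v
    simp
    ring
  exact hψ.comp_hasFDerivAt w h1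

lemma hasFDerivAt_fderiv_comp_im {ψ₁ : ℝ → ℝ} {p₂ : ℝ} {G G₁ : ℂ → ℂ} {G₂ w : ℂ}
    (hG : HasDerivAt G (G₁ w) w) (hG₁ : HasDerivAt G₁ G₂ w) (hψ : HasDerivAt ψ₁ p₂ (G w).im) :
    HasFDerivAt (fun w => ψ₁ (G w).im • imMul (G₁ w)) (hessianIm (ψ₁ (G w).im) p₂ (G₁ w) G₂) w := by
  have h1 := hasFDerivAt_comp_im hG hψ
  have h2 : HasFDerivAt (fun w => imMul (G₁ w))
      (imMul.comp (ContinuousLinearMap.mul ℝ ℂ G₂)) w := by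
    have := imMul.hasFDerivAt.comp w (hG₁.hasFDerivAt.restrictScalars ℝ)
    refine this.congr_fderiv ?_
    ext v u
    simp [mul_comm]
  exact h1.smul h2

/-! ### The one-variable series at a cusp -/

/-- The nonzero integers. -/
abbrev NonzeroInt : Type := {n : ℤ // n ≠ 0}

lemma one_le_sq_of_nonzeroInt (n : NonzeroInt) : (1 : ℝ) ≤ (n.1 : ℝ) ^ 2 := by
  have : 1 ≤ n.1 ^ 2 := by
    have := sq_pos_of_ne_zero n.2
    omega
  exact_mod_cast this

lemma summable_inv_sq_nonzeroInt : Summable fun n : NonzeroInt => ((n.1 : ℝ) ^ 2)⁻¹ := by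
  have : Summable fun n : ℤ => ((n : ℝ) ^ 2)⁻¹ := by
    simpa using Real.summable_one_div_int_pow (p := 2) |>.mpr one_lt_two
  exact this.subtype _

/-- The function `log (1 + 4 t² / n²)`. -/
def psi (n : ℤ) (t : ℝ) : ℝ := Real.log (1 + 4 * t ^ 2 / (n : ℝ) ^ 2)

/-- The derivative of `psi n`. -/
def psi₁ (n : ℤ) (t : ℝ) : ℝ := 8 * t / ((n : ℝ) ^ 2 + 4 * t ^ 2)

/-- The second derivative of `psi n`. -/
def psi₂ (n : ℤ) (t : ℝ) : ℝ :=
  8 * ((n : ℝ) ^ 2 - 4 * t ^ 2) / ((n : ℝ) ^ 2 + 4 * t ^ 2) ^ 2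

lemma hasDerivAt_psi (n : NonzeroInt) (t : ℝ) : HasDerivAt (psi n) (psi₁ n t) t := by
  have hn := one_le_sq_of_nonzeroInt n
  have h1 : HasDerivAt (fun t : ℝ => 1 + 4 * t ^ 2 / (n.1 : ℝ) ^ 2)
      (4 * (2 * t) / (n.1 : ℝ) ^ 2) t := by
    have := ((((hasDerivAt_id t).pow 2).const_mul 4).div_const ((n.1 : ℝ) ^ 2)).const_add 1
    simpa using this
  have hpos : 0 < 1 + 4 * t ^ 2 / (n.1 : ℝ) ^ 2 := by positivity
  refine (h1.log hpos.ne').congr_deriv ?_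
  have : (n.1 : ℝ) ≠ 0 := by exact_mod_cast n.2
  rw [psi₁]
  field_simp
  ring

lemma hasDerivAt_psi₁ (n : NonzeroInt) (t : ℝ) : HasDerivAt (psi₁ n) (psi₂ n t) t := by
  have hn := one_le_sq_of_nonzeroInt n
  have hpos : 0 < (n.1 : ℝ) ^ 2 + 4 * t ^ 2 := by positivity
  have h1 : HasDerivAt (fun t : ℝ => (n.1 : ℝ) ^ 2 + 4 * t ^ 2) (4 * (2 * t)) t := by
    have := (((hasDerivAt_id t).pow 2).const_mul 4).const_add ((n.1 : ℝ) ^ 2)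
    simpa using this
  have h2 : HasDerivAt (fun t : ℝ => 8 * t) 8 t := by
    simpa using (hasDerivAt_id t).const_mul (8 : ℝ)
  refine (h2.div h1 hpos.ne').congr_deriv ?_
  rw [psi₂]
  congr 1
  ring

lemma psi_nonneg (n : ℤ) (t : ℝ) : 0 ≤ psi n t := by
  refine Real.log_nonneg ?_
  have : 0 ≤ 4 * t ^ 2 / (n : ℝ) ^ 2 := by positivity
  linarith

lemma psi_le (n : ℤ) (t : ℝ) : psi n t ≤ 4 * t ^ 2 * ((n : ℝ) ^ 2)⁻¹ := by
  have h0 : 0 ≤ 4 * t ^ 2 / (n : ℝ) ^ 2 := by positivity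
  have := Real.log_le_sub_one_of_pos (show 0 < 1 + 4 * t ^ 2 / (n : ℝ) ^ 2 by linarith)
  rw [psi, ← div_eq_mul_inv]
  linarith

lemma abs_psi₁_le (n : NonzeroInt) {t : ℝ} (ht : 0 ≤ t) :
    |psi₁ n t| ≤ 8 * t * ((n.1 : ℝ) ^ 2)⁻¹ := by
  have hn := one_le_sq_of_nonzeroInt n
  rw [psi₁, abs_of_nonneg (by positivity), ← div_eq_mul_inv]
  gcongr
  nlinarith

lemma abs_psi₂_le (n : NonzeroInt) (t : ℝ) : |psi₂ n t| ≤ 8 * ((n.1 : ℝ) ^ 2)⁻¹ := by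
  have hn := one_le_sq_of_nonzeroInt n
  have ht : 0 ≤ 4 * t ^ 2 := by positivity
  rw [psi₂, abs_div, abs_mul, abs_of_pos (show (0 : ℝ) < 8 by norm_num),
    abs_of_nonneg (show 0 ≤ ((n.1 : ℝ) ^ 2 + 4 * t ^ 2) ^ 2 by positivity), mul_div_assoc]
  gcongr
  rw [← one_div, div_le_div_iff₀ (by positivity) (by positivity), one_mul]
  have : |(n.1 : ℝ) ^ 2 - 4 * t ^ 2| ≤ (n.1 : ℝ) ^ 2 + 4 * t ^ 2 := by
    rw [abs_le]; constructor <;> linarith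
  nlinarith [abs_nonneg ((n.1 : ℝ) ^ 2 - 4 * t ^ 2)]

lemma continuous_psi₁ (n : NonzeroInt) : Continuous (psi₁ n) :=
  continuous_iff_continuousAt.mpr fun t => (hasDerivAt_psi₁ n t).continuousAt

lemma continuous_psi₂ (n : NonzeroInt) : Continuous (psi₂ n) := by
  have hn := one_le_sq_of_nonzeroInt n
  unfold psi₂
  refine Continuous.div (by fun_prop) (by fun_prop) fun t => ?_
  have : 0 < (n.1 : ℝ) ^ 2 + 4 * t ^ 2 := by positivity
  positivity

/-- The value of the series `∑ (n + i s)⁻²`. -/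
lemma tsum_inv_add_sq {s : ℝ} (hs : 0 < s) :
    ∑' n : ℤ, 1 / ((s * Complex.I : ℂ) + n) ^ 2 =
      ((-(Real.pi ^ 2 / Real.sinh (Real.pi * s) ^ 2) : ℝ) : ℂ) := by
  -- Lipschitz's formula with exponent `k + 1 = 2`: the series equals `-4π² ∑ n qⁿ = -4π² q / (1 -
  -- q)²` with `q = exp (-2πs)`, and `(1 - q)² / (4q) = sinh² (πs)`.
  have h := EisensteinSeries.qExpansion_identity (k := 1) le_rfl ⟨s * Complex.I, by simpa using hs⟩
  simp only [Nat.reduceAdd, pow_one, Nat.factorial_one, Nat.cast_one, div_one] at h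
  rw [h]
  have hq : Complex.exp (2 * Real.pi * Complex.I * (s * Complex.I)) =
      ((Real.exp (-(2 * Real.pi * s)) : ℝ) : ℂ) := by
    rw [Complex.ofReal_exp]
    congr 1
    push_cast
    linear_combination (2 * Real.pi * s : ℂ) * Complex.I_sq
  rw [hq]
  set q := Real.exp (-(2 * Real.pi * s)) with hqdef
  have hq0 : 0 < q := Real.exp_pos _
  have hq1 : q < 1 := by
    rw [hqdef, Real.exp_lt_one_iff]
    have := mul_pos Real.pi_pos hs
    linarith
  rw [tsum_coe_mul_geometric_of_norm_lt_one (by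
    rw [Complex.norm_real, Real.norm_eq_abs, abs_of_pos hq0]; exact hq1)]
  have hsinh : Real.sinh (Real.pi * s) ^ 2 = (1 - q) ^ 2 / (4 * q) := by
    have he : q = Real.exp (-(Real.pi * s)) * Real.exp (-(Real.pi * s)) := by
      rw [← Real.exp_add, hqdef]; congr 1; ring
    have he' : Real.exp (Real.pi * s) * Real.exp (-(Real.pi * s)) = 1 := by
      rw [← Real.exp_add]; simp
    rw [Real.sinh_eq, eq_div_iff (by positivity), he]
    set a := Real.exp (Real.pi * s)
    set b := Real.exp (-(Real.pi * s))
    linear_combination ((a * b - b * b) + (1 - b * b)) * he'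
  rw [hsinh]
  have hI : (-2 * Real.pi * Complex.I : ℂ) ^ 2 = -(4 * Real.pi ^ 2) := by
    rw [mul_pow, Complex.I_sq]; ring
  rw [hI]
  have hq1' : (1 - (q : ℂ)) ≠ 0 := by
    have : (1 - q : ℝ) ≠ 0 := by linarith
    exact_mod_cast this
  have hq0' : (q : ℂ) ≠ 0 := by exact_mod_cast hq0.ne'
  push_cast
  field_simp

/-- With `s = 2t` the terms are `2 s² Re (n + is)⁻²`, so the full series is known. Removing `n = 0`
leaves `2 - 2 (πs)² / sinh² (πs)`, which lies in `[0, 2]`. The cancellation between the terms is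
essential: the sum of their absolute values grows with `t`. -/
lemma tsum_psi₂_bound {t : ℝ} (ht : 0 < t) :
    |∑' n : NonzeroInt, t ^ 2 * psi₂ n t| ≤ 2 := by
  set s := 2 * t with hs
  have hs0 : 0 < s := by positivity
  have hterm : ∀ n : ℤ, (1 / ((s * Complex.I : ℂ) + n) ^ 2).re =
      ((n : ℝ) ^ 2 - s ^ 2) / ((n : ℝ) ^ 2 + s ^ 2) ^ 2 := by
    intro n
    have hns : 0 < (n : ℝ) ^ 2 + s ^ 2 := by positivity
    have e : (1 / ((s * Complex.I : ℂ) + n) ^ 2) =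
        (((n : ℝ) - s * Complex.I : ℂ) ^ 2) / (((n : ℝ) ^ 2 + s ^ 2 : ℝ) ^ 2 : ℝ) := by
      have h1 : ((s * Complex.I : ℂ) + n) * ((n : ℝ) - s * Complex.I) =
          (((n : ℝ) ^ 2 + s ^ 2 : ℝ) : ℂ) := by
        push_cast
        linear_combination (-(s : ℂ) ^ 2) * Complex.I_sq
      have h2 : ((s * Complex.I : ℂ) + n) ≠ 0 := by
        intro h0
        rw [h0, zero_mul] at h1
        exact hns.ne (by exact_mod_cast h1)
      have h3 : ((((n : ℝ) ^ 2 + s ^ 2 : ℝ) ^ 2 : ℝ) : ℂ) ≠ 0 := by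
        exact_mod_cast (pow_pos hns 2).ne'
      rw [div_eq_div_iff (pow_ne_zero 2 h2) h3, one_mul, ← mul_pow,
        mul_comm _ (s * Complex.I + _ : ℂ),
        h1]
      push_cast
      ring
    rw [e, Complex.div_ofReal_re]
    congr 1
    simp [sq]
  have hsumC : Summable fun n : ℤ => 1 / ((s * Complex.I : ℂ) + n) ^ 2 := by
    have := EisensteinSeries.linear_right_summable (s * Complex.I : ℂ) 1 (k := 2) le_rfl
    simpa using this
  have hre : HasSum (fun n : ℤ => ((n : ℝ) ^ 2 - s ^ 2) / ((n : ℝ) ^ 2 + s ^ 2) ^ 2)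
      (-(Real.pi ^ 2 / Real.sinh (Real.pi * s) ^ 2)) := by
    have := Complex.hasSum_re hsumC.hasSum
    rw [tsum_inv_add_sq hs0, Complex.ofReal_re] at this
    exact this.congr_fun fun n => (hterm n).symm
  have hsplit : ∑' n : NonzeroInt, ((n.1 : ℝ) ^ 2 - s ^ 2) / ((n.1 : ℝ) ^ 2 + s ^ 2) ^ 2 =
      1 / s ^ 2 - Real.pi ^ 2 / Real.sinh (Real.pi * s) ^ 2 := by
    have h1 := hre.summable.sum_add_tsum_subtype_compl {0}
    have h2 : ∑' n : {n // n ∉ ({0} : Finset ℤ)},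
        ((n.1 : ℝ) ^ 2 - s ^ 2) / ((n.1 : ℝ) ^ 2 + s ^ 2) ^ 2 =
        ∑' n : NonzeroInt, ((n.1 : ℝ) ^ 2 - s ^ 2) / ((n.1 : ℝ) ^ 2 + s ^ 2) ^ 2 :=
      (Equiv.subtypeEquivRight (by simp)).tsum_eq fun n : NonzeroInt =>
        ((n.1 : ℝ) ^ 2 - s ^ 2) / ((n.1 : ℝ) ^ 2 + s ^ 2) ^ 2
    rw [hre.tsum_eq, h2, Finset.sum_singleton] at h1
    have h3 : (((0 : ℤ) : ℝ) ^ 2 - s ^ 2) / (((0 : ℤ) : ℝ) ^ 2 + s ^ 2) ^ 2 = -(1 / s ^ 2) := by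
      simp
      field_simp
    rw [h3] at h1
    linarith
  have hmul : ∑' n : NonzeroInt, t ^ 2 * psi₂ n t =
      2 - 2 * ((Real.pi * s) ^ 2 / Real.sinh (Real.pi * s) ^ 2) := by
    have : ∀ n : NonzeroInt, t ^ 2 * psi₂ n t =
        2 * s ^ 2 * (((n.1 : ℝ) ^ 2 - s ^ 2) / ((n.1 : ℝ) ^ 2 + s ^ 2) ^ 2) := by
      intro n
      rw [psi₂, show (n.1 : ℝ) ^ 2 + 4 * t ^ 2 = (n.1 : ℝ) ^ 2 + s ^ 2 by rw [hs]; ring,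
        show (n.1 : ℝ) ^ 2 - 4 * t ^ 2 = (n.1 : ℝ) ^ 2 - s ^ 2 by rw [hs]; ring, hs]
      ring
    simp_rw [this]
    rw [tsum_mul_left, hsplit]
    field_simp
  have hps : 0 < Real.pi * s := mul_pos Real.pi_pos hs0
  have hle : (Real.pi * s) ^ 2 / Real.sinh (Real.pi * s) ^ 2 ≤ 1 := by
    have h1 := Real.self_le_sinh_iff.mpr hps.le
    rw [div_le_one (by have := Real.sinh_pos_iff.mpr hps; positivity)]
    exact pow_le_pow_left₀ hps.le h1 2
  have hge : 0 ≤ (Real.pi * s) ^ 2 / Real.sinh (Real.pi * s) ^ 2 := by positivity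
  rw [hmul, abs_le]
  constructor <;> linarith

/-! ### The parabolic elements -/

/-- The cusps of `Γ`, as points of `ℝ ∪ {∞}`. -/
abbrev CuspPt (Γ : PSLSubgroup) : Type := {c : OnePoint ℝ // IsCusp c Γ.grp}

/-- A scaling matrix at a cusp of a discrete group. -/
def cuspScal {Γ : PSLSubgroup} (h : IsLocFinite Γ) (c : CuspPt Γ) : GL (Fin 2) ℝ :=
  (exists_isScaling h c.2).choose

lemma isScaling_cuspScal {Γ : PSLSubgroup} (h : IsLocFinite Γ) (c : CuspPt Γ) :
    IsScaling Γ c.1 (cuspScal h c) :=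
  (exists_isScaling h c.2).choose_spec

/-- The height of `z` at the cusp `c`. -/
def cuspHeight {Γ : PSLSubgroup} (h : IsLocFinite Γ) (c : CuspPt Γ) (z : ℍ) : ℝ :=
  ((cuspScal h c)⁻¹ • z).im

lemma cuspHeight_pos {Γ : PSLSubgroup} (h : IsLocFinite Γ) (c : CuspPt Γ) (z : ℍ) :
    0 < cuspHeight h c z := im_pos _

lemma trace_conj_upperRightHom {s : GL (Fin 2) ℝ} (hs : s.det = 1) (t : ℝ) :
    Matrix.trace (s * upperRightHom t * s⁻¹).val = 2 := by
  obtain ⟨h1, -, -, h4⟩ := conj_upperRightHom_entries hs t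
  rw [Matrix.trace_fin_two, h1, h4]
  ring

lemma isParabolic_conj_upperRightHom (s : GL (Fin 2) ℝ) {t : ℝ} (ht : t ≠ 0) :
    (s * upperRightHom t * s⁻¹).IsParabolic := by
  rw [GeneralLinearGroup.isParabolic_conj_iff,
    GeneralLinearGroup.isParabolic_iff_of_upperTriangular (by simp)]
  simpa using ht

lemma conj_upperRightHom_smul {s : GL (Fin 2) ℝ} {c : OnePoint ℝ}
    (hs : s • (OnePoint.infty : OnePoint ℝ) = c) (t : ℝ) : (s * upperRightHom t * s⁻¹) • c = c := by
  rw [mul_smul, mul_smul, ← hs, inv_smul_smul,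
    OnePoint.smul_infty_eq_self_iff.mpr (show upperRightHom t 1 0 = 0 by simp)]

/-- The parabolic elements of `Γ` correspond to the pairs of a cusp and a nonzero integer. -/
def parabolicOf {Γ : PSLSubgroup} (h : IsLocFinite Γ) (x : CuspPt Γ × NonzeroInt) : parabolics Γ :=
  ⟨cuspScal h x.1 * upperRightHom (x.2.1 : ℝ) * (cuspScal h x.1)⁻¹,
    (isScaling_cuspScal h x.1).conj_mem x.2.1,
    isParabolic_conj_upperRightHom _ (by exact_mod_cast x.2.2),
    trace_conj_upperRightHom (isScaling_cuspScal h x.1).det _⟩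

/-- A parabolic element has a unique boundary fixed point, which recovers the cusp; its translation
length there recovers the integer. -/
lemma parabolicOf_bijective {Γ : PSLSubgroup} (h : IsLocFinite Γ) :
    Function.Bijective (parabolicOf h) := by
  constructor
  · rintro ⟨c, n⟩ ⟨d, k⟩ hcd
    have hv : (parabolicOf h (c, n)).1 = (parabolicOf h (d, k)).1 := congrArg Subtype.val hcd
    have h1 : (parabolicOf h (c, n)).1 • c.1 = c.1 :=
      conj_upperRightHom_smul (isScaling_cuspScal h c).smul_infty _
    have h2 : (parabolicOf h (d, k)).1 • d.1 = d.1 :=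
      conj_upperRightHom_smul (isScaling_cuspScal h d).smul_infty _
    rw [(parabolicOf h (c, n)).2.2.1.smul_eq_self_iff] at h1
    rw [(parabolicOf h (d, k)).2.2.1.smul_eq_self_iff, ← hv, ← h1] at h2
    obtain rfl : c = d := Subtype.ext h2.symm
    have h3 : (upperRightHom (n.1 : ℝ) : GL (Fin 2) ℝ) = upperRightHom (k.1 : ℝ) := by
      simpa only [parabolicOf, mul_left_inj, mul_right_inj] using hv
    have h4 : (n.1 : ℝ) = k.1 := injective_upperRightHom h3
    have h5 : n.1 = k.1 := by exact_mod_cast h4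
    rw [Subtype.ext h5]
  · rintro ⟨γ, hγ, hp, ht⟩
    have hfix : γ • γ.parabolicFixedPoint = γ.parabolicFixedPoint := hp.smul_eq_self_iff.mpr rfl
    set c : CuspPt Γ := ⟨γ.parabolicFixedPoint, γ, hγ, hp, hfix⟩
    have hs := isScaling_cuspScal h c
    set s := cuspScal h c with hs_def
    obtain ⟨n, hn⟩ := (hs.stabilizer γ).mp ⟨hγ, hfix⟩
    have hγs : γ = s * (s⁻¹ * γ * s) * s⁻¹ := by group
    -- The normalisation to trace `2` excludes the negative sign.
    have hn' : s⁻¹ * γ * s = upperRightHom (n : ℝ) := by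
      refine hn.resolve_right fun hneg => ?_
      rw [hneg, mul_neg, neg_mul] at hγs
      have := trace_conj_upperRightHom hs.det (n : ℝ)
      rw [hγs, Units.val_neg, Matrix.trace_neg, this] at ht
      norm_num at ht
    rw [hn'] at hγs
    have hn0 : n ≠ 0 := by
      rintro rfl
      have h1 : γ = 1 := by rw [hγs]; simp only [Int.cast_zero, AddChar.map_zero_eq_one]; group
      refine hp.1 ⟨1, ?_⟩
      rw [h1]; simp
    exact ⟨(c, ⟨n, hn0⟩), Subtype.ext hγs.symm⟩

/-- The bijection between the pairs of a cusp and a nonzero integer and the parabolic elements. -/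
def parabolicEquiv {Γ : PSLSubgroup} (h : IsLocFinite Γ) :
    CuspPt Γ × NonzeroInt ≃ parabolics Γ :=
  Equiv.ofBijective _ (parabolicOf_bijective h)

/-- From `|z - w̄|² = |z - w|² + 4 Im z Im w`. In this form the invariance under isometries is
evident. -/
lemma greenH_eq {z w : ℍ} (hzw : z ≠ w) :
    greenH z w = Real.log (1 + 2 / (Real.cosh (dist z w) - 1)) := by
  have hne : (z : ℂ) - w ≠ 0 := sub_ne_zero.mpr fun h => hzw (UpperHalfPlane.ext h)
  have hpos : 0 < ‖(z : ℂ) - w‖ ^ 2 := by positivity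
  have hz := z.im_pos
  have hw := w.im_pos
  have h1 : ‖(z : ℂ) - (starRingEnd ℂ) (w : ℂ)‖ ^ 2 = ‖(z : ℂ) - w‖ ^ 2 + 4 * z.im * w.im := by
    rw [← Complex.normSq_eq_norm_sq, ← Complex.normSq_eq_norm_sq, Complex.normSq_apply,
      Complex.normSq_apply]
    simp
    ring
  rw [greenH, norm_div, div_pow, h1, cosh_dist, dist_eq_norm]
  congr 1
  field_simp
  ring

lemma greenH_conj {s : GL (Fin 2) ℝ} (hs : s.det = 1) (n : NonzeroInt) (z : ℍ) :
    greenH z ((s * upperRightHom (n.1 : ℝ) * s⁻¹) • z) = psi n (s⁻¹ • z).im := by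
  set w := s⁻¹ • z with hw
  have hn : (n.1 : ℝ) ≠ 0 := by exact_mod_cast n.2
  have hz : z = s • w := by rw [hw, smul_inv_smul]
  have e : (s * upperRightHom (n.1 : ℝ) * s⁻¹) • z = s • upperRightHom (n.1 : ℝ) • w := by
    rw [mul_smul, mul_smul]
  have hd : dist (w : ℂ) (upperRightHom (n.1 : ℝ) • w : ℍ) ^ 2 = (n.1 : ℝ) ^ 2 := by
    rw [upperRightHom_smul_coe, dist_eq_norm]
    simp
  have hpos := w.im_pos
  rw [greenH_eq, e, hz, dist_smul_smul hs, cosh_dist, hd, upperRightHom_smul_im, psi]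
  · congr 1
    field_simp
    ring
  · rw [e]
    nth_rewrite 1 [hz]
    intro h0
    have h1 := MulAction.injective s h0
    rw [← h1, dist_self] at hd
    exact hn (by simpa using hd.symm)

/-! ### Möbius transformations as holomorphic functions -/

/-- The Möbius transformation of `ℂ` given by `g`. -/
def moeb (g : GL (Fin 2) ℝ) (w : ℂ) : ℂ := (g 0 0 * w + g 0 1) / (g 1 0 * w + g 1 1)

/-- The denominator of `moeb g`. -/
def den (g : GL (Fin 2) ℝ) (w : ℂ) : ℂ := g 1 0 * w + g 1 1

lemma den_ne_zero (g : GL (Fin 2) ℝ) {w : ℂ} (hw : 0 < w.im) : den g w ≠ 0 :=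
  denom_ne_zero_of_im g hw.ne'

lemma moeb_coe {g : GL (Fin 2) ℝ} (hg : g.det = 1) (z : ℍ) : moeb g z = (g • z : ℍ) := by
  rw [coe_smul_of_det_pos (by rw [hg]; exact one_pos)]
  rfl

lemma hasDerivAt_den (g : GL (Fin 2) ℝ) (w : ℂ) : HasDerivAt (den g) (g 1 0) w := by
  have := ((hasDerivAt_id w).const_mul (g 1 0 : ℂ)).add_const (g 1 1 : ℂ)
  rw [mul_one] at this
  exact this

lemma hasDerivAt_moeb {g : GL (Fin 2) ℝ} (hg : g.det = 1) {w : ℂ} (hw : 0 < w.im) :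
    HasDerivAt (moeb g) (1 / den g w ^ 2) w := by
  have h1 : HasDerivAt (fun w : ℂ => (g 0 0 * w + g 0 1 : ℂ)) (g 0 0) w := by
    simpa using ((hasDerivAt_id w).const_mul (g 0 0 : ℂ)).add_const (g 0 1 : ℂ)
  refine (h1.div (hasDerivAt_den g w) (den_ne_zero g hw)).congr_deriv ?_
  congr 1
  have hd : (g 0 0 * g 1 1 - g 0 1 * g 1 0 : ℂ) = 1 := by exact_mod_cast entries_det hg
  rw [den]
  linear_combination hd

lemma hasDerivAt_inv_den_sq (g : GL (Fin 2) ℝ) {w : ℂ} (hw : 0 < w.im) :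
    HasDerivAt (fun w => 1 / den g w ^ 2) (-(2 * g 1 0) / den g w ^ 3) w := by
  have h0 := den_ne_zero g hw
  have h1 := ((hasDerivAt_den g w).pow 2).inv (pow_ne_zero 2 h0)
  simp only [one_div]
  refine h1.congr_deriv ?_
  simp
  field_simp

/-- The conformal factor `|g'(z)|`; it turns bounds for derivatives of the terms into bounds by
heights. -/
lemma norm_inv_den_sq {g : GL (Fin 2) ℝ} (hg : g.det = 1) (z : ℍ) :
    ‖1 / den g z ^ 2‖ = (g • z).im / z.im := by
  have hz := z.im_pos
  rw [im_smul_eq_div_normSq, hg, Complex.normSq_eq_norm_sq]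
  simp only [Units.val_one, abs_one, one_mul, norm_div, norm_one, norm_pow]
  rw [div_div, mul_comm, ← div_div, div_self hz.ne']
  rfl

/-- The extra factor `c / (c z + d)` in the second derivative is at most `1 / Im z`, since `|c| Im z
= |Im (c z + d)|`. -/
lemma norm_deriv_inv_den_sq_le {g : GL (Fin 2) ℝ} (hg : g.det = 1) (z : ℍ) :
    ‖-(2 * g 1 0) / den g z ^ 3‖ ≤ 2 * (g • z).im / z.im ^ 2 := by
  have hz := z.im_pos
  have h0 : 0 < ‖den g z‖ := norm_pos_iff.mpr (den_ne_zero g z.im_pos)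
  have h1 : |g 1 0| * z.im ≤ ‖den g z‖ := by
    have : (den g z).im = g 1 0 * z.im := by simp [den]
    calc |g 1 0| * z.im = |(den g z).im| := by rw [this, abs_mul, abs_of_pos hz]
      _ ≤ _ := Complex.abs_im_le_norm _
  have h2 : (g • z).im = z.im / ‖den g z‖ ^ 2 := by
    have := norm_inv_den_sq hg z
    rw [eq_div_iff hz.ne', norm_div, norm_one, norm_pow] at this
    rw [← this]
    field_simp
  rw [h2, norm_div, norm_neg, norm_mul, norm_pow, Complex.norm_real, Complex.norm_ofNat,
    Real.norm_eq_abs]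
  rw [div_le_iff₀ (by positivity)]
  have e : 2 * (z.im / ‖den g z‖ ^ 2) / z.im ^ 2 * ‖den g z‖ ^ 3 = 2 * (‖den g z‖ / z.im) := by
    field_simp
  rw [e]
  have : |g 1 0| ≤ ‖den g z‖ / z.im := by rwa [le_div_iff₀ hz]
  linarith

/-! ### The series over the parabolic elements -/

section ParSum

variable {Γ : PSLSubgroup} (h : IsLocFinite Γ)

lemma det_cuspScal_inv (c : CuspPt Γ) : ((cuspScal h c)⁻¹).det = 1 :=
  det_inv_eq_one (isScaling_cuspScal h c).det

lemma eq_of_one_lt_cuspHeight {c d : CuspPt Γ} {z : ℍ} (hc : 1 < cuspHeight h c z)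
    (hd : 1 < cuspHeight h d z) : c = d :=
  Subtype.ext ((isScaling_cuspScal h c).eq_of_one_lt_im h (isScaling_cuspScal h d) hc hd)

/-- At most one cusp sees `z` above height one. The bound depends on `z`, which suffices for
convergence. -/
lemma exists_cuspHeight_le (z : ℍ) : ∃ H, ∀ c, cuspHeight h c z ≤ H := by
  by_cases h0 : ∃ c, 1 < cuspHeight h c z
  · obtain ⟨c, hc⟩ := h0
    refine ⟨cuspHeight h c z, fun d => ?_⟩
    rcases lt_or_ge 1 (cuspHeight h d z) with hd | hd
    · rw [eq_of_one_lt_cuspHeight h hc hd]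
    · exact hd.trans hc.le
  · push Not at h0
    exact ⟨1, h0⟩

lemma summable_cuspHeight_sq (z : ℍ) : Summable fun c => cuspHeight h c z ^ 2 := by
  obtain ⟨H, hH⟩ := exists_cuspHeight_le h z
  have h1 := tsum_height_sq_le (cuspScal h) (fun c => (isScaling_cuspScal h c).det)
    (fun c d w hc hd => eq_of_one_lt_cuspHeight h hc hd) z hH
  have h2 := ENNReal.summable_toReal (ne_top_of_le_ne_top (horoConst_ne_top H) h1)
  exact h2.congr fun c => ENNReal.toReal_ofReal (sq_nonneg _)

lemma summable_cuspHeight_sq_mul (z : ℍ) : Summable fun i : CuspPt Γ × NonzeroInt =>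
    cuspHeight h i.1 z ^ 2 * ((i.2.1 : ℝ) ^ 2)⁻¹ :=
  (summable_cuspHeight_sq h z).mul_of_nonneg summable_inv_sq_nonzeroInt
    (fun _ => sq_nonneg _) fun _ => inv_nonneg.mpr (sq_nonneg _)

lemma greenH_parabolicEquiv (z : ℍ) (i : CuspPt Γ × NonzeroInt) :
    greenH z ((parabolicEquiv h i).1 • z) = psi i.2.1 (cuspHeight h i.1 z) :=
  greenH_conj (isScaling_cuspScal h i.1).det i.2 z

lemma summable_psi_cuspHeight (z : ℍ) : Summable fun i : CuspPt Γ × NonzeroInt =>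
    psi i.2.1 (cuspHeight h i.1 z) := by
  refine Summable.of_nonneg_of_le (fun i => psi_nonneg _ _) (fun i => psi_le _ _)
    (((summable_cuspHeight_sq_mul h z).mul_left 4).congr fun i => ?_)
  ring

lemma summable_greenH (h : IsLocFinite Γ) (z : ℍ) :
    Summable fun γ : parabolics Γ => greenH z (γ.1 • z) := by
  rw [← (parabolicEquiv h).summable_iff]
  exact (summable_psi_cuspHeight h z).congr fun i => (greenH_parabolicEquiv h z i).symm

/-- The terms of `parSum`, as functions on `ℂ`. -/
def parTerm (i : CuspPt Γ × NonzeroInt) (w : ℂ) : ℝ :=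
  psi i.2.1 (moeb (cuspScal h i.1)⁻¹ w).im

/-- The derivative of `parTerm`. -/
def parTerm₁ (i : CuspPt Γ × NonzeroInt) (w : ℂ) : ℂ →L[ℝ] ℝ :=
  psi₁ i.2.1 (moeb (cuspScal h i.1)⁻¹ w).im • imMul (1 / den (cuspScal h i.1)⁻¹ w ^ 2)

/-- The second derivative of `parTerm`. -/
def parTerm₂ (i : CuspPt Γ × NonzeroInt) (w : ℂ) : ℂ →L[ℝ] ℂ →L[ℝ] ℝ :=
  hessianIm (psi₁ i.2.1 (moeb (cuspScal h i.1)⁻¹ w).im)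
    (psi₂ i.2.1 (moeb (cuspScal h i.1)⁻¹ w).im) (1 / den (cuspScal h i.1)⁻¹ w ^ 2)
    (-(2 * (cuspScal h i.1)⁻¹ 1 0) / den (cuspScal h i.1)⁻¹ w ^ 3)

lemma im_moeb_cuspScal (c : CuspPt Γ) (z : ℍ) :
    (moeb (cuspScal h c)⁻¹ z).im = cuspHeight h c z := by
  rw [moeb_coe (det_cuspScal_inv h c)]
  rfl

lemma hasFDerivAt_parTerm (i : CuspPt Γ × NonzeroInt) {w : ℂ} (hw : 0 < w.im) :
    HasFDerivAt (parTerm h i) (parTerm₁ h i w) w :=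
  hasFDerivAt_comp_im (hasDerivAt_moeb (det_cuspScal_inv h i.1) hw) (hasDerivAt_psi i.2 _)

lemma hasFDerivAt_parTerm₁ (i : CuspPt Γ × NonzeroInt) {w : ℂ} (hw : 0 < w.im) :
    HasFDerivAt (parTerm₁ h i) (parTerm₂ h i w) w :=
  hasFDerivAt_fderiv_comp_im (hasDerivAt_moeb (det_cuspScal_inv h i.1) hw)
    (hasDerivAt_inv_den_sq _ hw) (hasDerivAt_psi₁ i.2 _)

lemma continuousAt_parTerm₂ (i : CuspPt Γ × NonzeroInt) {w : ℂ} (hw : 0 < w.im) :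
    ContinuousAt (parTerm₂ h i) w := by
  have h1 : ContinuousAt (fun w => (moeb (cuspScal h i.1)⁻¹ w).im) w :=
    Complex.continuous_im.continuousAt.comp
      (hasDerivAt_moeb (det_cuspScal_inv h i.1) hw).continuousAt
  have h2 := (hasDerivAt_inv_den_sq (cuspScal h i.1)⁻¹ hw).continuousAt
  have h3 : ContinuousAt (fun w => (-(2 * (cuspScal h i.1)⁻¹ 1 0 : ℂ)) /
      den (cuspScal h i.1)⁻¹ w ^ 3) w :=
    continuousAt_const.div ((hasDerivAt_den _ w).continuousAt.pow 3)
      (pow_ne_zero 3 (den_ne_zero _ hw))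
  exact continuous_hessianIm.continuousAt.comp
    (((continuous_psi₁ i.2).continuousAt.comp h1).prodMk
      (((continuous_psi₂ i.2).continuousAt.comp h1).prodMk (h2.prodMk h3)))

lemma norm_parTerm₁_le (i : CuspPt Γ × NonzeroInt) (z : ℍ) :
    ‖parTerm₁ h i z‖ ≤ 8 / z.im * (cuspHeight h i.1 z ^ 2 * ((i.2.1 : ℝ) ^ 2)⁻¹) := by
  have hz := z.im_pos
  have h0 := cuspHeight_pos h i.1 z
  rw [parTerm₁, norm_smul, Real.norm_eq_abs, im_moeb_cuspScal]
  have h1 : ‖imMul (1 / den (cuspScal h i.1)⁻¹ (z : ℂ) ^ 2)‖ ≤ cuspHeight h i.1 z / z.im :=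
    (norm_imMul_le _).trans_eq (norm_inv_den_sq (det_cuspScal_inv h i.1) z)
  calc _ ≤ 8 * cuspHeight h i.1 z * ((i.2.1 : ℝ) ^ 2)⁻¹ * (cuspHeight h i.1 z / z.im) := by
        gcongr
        exact abs_psi₁_le i.2 h0.le
    _ = _ := by ring

lemma norm_parTerm₂_le (i : CuspPt Γ × NonzeroInt) (z : ℍ) :
    ‖parTerm₂ h i z‖ ≤ 24 / z.im ^ 2 * (cuspHeight h i.1 z ^ 2 * ((i.2.1 : ℝ) ^ 2)⁻¹) := by
  have hz := z.im_pos
  have h0 := cuspHeight_pos h i.1 z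
  refine (norm_hessianIm_le _ _ _ _).trans ?_
  rw [im_moeb_cuspScal, norm_inv_den_sq (det_cuspScal_inv h i.1) z]
  calc _ ≤ 8 * cuspHeight h i.1 z * ((i.2.1 : ℝ) ^ 2)⁻¹ * (2 * cuspHeight h i.1 z / z.im ^ 2) +
        8 * ((i.2.1 : ℝ) ^ 2)⁻¹ * (cuspHeight h i.1 z / z.im) ^ 2 := by
        gcongr
        · exact abs_psi₁_le i.2 h0.le
        · exact norm_deriv_inv_den_sq_le (det_cuspScal_inv h i.1) z
        · exact abs_psi₂_le i.2 _
        · rfl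
    _ = _ := by ring

/-- The unit ball of `ℍ` around `z`, as a subset of `ℂ`. -/
def unitNhd (z : ℍ) : Set ℂ := ((↑) : ℍ → ℂ) '' Metric.ball z 1

lemma isOpen_unitNhd (z : ℍ) : IsOpen (unitNhd z) := by
  rw [unitNhd, image_coe_ball]
  exact Metric.isOpen_ball

lemma isPreconnected_unitNhd (z : ℍ) : IsPreconnected (unitNhd z) := by
  rw [unitNhd, image_coe_ball]
  exact (convex_ball _ _).isPreconnected

lemma mem_unitNhd (z : ℍ) : (z : ℂ) ∈ unitNhd z := ⟨z, Metric.mem_ball_self one_pos, rfl⟩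

lemma im_le_of_dist_lt {z w : ℍ} (hw : dist w z < 1) : w.im ≤ z.im * Real.exp 1 := by
  refine (im_le_im_mul_exp_dist w z).trans ?_
  gcongr

/-- A Harnack-type bound: summability at the centre `z` gives a summable majorant on the whole unit
ball. -/
lemma cuspHeight_le_of_dist_lt (c : CuspPt Γ) {z w : ℍ} (hw : dist w z < 1) :
    cuspHeight h c w ≤ cuspHeight h c z * Real.exp 1 :=
  im_le_of_dist_lt (by rwa [dist_smul_smul (det_cuspScal_inv h c)])

lemma tsum_parTerm (z : ℍ) : ∑' i, parTerm h i z = parSum Γ z := by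
  rw [parSum, ← (parabolicEquiv h).tsum_eq]
  refine tsum_congr fun i => ?_
  rw [greenH_parabolicEquiv, parTerm, im_moeb_cuspScal]

lemma parSum_ofComplex_eventuallyEq (z : ℍ) :
    (fun w : ℂ => parSum Γ (ofComplex w)) =ᶠ[nhds (z : ℂ)] fun w => ∑' i, parTerm h i w := by
  filter_upwards [(isOpen_unitNhd z).mem_nhds (mem_unitNhd z)]
  rintro _ ⟨w, -, rfl⟩
  rw [ofComplex_apply, tsum_parTerm]

/-- The derivatives of the terms of `parSum` are dominated near each point by summable sequences. -/
lemma exists_summable_bound (z : ℍ) : ∃ b b' : CuspPt Γ × NonzeroInt → ℝ, Summable b ∧ Summable b' ∧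
    (∀ i, ∀ w ∈ unitNhd z, ‖parTerm₁ h i w‖ ≤ b i) ∧
    ∀ i, ∀ w ∈ unitNhd z, ‖parTerm₂ h i w‖ ≤ b' i := by
  have hs := summable_cuspHeight_sq_mul h z
  have hz := z.im_pos
  refine ⟨fun i => 8 / (z.im / Real.exp 1) * Real.exp 1 ^ 2 *
      (cuspHeight h i.1 z ^ 2 * ((i.2.1 : ℝ) ^ 2)⁻¹),
    fun i => 24 / (z.im / Real.exp 1) ^ 2 * Real.exp 1 ^ 2 *
      (cuspHeight h i.1 z ^ 2 * ((i.2.1 : ℝ) ^ 2)⁻¹), hs.mul_left _, hs.mul_left _, ?_, ?_⟩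
  all_goals
    rintro i _ ⟨w, hw, rfl⟩
    have h1 := cuspHeight_le_of_dist_lt h i.1 hw
    have h0 := (cuspHeight_pos h i.1 w).le
    have h2 : z.im / Real.exp 1 ≤ w.im := by
      rw [div_le_iff₀ (Real.exp_pos 1)]
      exact im_le_of_dist_lt (by rw [dist_comm]; exact hw)
  · calc _ ≤ _ := norm_parTerm₁_le h i w
      _ ≤ 8 / (z.im / Real.exp 1) *
          ((cuspHeight h i.1 z * Real.exp 1) ^ 2 * ((i.2.1 : ℝ) ^ 2)⁻¹) := by gcongr
      _ = _ := by ring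
  · calc _ ≤ _ := norm_parTerm₂_le h i w
      _ ≤ 24 / (z.im / Real.exp 1) ^ 2 *
          ((cuspHeight h i.1 z * Real.exp 1) ^ 2 * ((i.2.1 : ℝ) ^ 2)⁻¹) := by gcongr
      _ = _ := by ring

lemma summable_parTerm (z : ℍ) : Summable fun i => parTerm h i z :=
  (summable_psi_cuspHeight h z).congr fun i => by rw [parTerm, im_moeb_cuspScal]

lemma im_pos_of_mem_unitNhd {z : ℍ} {w : ℂ} (hw : w ∈ unitNhd z) : 0 < w.im := by
  obtain ⟨w, -, rfl⟩ := hw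
  exact w.im_pos

lemma contDiffOn_parSum (h : IsLocFinite Γ) :
    ContDiffOn ℝ 2 (fun w : ℂ => parSum Γ (ofComplex w)) {w : ℂ | 0 < w.im} := by
  intro w hw
  obtain ⟨b, b', hb, hb', h1, h2⟩ := exists_summable_bound h ⟨w, hw⟩
  have h3 := contDiffOn_two_tsum (isOpen_unitNhd _) (isPreconnected_unitNhd _)
    (fun i x hx => hasFDerivAt_parTerm h i (im_pos_of_mem_unitNhd hx)) hb h1
    (fun i x hx => hasFDerivAt_parTerm₁ h i (im_pos_of_mem_unitNhd hx)) hb' h2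
    (fun i x hx => (continuousAt_parTerm₂ h i (im_pos_of_mem_unitNhd hx)).continuousWithinAt)
    (mem_unitNhd _) (summable_parTerm h _)
  have h4 := h3.contDiffAt ((isOpen_unitNhd _).mem_nhds (mem_unitNhd ⟨w, hw⟩))
  exact (h4.congr_of_eventuallyEq (parSum_ofComplex_eventuallyEq h ⟨w, hw⟩)).contDiffWithinAt

lemma summable_psi₂_cuspHeight (z : ℍ) : Summable fun i : CuspPt Γ × NonzeroInt =>
    cuspHeight h i.1 z ^ 2 * psi₂ i.2.1 (cuspHeight h i.1 z) := by
  refine Summable.of_norm_bounded ((summable_cuspHeight_sq_mul h z).mul_left 8) fun i => ?_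
  rw [norm_mul, Real.norm_eq_abs, Real.norm_eq_abs, abs_of_nonneg (sq_nonneg _)]
  calc _ ≤ cuspHeight h i.1 z ^ 2 * (8 * ((i.2.1 : ℝ) ^ 2)⁻¹) := by
        gcongr
        exact abs_psi₂_le i.2 _
    _ = _ := by ring

/-- Conformal invariance of the hyperbolic Laplacian: `y² |g'|²` is the square of the height. -/
lemma parTerm₂_trace (i : CuspPt Γ × NonzeroInt) (z : ℍ) :
    z.im ^ 2 * (parTerm₂ h i z 1 1 + parTerm₂ h i z Complex.I Complex.I) =
      cuspHeight h i.1 z ^ 2 * psi₂ i.2.1 (cuspHeight h i.1 z) := by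
  have hz := z.im_pos.ne'
  rw [parTerm₂, hessianIm_trace, im_moeb_cuspScal, norm_inv_den_sq (det_cuspScal_inv h i.1) z]
  rw [show ((cuspScal h i.1)⁻¹ • z).im = cuspHeight h i.1 z from rfl, div_pow, mul_left_comm,
    mul_div_cancel₀ _ (pow_ne_zero 2 hz), mul_comm]

lemma hasSum_apply_apply {ι : Type*} {D : ι → ℂ →L[ℝ] ℂ →L[ℝ] ℝ} (hD : Summable D) (v w : ℂ) :
    HasSum (fun i => D i v w) ((∑' i, D i) v w) :=
  (ContinuousLinearMap.apply ℝ ℝ w).hasSum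
    ((ContinuousLinearMap.apply ℝ (ℂ →L[ℝ] ℝ) v).hasSum hD.hasSum)

lemma summable_of_norm_le {ι F : Type*} [NormedAddCommGroup F] [CompleteSpace F] {D : ι → F}
    {b : ι → ℝ} (hb : Summable b) (hD : ∀ i, ‖D i‖ ≤ b i) : Summable D :=
  Summable.of_norm_bounded hb hD

lemma summable_parTerm₂ (z : ℍ) : Summable fun i => parTerm₂ h i z := by
  obtain ⟨b, b', hb, hb', h1, h2⟩ := exists_summable_bound h z
  exact summable_of_norm_le (F := ℂ →L[ℝ] ℂ →L[ℝ] ℝ) hb' fun i => h2 i z (mem_unitNhd z)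

lemma hasFDerivAt_fderiv_parSum (z : ℍ) :
    HasFDerivAt (fderiv ℝ fun w => ∑' i, parTerm h i w) (∑' i, parTerm₂ h i z) (z : ℂ) := by
  obtain ⟨b, b', hb, hb', h1, h2⟩ := exists_summable_bound h z
  have hf : ∀ i, ∀ x ∈ unitNhd z, HasFDerivAt (parTerm h i) (parTerm₁ h i x) x :=
    fun i x hx => hasFDerivAt_parTerm h i (im_pos_of_mem_unitNhd hx)
  have hf' : ∀ i, ∀ x ∈ unitNhd z, HasFDerivAt (parTerm₁ h i) (parTerm₂ h i x) x :=
    fun i x hx => hasFDerivAt_parTerm₁ h i (im_pos_of_mem_unitNhd hx)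
  exact hasFDerivAt_fderiv_tsum (isOpen_unitNhd z) (isPreconnected_unitNhd z) hf hb h1 hf' hb' h2
    (mem_unitNhd z) (summable_parTerm h z) z (mem_unitNhd z)

lemma hypLaplacian_parSum (z : ℍ) : hypLaplacian (parSum Γ) z =
    -∑' i : CuspPt Γ × NonzeroInt, cuspHeight h i.1 z ^ 2 * psi₂ i.2.1 (cuspHeight h i.1 z) := by
  have hs := summable_parTerm₂ h z
  have h3 := hasFDerivAt_fderiv_parSum h z
  have h4 := ((hasSum_apply_apply hs 1 1).add
    (hasSum_apply_apply hs Complex.I Complex.I)).mul_left (z.im ^ 2)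
  have h5 := (InnerProductSpace.laplacian_congr_nhds
    (parSum_ofComplex_eventuallyEq h z)).eq_of_nhds
  rw [hypLaplacian, h5, laplacian_of_hasFDerivAt h3, neg_mul, ← h4.tsum_eq]
  exact congrArg Neg.neg (tsum_congr fun i => parTerm₂_trace h i z)

/-- The bound for `|Δ P_X|`, the same for all surfaces. -/
def auxConst : ℝ≥0∞ :=
  ENNReal.ofReal 2 + ENNReal.ofReal (8 * ∑' n : NonzeroInt, ((n.1 : ℝ) ^ 2)⁻¹) * horoConst 1

lemma auxConst_ne_top : auxConst ≠ ∞ :=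
  ENNReal.add_ne_top.mpr
    ⟨ENNReal.ofReal_ne_top, ENNReal.mul_ne_top ENNReal.ofReal_ne_top (horoConst_ne_top 1)⟩

/-- The bound used at cusps of height at most one, where a constant bound would not be summable over
the cusps. -/
lemma abs_tsum_psi₂_le (t : ℝ) : |∑' n : NonzeroInt, t ^ 2 * psi₂ n t| ≤
    8 * (∑' n : NonzeroInt, ((n.1 : ℝ) ^ 2)⁻¹) * t ^ 2 := by
  have h1 : HasSum (fun n : NonzeroInt => 8 * t ^ 2 * ((n.1 : ℝ) ^ 2)⁻¹)
      (8 * (∑' n : NonzeroInt, ((n.1 : ℝ) ^ 2)⁻¹) * t ^ 2) := by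
    have := summable_inv_sq_nonzeroInt.hasSum.mul_left (8 * t ^ 2)
    rwa [mul_right_comm] at this
  rw [← Real.norm_eq_abs]
  refine tsum_of_norm_bounded h1 fun n => ?_
  rw [norm_mul, Real.norm_eq_abs, Real.norm_eq_abs, abs_of_nonneg (sq_nonneg t)]
  calc _ ≤ t ^ 2 * (8 * ((n.1 : ℝ) ^ 2)⁻¹) := by
        gcongr
        exact abs_psi₂_le n t
    _ = _ := by ring

lemma tsum_ite_height_le (z : ℍ) :
    ∑' c, (if 1 < cuspHeight h c z then ENNReal.ofReal 2 else 0) ≤ ENNReal.ofReal 2 := by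
  by_cases h0 : ∃ c, 1 < cuspHeight h c z
  · obtain ⟨c, hc⟩ := h0
    rw [tsum_eq_single c fun d hd => if_neg fun hd' => hd (eq_of_one_lt_cuspHeight h hd' hc),
      if_pos hc]
  · push Not at h0
    simp [fun c => (h0 c).not_gt]

lemma tsum_ite_height_sq_le (z : ℍ) :
    ∑' c, (if 1 < cuspHeight h c z then 0 else ENNReal.ofReal (cuspHeight h c z ^ 2)) ≤
      horoConst 1 := by
  have h1 := tsum_height_sq_le (fun c : {c // cuspHeight h c z ≤ 1} => cuspScal h c.1)
    (fun c => (isScaling_cuspScal h c.1).det)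
    (fun c d w hc hd => Subtype.ext (eq_of_one_lt_cuspHeight h hc hd)) z (fun c => c.2)
  refine le_of_eq_of_le ?_ h1
  rw [← tsum_subtype_eq_of_support_subset (s := {c | cuspHeight h c z ≤ 1})]
  · refine tsum_congr fun c => ?_
    rw [if_neg (not_lt.mpr c.2)]
    rfl
  · intro c hc
    by_contra h2
    exact hc (if_pos (not_le.mp h2))

/-- The at most one cusp above height one contributes at most `2`; the cusps below contribute
`O(t²)` each, summed by the packing estimate with height bound `1`. -/
lemma constParAux_le (h : IsLocFinite Γ) : constParAux Γ ≤ auxConst := by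
  refine iSup_le fun z => ?_
  set Z := ∑' n : NonzeroInt, ((n.1 : ℝ) ^ 2)⁻¹ with hZ
  have hZ0 : 0 ≤ Z := tsum_nonneg fun n => inv_nonneg.mpr (sq_nonneg _)
  -- Absolute convergence permits summing over the integers first, so that the absolute value is
  -- taken only after the cancellation at each cusp.
  rw [hypLaplacian_parSum h, abs_neg, (summable_psi₂_cuspHeight h z).tsum_prod,
    ← Real.enorm_eq_ofReal_abs]
  refine (enorm_tsum_le_tsum_enorm).trans ?_
  calc _ ≤ ∑' c, ((if 1 < cuspHeight h c z then ENNReal.ofReal 2 else 0) +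
        ENNReal.ofReal (8 * Z) *
          (if 1 < cuspHeight h c z then 0 else ENNReal.ofReal (cuspHeight h c z ^ 2))) := by
        refine ENNReal.tsum_le_tsum fun c => ?_
        rw [Real.enorm_eq_ofReal_abs]
        split_ifs with hc
        · rw [mul_zero, add_zero]
          exact ENNReal.ofReal_le_ofReal (tsum_psi₂_bound (cuspHeight_pos h c z))
        · rw [zero_add, ← ENNReal.ofReal_mul (by positivity)]
          exact ENNReal.ofReal_le_ofReal (abs_tsum_psi₂_le (cuspHeight h c z))
    _ ≤ _ := by
        rw [ENNReal.tsum_add, ENNReal.tsum_mul_left]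
        exact add_le_add (tsum_ite_height_le h z) (mul_le_mul_right (tsum_ite_height_sq_le h z) _)

end ParSum

/-! ### The uniform bound -/

/-- A bound for the constants of a surface in terms of its geometric data. -/
def boundConst (ε : ℝ) (m : ℕ) (v : ℝ≥0∞) : ℝ≥0∞ :=
  horoConst (commonHeight ε) + auxConst + (m : ℝ≥0∞) ^ 2 + 5 * (m : ℝ≥0∞) ^ 2 * m * v⁻¹ +
    (m : ℝ≥0∞) ^ 2 * (m * ballConst (commonRadius ε))

lemma boundConst_ne_top {ε : ℝ} (hε : 0 < ε) (m : ℕ) {v : ℝ≥0∞} (hv : v ≠ 0) :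
    boundConst ε m v ≠ ∞ := by
  have hm : (m : ℝ≥0∞) ≠ ∞ := ENNReal.natCast_ne_top m
  have hm2 : (m : ℝ≥0∞) ^ 2 ≠ ∞ := ENNReal.pow_ne_top hm
  refine ENNReal.add_ne_top.mpr ⟨ENNReal.add_ne_top.mpr ⟨ENNReal.add_ne_top.mpr
    ⟨ENNReal.add_ne_top.mpr ⟨horoConst_ne_top _, auxConst_ne_top⟩, hm2⟩, ?_⟩, ?_⟩
  · exact ENNReal.mul_ne_top (ENNReal.mul_ne_top (ENNReal.mul_ne_top (by norm_num) hm2) hm)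
      (ENNReal.inv_ne_top.mpr hv)
  · exact ENNReal.mul_ne_top hm2 (ENNReal.mul_ne_top hm (ballConst_ne_top (commonRadius_pos hε)))

lemma IsAdmissible.one_le_genus {𝒩 : Set ℕ} {Γ : ℕ → PSLSubgroup} {q : ℕ}
    (h : IsAdmissible 𝒩 Γ q) {N : ℕ} (hN : N ∈ 𝒩) : 1 ≤ genus (Γ N) := by
  cases h with
  | tower _ surface _ => exact (surface N).one_le_genus
  | modular _ _ _ _ _ _ _ one_le_genus _ => exact one_le_genus N hN

/-- The bounds for all the constants of a surface with given geometric data. -/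
lemma GeomBound.bounds {Γ : PSLSubgroup} {ε : ℝ} {m : ℕ} {v : ℝ≥0∞} (h : GeomBound Γ ε m v)
    (hε : 0 < ε) (hg : 1 ≤ genus Γ) {C : ℝ≥0∞} (hC : boundConst ε m v ≤ C) :
    (∀ (M : Marking Γ) (F : Set ℍ), M.IsFundamentalDomain F → M.constPar F ≤ C) ∧
    ((∀ z : ℍ, Summable fun γ : parabolics Γ => greenH z (γ.1 • z)) ∧
      ContDiffOn ℝ 2 (fun w : ℂ => parSum Γ (ofComplex w)) {w : ℂ | 0 < w.im} ∧
      constParAux Γ ≤ C) ∧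
    (∀ M : Marking Γ, M.smallConstEll ≤ C ∧
      5 * M.smallConstEll / (genus Γ * hypVol Γ) * ∑' e : M.ells, ((order Γ e - 1 : ℕ) : ℝ≥0∞) ≤
        C * ((M.ells.encard : ℝ≥0∞) / genus Γ)) ∧
    (∀ (M : Marking Γ) (F : Set ℍ), M.IsFundamentalDomain F → M.constEll F ≤ C) := by
  have h5 := le_add_self.trans hC
  have h1234 := le_self_add.trans hC
  have h4 := le_add_self.trans h1234
  have h123 := le_self_add.trans h1234
  have h3 := le_add_self.trans h123
  have h12 := le_self_add.trans h123
  refine ⟨fun M F hF => (h.constPar_le hε M F hF).trans (le_self_add.trans h12),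
    ⟨summable_greenH h.locFinite, contDiffOn_parSum h.locFinite,
      (constParAux_le h.locFinite).trans (le_add_self.trans h12)⟩,
    fun M => ⟨(h.smallConstEll_le M).trans h3, (h.sum_order_le M hg).trans ?_⟩,
    fun M F hF => (h.constEll_le hε M F hF).trans h5⟩
  gcongr

end Orbisurface

end

open Orbisurface in
theorem mainTheorem8 (Γq : PSLSubgroup) :
    ∃ C : ℝ≥0, ∀ (𝒩 : Set ℕ) (Γ : ℕ → PSLSubgroup) (q : ℕ),
      IsAdmissible 𝒩 Γ q → Γ q = Γq → ∀ N ∈ 𝒩,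
        (∀ (M : Marking (Γ N)) (F : Set ℍ), M.IsFundamentalDomain F → M.constPar F ≤ C) ∧
        ((∀ z : ℍ, Summable fun γ : parabolics (Γ N) => greenH z (γ.1 • z)) ∧
          ContDiffOn ℝ 2 (fun w : ℂ => parSum (Γ N) (ofComplex w)) {w : ℂ | 0 < w.im} ∧
          constParAux (Γ N) ≤ C) ∧
        (∀ M : Marking (Γ N), M.smallConstEll ≤ C ∧
          5 * M.smallConstEll / (genus (Γ N) * hypVol (Γ N)) *
              ∑' e : M.ells, ((order (Γ N) e - 1 : ℕ) : ℝ≥0∞) ≤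
            C * ((M.ells.encard : ℝ≥0∞) / genus (Γ N))) ∧
        (∀ (M : Marking (Γ N)) (F : Set ℍ), M.IsFundamentalDomain F → M.constEll F ≤ C) := by
  obtain ⟨ε, hε, m, v, hv, ε', hε', m', v', hv', h⟩ := exists_geomBound_of_isAdmissible Γq
  have hC : boundConst ε m v + boundConst ε' m' v' ≠ ∞ :=
    ENNReal.add_ne_top.mpr ⟨boundConst_ne_top hε m hv, boundConst_ne_top hε' m' hv'⟩
  refine ⟨(boundConst ε m v + boundConst ε' m' v').toNNReal, fun 𝒩 Γ q hA hq N hN => ?_⟩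
  rw [ENNReal.coe_toNNReal hC]
  rcases h 𝒩 Γ q hA hq N hN with hG | hG
  · exact hG.bounds hε (hA.one_le_genus hN) le_self_add
  · exact hG.bounds hε' (hA.one_le_genus hN) le_add_self
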